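/- Let $\mathcal M$ be a finite-dimensional smooth Riemannian manifold, $F$ a smooth vector field on $\mathcal M$ with smooth flow $f^t$, $t\in\mathbb R$, and $K\subset\mathcal M$ a compact $f^t$-invariant set (for instance an attractor) on which $F\neq0$ and which is hyperbolic: there is a continuous $f_*^t$-invariant splitting $T_K\mathcal M=V^s\oplus V^u\oplus V^c$ with $V^c=\operatorname{span}F$, and there are constants $C>0$, $0<\lambda<1$ with $|f_*^{t}w|\le C\lambda^t|w|$ for $w\in V^s$ and $|f_*^{-t}w|\le C\lambda^t|w|$ for $w\in V^u$, $t\ge0$. Let $P^s,P^u,P^c$ be the projections of the splitting, $f^{*t}$ the adjoint of $f_*^t$, $(\cdot)_t=(\cdot)\circ f^t$, and for a covector field $\omega$ put $\omega^s=\omega\circ P^s$, $\omega^u=\omega\circ P^u$. Let $\rho$ be an $f^t$-invariant Borel probability measure on $K$ (for instance the SRB measure of an attractor), $\rho(g)=\int g\,d\rho$. Let $C^\alpha$, $\mathcal X^\alpha$, $\mathcal X^{*\alpha}$ be the spaces of functions, vector fields and covector fields on $K$ that are Hölder continuous for some positive exponent, and write $\mathcal L_F$ for the Lie derivative along the flow: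 $\mathcal L_Fv=\frac{d}{dt}\big|_{0}(f^t_*)^{-1}v_t$ for vector fields, $\mathcal L_F\nu=\frac{d}{dt}\big|_{0}f^{*t}\nu_t$ for covector fields, and $F(\psi)=\frac{d}{dt}\big|_{0}\psi_t$ for functions. Let $$\mathcal A=\{(\omega,\psi)\in\mathcal X^{*\alpha}\times C^\alpha: F(\psi)=\omega(F)\}.$$ A shadowing pair of $X\in\mathcal X^\alpha$ is a pair $(v,\eta)\in\mathcal X^\alpha\times C^\alpha$ with $\mathcal L_Fv+\eta F=X$; put $\langle\!\langle v,\eta;\omega,\psi\rangle\!\rangle=\rho(\omega v)-\rho(\eta\psi)$. Let $\varepsilon^c$ be the covector field on $K$ with $P^cw=\varepsilon^c(w)F$. Then every $X\in\mathcal X^\alpha$ has a shadowing pair; $\varepsilon^c$ satisfies $\mathcal L_F\varepsilon^c=0$, $\varepsilon^c\circ P^c=\varepsilon^c$ and $\varepsilon^c(F)=1$; and there is a linear operator $\mathcal S:\mathcal A\to\mathcal X^{*\alpha}$ with the following properties. (a) For all $(\omega,\psi)\in\mathcal A$, all $X\in\mathcal X^\alpha$ and all shadowing pairs $(v,\eta)$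 of $X$, $\langle\!\langle v,\eta;\omega,\psi\rangle\!\rangle=\rho(X\,\mathcal S(\omega,\psi))$. For fixed $(\omega,\psi)\in\mathcal A$, a covector field $\nu\in\mathcal X^{*\alpha}$ has this property in place of $\mathcal S(\omega,\psi)$ if and only if $\nu=\mathcal S(\omega,\psi)$ $\rho$-almost everywhere. Hence, if $\rho$ has full support in $K$, $\mathcal S$ is the only linear operator $\mathcal A\to\mathcal X^{*\alpha}$ with this property. (b) $\mathcal S(\omega,\psi)=\int_{t\ge0}f^{*t}\omega^s_t\,dt-\int_{t\le0}f^{*t}\omega^u_t\,dt-\psi\,\varepsilon^c$, with absolutely convergent integrals. (c) $\nu=\mathcal S(\omega,\psi)$ is the unique bounded covector field on $K$ with $\mathcal L_F\nu=-\omega$ and $\nu(F)=-\psi$. Also along each single orbit $(f^tx)_{t\in\mathbb R}$, $x\in K$, the covectors $\mathcal S(\omega,\psi)(f^tx)$ are the unique bounded solution $\nu_t\in T^*_{f^tx}\mathcal M$ of $\mathcal L_F\nu=-\omega$ that satisfies $\nu_\tau(F_\tau)=-\psi_\tau$ for some $\tau$, equivalently for all $\tau$. Moreover, for every smooth $\Phi:\mathcal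 M\to\mathbb R$ the pair $(d\Phi,\Phi-\rho(\Phi))$ belongs to $\mathcal A$; with $\nu=\mathcal S(d\Phi,\Phi-\rho(\Phi))$ and $X\in\mathcal X^\alpha$, the shadowing contribution $SC=\langle\!\langle v,\eta;d\Phi,\Phi-\rho(\Phi)\rangle\!\rangle$, for any shadowing pair $(v,\eta)$ of $X$, equals $\rho(X\nu)$, and if $\rho$ is ergodic, then for $\rho$-almost every $x\in K$ $$SC=\lim_{T\to\infty}\frac1T\int_0^T\nu(X)(f^tx)\,dt .$$ -/

import Mathlib

open Set Filter MeasureTheory Manifold Bundle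
open scoped Topology ContDiff

noncomputable section

namespace AdjointShadowing

section Holder

variable {E : Type*} [NormedAddCommGroup E] [NormedSpace ℝ E]
  {M : Type*} [TopologicalSpace M] [ChartedSpace E M]
  {G : Type*} [NormedAddCommGroup G] {K : Set M}

/-- Local Hölder continuity. The function `u x₀ : K → G` is the expression, in the chart of `M`
centred at `x₀`, of some field on `K`; the field is Hölder if there is one exponent `r > 0` such
that every `u x₀` is `r`-Hölder, with respect to the distance in that chart, for pairs of points
of `K` close to `x₀`. On a compact `K` this is the same as being globally Hölder for some
exponent. -/
def IsHolder (u : K → K → G) : Prop :=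
  ∃ r : ℝ, 0 < r ∧ ∀ x₀ : K, ∃ C : ℝ, ∀ᶠ p : K × K in 𝓝 (x₀, x₀),
    ‖u x₀ p.1 - u x₀ p.2‖ ≤
      C * ‖extChartAt 𝓘(ℝ, E) (x₀ : M) p.1 - extChartAt 𝓘(ℝ, E) (x₀ : M) p.2‖ ^ r

theorem IsHolder.zero : IsHolder (E := E) (fun _ _ => 0 : K → K → G) :=
  ⟨1, one_pos, fun _ => ⟨0, by simp⟩⟩

theorem IsHolder.smul [NormedSpace ℝ G] {u : K → K → G} (hu : IsHolder (E := E) u) (c : ℝ) :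
    IsHolder (E := E) (fun x₀ x => c • u x₀ x) := by
  obtain ⟨r, hr, h⟩ := hu
  refine ⟨r, hr, fun x₀ => ?_⟩
  obtain ⟨C, hC⟩ := h x₀
  refine ⟨|c| * C, ?_⟩
  filter_upwards [hC] with p hp
  rw [← smul_sub, norm_smul, mul_assoc, Real.norm_eq_abs]
  exact mul_le_mul_of_nonneg_left hp (abs_nonneg c)

/-- The distance in the chart centred at `x₀` is at most `1` close to `x₀`. -/
theorem eventually_chart_le_one (x₀ : K) : ∀ᶠ p : K × K in 𝓝 (x₀, x₀),
    ‖extChartAt 𝓘(ℝ, E) (x₀ : M) p.1 - extChartAt 𝓘(ℝ, E) (x₀ : M) p.2‖ ≤ 1 := by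
  have hc : ContinuousAt (fun x : K => extChartAt 𝓘(ℝ, E) (x₀ : M) x) x₀ :=
    (continuousAt_extChartAt (I := 𝓘(ℝ, E)) (x₀ : M)).comp continuousAt_subtype_val
  have h1 : Tendsto (fun p : K × K => extChartAt 𝓘(ℝ, E) (x₀ : M) p.1) (𝓝 (x₀, x₀))
      (𝓝 (extChartAt 𝓘(ℝ, E) (x₀ : M) x₀)) := hc.tendsto.comp continuousAt_fst
  have h2 : Tendsto (fun p : K × K => extChartAt 𝓘(ℝ, E) (x₀ : M) p.2) (𝓝 (x₀, x₀))
      (𝓝 (extChartAt 𝓘(ℝ, E) (x₀ : M) x₀)) := hc.tendsto.comp continuousAt_snd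
  have h := (h1.sub h2).norm
  rw [sub_self, norm_zero] at h
  exact h.eventually (eventually_le_nhds one_pos)

theorem IsHolder.add {u v : K → K → G} (hu : IsHolder (E := E) u) (hv : IsHolder (E := E) v) :
    IsHolder (E := E) (fun x₀ x => u x₀ x + v x₀ x) := by
  obtain ⟨r, hr, h⟩ := hu
  obtain ⟨s, hs, k⟩ := hv
  refine ⟨min r s, lt_min hr hs, fun x₀ => ?_⟩
  obtain ⟨C, hC⟩ := h x₀
  obtain ⟨D, hD⟩ := k x₀
  refine ⟨|C| + |D|, ?_⟩
  filter_upwards [hC, hD, eventually_chart_le_one (E := E) x₀] with p hp hq h1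
  set d := ‖extChartAt 𝓘(ℝ, E) (x₀ : M) p.1 - extChartAt 𝓘(ℝ, E) (x₀ : M) p.2‖ with hd
  have hd0 : 0 ≤ d := norm_nonneg _
  have hm : 0 ≤ min r s := (lt_min hr hs).le
  have e1 : d ^ r ≤ d ^ min r s :=
    Real.rpow_le_rpow_of_exponent_ge' hd0 h1 hm (min_le_left _ _)
  have e2 : d ^ s ≤ d ^ min r s :=
    Real.rpow_le_rpow_of_exponent_ge' hd0 h1 hm (min_le_right _ _)
  have p1 : 0 ≤ d ^ r := Real.rpow_nonneg hd0 _
  have p2 : 0 ≤ d ^ s := Real.rpow_nonneg hd0 _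
  calc ‖u x₀ p.1 + v x₀ p.1 - (u x₀ p.2 + v x₀ p.2)‖
      ≤ ‖u x₀ p.1 - u x₀ p.2‖ + ‖v x₀ p.1 - v x₀ p.2‖ := by
        rw [add_sub_add_comm]; exact norm_add_le _ _
    _ ≤ C * d ^ r + D * d ^ s := add_le_add hp hq
    _ ≤ |C| * d ^ r + |D| * d ^ s :=
        add_le_add (mul_le_mul_of_nonneg_right (le_abs_self _) p1)
          (mul_le_mul_of_nonneg_right (le_abs_self _) p2)
    _ ≤ |C| * d ^ min r s + |D| * d ^ min r s :=
        add_le_add (mul_le_mul_of_nonneg_left e1 (abs_nonneg _))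
          (mul_le_mul_of_nonneg_left e2 (abs_nonneg _))
    _ = (|C| + |D|) * d ^ min r s := by ring

end Holder

section Fields

variable (E : Type*) [NormedAddCommGroup E] [NormedSpace ℝ E]
  {M : Type*} [TopologicalSpace M] [ChartedSpace E M] [IsManifold 𝓘(ℝ, E) ∞ M]

/-- The space `C^α(K)` of Hölder functions on `K`. -/
def HolderFun (K : Set M) : Submodule ℝ (K → ℝ) where
  carrier := {ψ | IsHolder (E := E) (fun _ x => ψ x)}
  zero_mem' := IsHolder.zero
  add_mem' h k := h.add k
  smul_mem' c _ h := h.smul c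

/-- The space `𝒳^α(K)` of Hölder vector fields on `K`. -/
def HolderVec (K : Set M) : Submodule ℝ ((x : K) → TangentSpace 𝓘(ℝ, E) (x : M)) where
  carrier := {v | IsHolder (E := E) (fun x₀ x =>
    (trivializationAt E (TangentSpace 𝓘(ℝ, E)) (x₀ : M)).continuousLinearMapAt ℝ (x : M) (v x))}
  zero_mem' := by
    simpa using (IsHolder.zero : IsHolder (E := E) (fun _ _ => 0 : K → K → E))
  add_mem' h k := by
    simp only [Set.mem_ofPred_eq] at h k ⊢
    simpa using h.add k
  smul_mem' c _ h := by
    simp only [Set.mem_ofPred_eq] at h ⊢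
    simpa using h.smul c

/-- The space `𝒳^{*α}(K)` of Hölder covector fields on `K`. -/
def HolderCovec (K : Set M) :
    Submodule ℝ ((x : K) → (TangentSpace 𝓘(ℝ, E) (x : M) →L[ℝ] ℝ)) where
  carrier := {ξ | IsHolder (E := E) (fun x₀ x =>
    (ξ x).comp ((trivializationAt E (TangentSpace 𝓘(ℝ, E)) (x₀ : M)).symmL ℝ (x : M)))}
  zero_mem' := by
    simp only [Set.mem_ofPred_eq, Pi.zero_apply, ContinuousLinearMap.zero_comp]
    exact (IsHolder.zero : IsHolder (E := E) (fun _ _ => 0 : K → K → (E →L[ℝ] ℝ)))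
  add_mem' h k := by
    simp only [Set.mem_ofPred_eq] at h k ⊢
    simpa [ContinuousLinearMap.add_comp, ContinuousLinearMap.smul_comp] using h.add k
  smul_mem' c _ h := by
    simp only [Set.mem_ofPred_eq] at h ⊢
    simpa [ContinuousLinearMap.add_comp, ContinuousLinearMap.smul_comp] using h.smul c

end Fields

/-- A smooth vector field `F` with its flow `f` on a Riemannian manifold `M`, with `F ≠ 0` on a
compact invariant set `K`, and a continuous invariant hyperbolic splitting
`T_K M = V^s ⊕ V^u ⊕ V^c`, where `V^c` is spanned by `F`. -/
structure HyperbolicFlow (E M : Type*) [NormedAddCommGroup E] [NormedSpace ℝ E]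
    [TopologicalSpace M] [ChartedSpace E M] [IsManifold 𝓘(ℝ, E) ∞ M]
    [RiemannianBundle (fun x : M => TangentSpace 𝓘(ℝ, E) x)] where
  /-- the vector field -/
  F : (x : M) → TangentSpace 𝓘(ℝ, E) x
  smooth_F : ContMDiff 𝓘(ℝ, E) 𝓘(ℝ, E).tangent ∞
    (fun x => (⟨x, F x⟩ : TangentBundle 𝓘(ℝ, E) M))
  /-- the flow -/
  f : Flow ℝ M
  smooth_f : ContMDiff (𝓘(ℝ, ℝ).prod 𝓘(ℝ, E)) 𝓘(ℝ, E) ∞ (fun p : ℝ × M => f p.1 p.2)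
  integralCurve : ∀ x, IsMIntegralCurve (I := 𝓘(ℝ, E)) (fun t => f t x) F
  /-- the hyperbolic set -/
  K : Set M
  isCompact_K : IsCompact K
  invariant_K : ∀ t, MapsTo (f t) K K
  F_ne_zero : ∀ x ∈ K, F x ≠ 0
  /-- the stable subspaces -/
  Vs : (x : K) → Submodule ℝ (TangentSpace 𝓘(ℝ, E) (x : M))
  /-- the unstable subspaces -/
  Vu : (x : K) → Submodule ℝ (TangentSpace 𝓘(ℝ, E) (x : M))
  isCompl_s : ∀ x : K, IsCompl (Vs x) (Vu x ⊔ ℝ ∙ F x)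
  isCompl_u : ∀ x : K, IsCompl (Vu x) (Vs x ⊔ ℝ ∙ F x)
  isCompl_c : ∀ x : K, IsCompl (ℝ ∙ F x) (Vs x ⊔ Vu x)
  /- The splitting is continuous: the projections onto its summands are continuous bundle maps. -/
  continuous_s : Continuous (fun w : {w : TangentBundle 𝓘(ℝ, E) M // w.proj ∈ K} =>
    (⟨w.1.proj,
      (Vs ⟨w.1.proj, w.2⟩).projection _ (isCompl_s ⟨w.1.proj, w.2⟩) w.1.2⟩ :
        TangentBundle 𝓘(ℝ, E) M))
  continuous_u : Continuous (fun w : {w : TangentBundle 𝓘(ℝ, E) M // w.proj ∈ K} =>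
    (⟨w.1.proj,
      (Vu ⟨w.1.proj, w.2⟩).projection _ (isCompl_u ⟨w.1.proj, w.2⟩) w.1.2⟩ :
        TangentBundle 𝓘(ℝ, E) M))
  invariant_s : ∀ (t : ℝ) (x : K), ∀ v ∈ Vs x,
    mfderiv 𝓘(ℝ, E) 𝓘(ℝ, E) (f t) (x : M) v ∈ Vs ⟨f t x, invariant_K t x.2⟩
  invariant_u : ∀ (t : ℝ) (x : K), ∀ v ∈ Vu x,
    mfderiv 𝓘(ℝ, E) 𝓘(ℝ, E) (f t) (x : M) v ∈ Vu ⟨f t x, invariant_K t x.2⟩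
  hyperbolic : ∃ C lam : ℝ, 0 < C ∧ 0 < lam ∧ lam < 1 ∧ ∀ (x : K) (t : ℝ), 0 ≤ t →
    (∀ v ∈ Vs x, ‖mfderiv 𝓘(ℝ, E) 𝓘(ℝ, E) (f t) (x : M) v‖ ≤ C * lam ^ t * ‖v‖) ∧
    (∀ v ∈ Vu x, ‖mfderiv 𝓘(ℝ, E) 𝓘(ℝ, E) (f (-t)) (x : M) v‖ ≤ C * lam ^ t * ‖v‖)

namespace HyperbolicFlow

variable {E M : Type*} [NormedAddCommGroup E] [NormedSpace ℝ E] [FiniteDimensional ℝ E]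
  [TopologicalSpace M] [ChartedSpace E M] [IsManifold 𝓘(ℝ, E) ∞ M]
  [RiemannianBundle (fun x : M => TangentSpace 𝓘(ℝ, E) x)]
  (H : HyperbolicFlow E M)

/-- The flow restricted to `K`, `x ↦ f^t x`. -/
abbrev orb (t : ℝ) (x : H.K) : H.K := ⟨H.f t x, H.invariant_K t x.2⟩

/-- The cotangent space at a point of `K`. -/
abbrev Cotan (x : H.K) : Type _ := TangentSpace 𝓘(ℝ, E) (x : M) →L[ℝ] ℝ

/-- The pushforward `f_*^t : T_x M → T_{f^t x} M`. -/
def push (t : ℝ) (x : H.K) :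
    TangentSpace 𝓘(ℝ, E) (x : M) →L[ℝ]
      TangentSpace 𝓘(ℝ, E) (H.orb t x : M) :=
  mfderiv 𝓘(ℝ, E) 𝓘(ℝ, E) (H.f t) (x : M)

/-- The pullback `f^{*t} : T*_{f^t x} M → T*_x M`, adjoint to `f_*^t`. -/
def pull (t : ℝ) (x : H.K) (η : H.Cotan (H.orb t x)) : H.Cotan x := η.comp (H.push t x)

instance (x : M) : FiniteDimensional ℝ (TangentSpace 𝓘(ℝ, E) x) :=
  inferInstanceAs (FiniteDimensional ℝ E)

/-- The oblique projections onto the stable, unstable and center subspaces. -/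
def Ps (x : H.K) :
    TangentSpace 𝓘(ℝ, E) (x : M) →L[ℝ] TangentSpace 𝓘(ℝ, E) (x : M) :=
  ((H.Vs x).projection _ (H.isCompl_s x)).toContinuousLinearMap

def Pu (x : H.K) :
    TangentSpace 𝓘(ℝ, E) (x : M) →L[ℝ] TangentSpace 𝓘(ℝ, E) (x : M) :=
  ((H.Vu x).projection _ (H.isCompl_u x)).toContinuousLinearMap

def Pc (x : H.K) :
    TangentSpace 𝓘(ℝ, E) (x : M) →L[ℝ] TangentSpace 𝓘(ℝ, E) (x : M) :=
  ((ℝ ∙ H.F x).projection _ (H.isCompl_c x)).toContinuousLinearMap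

/-- The center covector field `ε^c`: `P^c w = ε^c(w) F`. -/
def epsc (x : H.K) : H.Cotan x :=
  LinearMap.toContinuousLinearMap
    ((LinearEquiv.coord ℝ (TangentSpace 𝓘(ℝ, E) (x : M)) (H.F x)
        (H.F_ne_zero x x.2)).toLinearMap ∘ₗ
      (ℝ ∙ H.F x).projectionOnto _ (H.isCompl_c x))

/-- `ℒ_F v = w` on `K`, the Lie derivative being `d/dt (f_*^t)⁻¹ v_t` at `t = 0`. -/
def LieVec (v w : (x : H.K) → TangentSpace 𝓘(ℝ, E) (x : M)) : Prop :=
  ∀ x : H.K, HasDerivAt (fun t : ℝ => (H.push t x).inverse (v (H.orb t x))) (w x) 0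

/-- `ℒ_F ν = μ` on `K`, the Lie derivative being `d/dt f^{*t} ν_t` at `t = 0`. -/
def LieCovec (ν μ : (x : H.K) → H.Cotan x) : Prop :=
  ∀ x : H.K, HasDerivAt (fun t : ℝ => H.pull t x (ν (H.orb t x))) (μ x) 0

/-- `F(ψ) = g` on `K`: derivative of a function along the flow. -/
def LieFun (ψ g : H.K → ℝ) : Prop :=
  ∀ x : H.K, HasDerivAt (fun t : ℝ => ψ (H.orb t x)) (g x) 0

/-- The space `𝒜` of pairs `(ω, ψ)` with `F(ψ) = ω(F)`. -/
def A : Submodule ℝ (HolderCovec E H.K × HolderFun E H.K) where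
  carrier := {p | H.LieFun (p.2 : H.K → ℝ) (fun x => (p.1 : (x : H.K) → H.Cotan x) x (H.F x))}
  zero_mem' := fun _ => hasDerivAt_const _ _
  add_mem' h k := fun x => (h x).add (k x)
  smul_mem' c _ h := fun x => (h x).const_mul c

/-- The components of an element `(ω, ψ)` of `𝒜`. -/
abbrev om (p : H.A) : (x : H.K) → H.Cotan x := p.1.1.1

abbrev psi (p : H.A) : H.K → ℝ := p.1.2.1

/-- `(v, η)` is a shadowing pair of `X`, i.e. one of the values of `S(X)`: both are Hölder and
`ℒ_F v + η F = X`, where `ℒ_F v = ∇_F v - ∇_v F`. -/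
def IsShadowingPair (X : HolderVec E H.K) (v : HolderVec E H.K) (η : HolderFun E H.K) : Prop :=
  H.LieVec v.1 (fun x => X.1 x - η.1 x • H.F x)

/-- The product `⟪v, η; ω, ψ⟫ = ρ(ω v) - ρ(η ψ)`. -/
def product [MeasurableSpace M] (ρ : Measure H.K) (v : HolderVec E H.K) (η : HolderFun E H.K)
    (p : H.A) : ℝ :=
  (∫ x, H.om p x (v.1 x) ∂ρ) - ∫ x, η.1 x * H.psi p x ∂ρ

/-- `ν` has the adjoint property for the pair `p = (ω, ψ)`: `⟪S(X); ω, ψ⟫ = ρ(X ν)` for every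
Hölder `X` and every value of `S(X)`. -/
def IsAdjointAt [MeasurableSpace M] (ρ : Measure H.K) (p : H.A) (ν : HolderCovec E H.K) : Prop :=
  ∀ X v η, H.IsShadowingPair X v η → H.product ρ v η p = ∫ x, ν.1 x (X.1 x) ∂ρ

/-- The integrands `f^{*t} ω^s_t` and `f^{*t} ω^u_t` of the split-propagate formula. -/
def stablePart (ξ : (x : H.K) → H.Cotan x) (x : H.K) (t : ℝ) : H.Cotan x :=
  H.pull t x ((ξ (H.orb t x)).comp (H.Ps (H.orb t x)))

def unstablePart (ξ : (x : H.K) → H.Cotan x) (x : H.K) (t : ℝ) : H.Cotan x :=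
  H.pull t x ((ξ (H.orb t x)).comp (H.Pu (H.orb t x)))

/-- `ν` is given by the split-propagate formula
`∫_{t ≥ 0} f^{*t} ω^s_t dt - ∫_{t ≤ 0} f^{*t} ω^u_t dt - ψ ε^c`. The integrals, with values in the
finite-dimensional space `T*_x M`, are written out on vectors `w ∈ T_x M`; they are required to
converge absolutely. -/
def IsSplitPropagate (ξ : (x : H.K) → H.Cotan x) (ψ : H.K → ℝ) (ν : (x : H.K) → H.Cotan x) :
    Prop :=
  ∀ (x : H.K) (w : TangentSpace 𝓘(ℝ, E) (x : M)),
    IntegrableOn (fun t => H.stablePart ξ x t w) (Ici 0) ∧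
    IntegrableOn (fun t => H.unstablePart ξ x t w) (Iic 0) ∧
    ν x w = (∫ t in Ici (0 : ℝ), H.stablePart ξ x t w)
      - (∫ t in Iic (0 : ℝ), H.unstablePart ξ x t w) - ψ x * H.epsc x w

/-- `ν` is a bounded covector field on `K` with `ℒ_F ν = -ω`. -/
def IsBoundedSolution (ξ ν : (x : H.K) → H.Cotan x) : Prop :=
  (∃ C : ℝ, ∀ (x : H.K) (w : TangentSpace 𝓘(ℝ, E) (x : M)), |ν x w| ≤ C * ‖w‖) ∧
    H.LieCovec ν (fun x => -ξ x)

/-- `ν_t ∈ T*_{f^t x} M` is a bounded solution, along the orbit of `x`, of `ℒ_F ν = -ω`; the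
equation is pulled back to the point `x` by the isomorphisms `f^{*t}`. -/
def IsBoundedOrbitSolution (ξ : (x : H.K) → H.Cotan x) (x : H.K)
    (ν : (t : ℝ) → H.Cotan (H.orb t x)) : Prop :=
  (∃ C : ℝ, ∀ (t : ℝ) (w : TangentSpace 𝓘(ℝ, E) (H.orb t x : M)), |ν t w| ≤ C * ‖w‖) ∧
    ∀ t, HasDerivAt (fun s : ℝ => H.pull s x (ν s)) (-H.pull t x (ξ (H.orb t x))) t

/-- Invariance of a measure on `K` under the flow. -/
def IsInvariantMeasure [MeasurableSpace M] (ρ : Measure H.K) : Prop :=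
  ∀ t, MeasurePreserving (H.orb t) ρ ρ

/-- Ergodicity of the flow: flow-invariant measurable sets are null or co-null. -/
def IsErgodicMeasure [MeasurableSpace M] (ρ : Measure H.K) : Prop :=
  ∀ s : Set H.K, MeasurableSet s → (∀ t, H.orb t ⁻¹' s = s) → ρ s = 0 ∨ ρ sᶜ = 0

end HyperbolicFlow

end AdjointShadowing

end

open Set Filter MeasureTheory Manifold Bundle
open scoped Topology ContDiff

noncomputable section

/-! Pulled back to `x`, the equation `ℒ_F ν = -ω` says that `f^{*t} ν_t` has derivative `-f^{*t}
ω_t` in `t`. The stable component is integrated from `+∞` and the unstable one from `-∞`, where the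
pullbacks decay, so both integrals converge. In the center direction `-ψ ε^c` solves the equation,
because `ε^c` is invariant and `F(ψ) = ω(F)`. The difference of two bounded solutions is an
invariant covector, bounded along the orbit. Evaluating it on stable vectors pushed forward and
unstable vectors pushed backward shows that it vanishes on `V^s ⊕ V^u`, and agreement on `F` at one
time removes the rest. Dually, `v = ∫_{t≥0} f_*^t X^s_{-t} dt - ∫_{t≥0} f_*^{-t} X^u_t dt` and `η =
ε^c(X)` form a shadowing pair of `X`.

For adjointness, the derivative of `ν(v)` along the flow is `-ω(v) + ν(X) + ηψ`
(`hasDerivAt_adjField_apply`), and such a derivative has integral zero for an invariant measure.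
Since every Hölder `X` has a shadowing pair, the adjoint property prescribes `ρ(ν X)` for all of
them. Testing a difference of two candidates against fields built from that difference gives
uniqueness almost everywhere.

The analytic work is Hölder regularity. Stable spaces at `x` and `y` are compared after time `T`:
contraction contributes `e^{-aT}`, the divergence of the two cocycles `e^{bT} d(x,y)^r`, and the
best `T` gives a power of the distance (`BddHolder.of_forall_exp`, `HypCocycle.holder_Ps`). The
improper integrals are Hölder because their integrands both decay and have exponentially growing
Hölder constants, and the two bounds can be interpolated (`ExpHolder.integral_Ici`).

To compare linear maps over different points, `K` is embedded in a normed space and `TM` over `K` in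
a trivial bundle, by `J` with left inverse `R`. The derivative becomes the cocycle `A_t = J f_*^t
R`, where `A_0 = J R` is a projection rather than the identity. The estimates are made for an
abstract `HypCocycle`, unstable statements being stable ones for the reversed time, and are
transferred back through `J` and `R`. The time averages use Birkhoff's theorem for continuous
functions, derived here from a maximal inequality. -/

namespace AdjointShadowing

set_option linter.unusedSectionVars false

/-! ### Hölder functions with exponentially growing constants, and their improper integrals. -/

section ExpHolder

variable {K V G G₁ G₂ G₃ : Type*} [NormedAddCommGroup V]
  [NormedAddCommGroup G] [NormedSpace ℝ G] [NormedAddCommGroup G₁] [NormedSpace ℝ G₁]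
  [NormedAddCommGroup G₂] [NormedSpace ℝ G₂] [NormedAddCommGroup G₃] [NormedSpace ℝ G₃]
  {ι : K → V}

/-- A time dependent function `h` on `K` which, like its Hölder constant with respect to the
distance pulled back by `ι`, grows at most exponentially in time. -/
def ExpHolder (ι : K → V) (h : ℝ → K → G) : Prop :=
  ∃ C b r : ℝ, 0 ≤ C ∧ 0 ≤ b ∧ 0 < r ∧ r ≤ 1 ∧
    (∀ t x, ‖h t x‖ ≤ C * Real.exp (b * |t|)) ∧
    ∀ t x y, ‖h t x - h t y‖ ≤ C * Real.exp (b * |t|) * ‖ι x - ι y‖ ^ r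

/-- Bounded Hölder functions with respect to the distance pulled back by `ι`. -/
def BddHolder (ι : K → V) (g : K → G) : Prop := ExpHolder ι (fun _ => g)

/-- Lowering the exponent is harmless at distances at most `1`. At larger distances the increment is
bounded by two sup norms, which is why the constant has to double. -/
theorem ExpHolder.mk_of_le {h : ℝ → K → G} {C b r : ℝ}
    (h1 : ∀ t x, ‖h t x‖ ≤ C * Real.exp (b * |t|))
    (h2 : ∀ t x y, ‖h t x - h t y‖ ≤ C * Real.exp (b * |t|) * ‖ι x - ι y‖ ^ r) (s : ℝ)
    (hsr : s ≤ r) (hs : 0 < s) {C' b' : ℝ} (hC : 2 * |C| ≤ C') (hb : b ≤ b') :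
    (∀ t x, ‖h t x‖ ≤ C' * Real.exp (b' * |t|)) ∧
    ∀ t x y, ‖h t x - h t y‖ ≤ C' * Real.exp (b' * |t|) * ‖ι x - ι y‖ ^ s := by
  have hC0 : 0 ≤ |C| := abs_nonneg C
  have key : ∀ t : ℝ, C * Real.exp (b * |t|) ≤ |C| * Real.exp (b' * |t|) := fun t => by
    have : Real.exp (b * |t|) ≤ Real.exp (b' * |t|) :=
      Real.exp_le_exp.2 (mul_le_mul_of_nonneg_right hb (abs_nonneg t))
    exact mul_le_mul (le_abs_self C) this (Real.exp_pos _).le hC0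
  have key2 : ∀ t : ℝ, 2 * (|C| * Real.exp (b' * |t|)) ≤ C' * Real.exp (b' * |t|) := fun t => by
    rw [← mul_assoc]
    exact mul_le_mul_of_nonneg_right hC (Real.exp_pos _).le
  have pos : ∀ t : ℝ, 0 ≤ |C| * Real.exp (b' * |t|) := fun t =>
    mul_nonneg hC0 (Real.exp_pos _).le
  refine ⟨fun t x => (h1 t x).trans ((key t).trans ?_), fun t x y => ?_⟩
  · linarith [key2 t, pos t]
  · set d := ‖ι x - ι y‖
    have hd : 0 ≤ d := norm_nonneg _
    rcases le_total d 1 with hd1 | hd1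
    · calc _ ≤ C * Real.exp (b * |t|) * d ^ r := h2 t x y
        _ ≤ (C' * Real.exp (b' * |t|)) * d ^ r :=
          mul_le_mul_of_nonneg_right (by linarith [key t, key2 t, pos t]) (Real.rpow_nonneg hd _)
        _ ≤ _ := mul_le_mul_of_nonneg_left
          (Real.rpow_le_rpow_of_exponent_ge' hd hd1 hs.le hsr) (by linarith [key2 t, pos t])
    · calc _ ≤ ‖h t x‖ + ‖h t y‖ := norm_sub_le _ _
        _ ≤ C' * Real.exp (b' * |t|) * 1 := by linarith [h1 t x, h1 t y, key t, key2 t]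
        _ ≤ _ := mul_le_mul_of_nonneg_left (Real.one_le_rpow hd1 hs.le)
          (by linarith [key2 t, pos t])

theorem ExpHolder.of_le {h : ℝ → K → G} {C b r : ℝ} (hr : 0 < r)
    (h1 : ∀ t x, ‖h t x‖ ≤ C * Real.exp (b * |t|))
    (h2 : ∀ t x y, ‖h t x - h t y‖ ≤ C * Real.exp (b * |t|) * ‖ι x - ι y‖ ^ r) :
    ExpHolder ι h := by
  obtain ⟨k1, k2⟩ := ExpHolder.mk_of_le h1 h2 (min r 1) (min_le_left _ _)
    (lt_min hr one_pos) le_rfl (le_max_left b 0)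
  exact ⟨2 * |C|, max b 0, min r 1, by positivity, le_max_right _ _, lt_min hr one_pos,
    min_le_right _ _, k1, k2⟩

theorem BddHolder.of_le {g : K → G} {C r : ℝ} (hr : 0 < r) (h1 : ∀ x, ‖g x‖ ≤ C)
    (h2 : ∀ x y, ‖g x - g y‖ ≤ C * ‖ι x - ι y‖ ^ r) : BddHolder ι g :=
  ExpHolder.of_le (C := C) (b := 0) hr (by simpa using h1) (by simpa using h2)

theorem BddHolder.exists_bound {g : K → G} (hg : BddHolder ι g) :
    ∃ C r : ℝ, 0 ≤ C ∧ 0 < r ∧ r ≤ 1 ∧ (∀ x, ‖g x‖ ≤ C) ∧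
      ∀ x y, ‖g x - g y‖ ≤ C * ‖ι x - ι y‖ ^ r := by
  obtain ⟨C, b, r, hC, -, hr, hr1, h1, h2⟩ := hg
  exact ⟨C, r, hC, hr, hr1, fun x => by simpa using h1 0 x, fun x y => by simpa using h2 0 x y⟩

theorem ExpHolder.common {h : ℝ → K → G₁} {k : ℝ → K → G₂} (hh : ExpHolder ι h)
    (hk : ExpHolder ι k) : ∃ C b r : ℝ, 0 ≤ C ∧ 0 ≤ b ∧ 0 < r ∧
      ((∀ t x, ‖h t x‖ ≤ C * Real.exp (b * |t|)) ∧
      ∀ t x y, ‖h t x - h t y‖ ≤ C * Real.exp (b * |t|) * ‖ι x - ι y‖ ^ r) ∧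
      (∀ t x, ‖k t x‖ ≤ C * Real.exp (b * |t|)) ∧
      ∀ t x y, ‖k t x - k t y‖ ≤ C * Real.exp (b * |t|) * ‖ι x - ι y‖ ^ r := by
  obtain ⟨C, b, r, hC, hb, hr, hr1, h1, h2⟩ := hh
  obtain ⟨D, c, s, hD, hc, hs, hs1, k1, k2⟩ := hk
  refine ⟨2 * |C| + 2 * |D|, b + c, min r s, by positivity, by positivity, lt_min hr hs, ?_, ?_⟩
  · exact ExpHolder.mk_of_le h1 h2 _ (min_le_left _ _) (lt_min hr hs)
      (by linarith [abs_nonneg D]) (by linarith)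
  · exact ExpHolder.mk_of_le k1 k2 _ (min_le_right _ _) (lt_min hr hs)
      (by linarith [abs_nonneg C]) (by linarith)

theorem ExpHolder.bilin (L : G₁ →L[ℝ] G₂ →L[ℝ] G₃) {h : ℝ → K → G₁} {k : ℝ → K → G₂}
    (hh : ExpHolder ι h) (hk : ExpHolder ι k) : ExpHolder ι (fun t x => L (h t x) (k t x)) := by
  obtain ⟨C, b, r, hC, hb, hr, ⟨h1, h2⟩, k1, k2⟩ := hh.common hk
  have hL : ∀ u v, ‖L u v‖ ≤ ‖L‖ * ‖u‖ * ‖v‖ := fun u v => L.le_opNorm₂ u v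
  -- The two exponentials multiply, so the rate doubles; the factor `2` counts the two terms of the
  -- telescoped increment.
  refine ExpHolder.of_le (C := 2 * ‖L‖ * C * C) (b := 2 * b) hr (fun t x => ?_) fun t x y => ?_
  · have e : Real.exp (2 * b * |t|) = Real.exp (b * |t|) * Real.exp (b * |t|) := by
      rw [← Real.exp_add]; ring_nf
    have hE := Real.exp_pos (b * |t|)
    calc ‖L (h t x) (k t x)‖ ≤ ‖L‖ * ‖h t x‖ * ‖k t x‖ := hL _ _
      _ ≤ ‖L‖ * (C * Real.exp (b * |t|)) * (C * Real.exp (b * |t|)) := by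
        gcongr
        · exact h1 t x
        · exact k1 t x
      _ ≤ 2 * (‖L‖ * (C * Real.exp (b * |t|)) * (C * Real.exp (b * |t|))) := by
        have : 0 ≤ ‖L‖ * (C * Real.exp (b * |t|)) * (C * Real.exp (b * |t|)) := by positivity
        linarith
      _ = _ := by rw [e]; ring
  · have e : Real.exp (2 * b * |t|) = Real.exp (b * |t|) * Real.exp (b * |t|) := by
      rw [← Real.exp_add]; ring_nf
    have hE := Real.exp_pos (b * |t|)
    have hd : 0 ≤ ‖ι x - ι y‖ ^ r := Real.rpow_nonneg (norm_nonneg _) _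
    have : L (h t x) (k t x) - L (h t y) (k t y)
        = L (h t x - h t y) (k t x) + L (h t y) (k t x - k t y) := by
      simp only [map_sub, sub_apply]; abel
    rw [this]
    calc _ ≤ ‖L (h t x - h t y) (k t x)‖ + ‖L (h t y) (k t x - k t y)‖ := norm_add_le _ _
      _ ≤ ‖L‖ * ‖h t x - h t y‖ * ‖k t x‖ + ‖L‖ * ‖h t y‖ * ‖k t x - k t y‖ :=
        add_le_add (hL _ _) (hL _ _)
      _ ≤ ‖L‖ * (C * Real.exp (b * |t|) * ‖ι x - ι y‖ ^ r) * (C * Real.exp (b * |t|))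
          + ‖L‖ * (C * Real.exp (b * |t|)) * (C * Real.exp (b * |t|) * ‖ι x - ι y‖ ^ r) := by
        gcongr
        · exact h2 t x y
        · exact k1 t x
        · exact h1 t y
        · exact k2 t x y
      _ = _ := by rw [e]; ring

theorem ExpHolder.const (c : G) : ExpHolder ι (fun _ _ => c : ℝ → K → G) :=
  ExpHolder.of_le (C := ‖c‖) (b := 0) one_pos (by simp) (by
    intro t x y
    rw [sub_self, norm_zero]; positivity)

theorem ExpHolder.clm (L : G₁ →L[ℝ] G₂) {h : ℝ → K → G₁} (hh : ExpHolder ι h) :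
    ExpHolder ι (fun t x => L (h t x)) :=
  (ExpHolder.const L).bilin (ContinuousLinearMap.id ℝ (G₁ →L[ℝ] G₂)) hh

theorem ExpHolder.comp_clm {h : ℝ → K → G₂ →L[ℝ] G₃} {k : ℝ → K → G₁ →L[ℝ] G₂}
    (hh : ExpHolder ι h) (hk : ExpHolder ι k) : ExpHolder ι (fun t x => (h t x).comp (k t x)) :=
  hh.bilin (ContinuousLinearMap.compL ℝ G₁ G₂ G₃) hk

theorem ExpHolder.clm_apply {h : ℝ → K → G₁ →L[ℝ] G₂} {k : ℝ → K → G₁}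
    (hh : ExpHolder ι h) (hk : ExpHolder ι k) : ExpHolder ι (fun t x => h t x (k t x)) :=
  hh.bilin (ContinuousLinearMap.id ℝ (G₁ →L[ℝ] G₂)) hk

theorem ExpHolder.smul {h : ℝ → K → ℝ} {k : ℝ → K → G}
    (hh : ExpHolder ι h) (hk : ExpHolder ι k) : ExpHolder ι (fun t x => h t x • k t x) :=
  hh.bilin (ContinuousLinearMap.lsmul ℝ ℝ) hk

theorem ExpHolder.add {h k : ℝ → K → G} (hh : ExpHolder ι h) (hk : ExpHolder ι k) :
    ExpHolder ι (fun t x => h t x + k t x) := by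
  obtain ⟨C, b, r, hC, hb, hr, ⟨h1, h2⟩, k1, k2⟩ := hh.common hk
  refine ExpHolder.of_le (C := C + C) (b := b) hr (fun t x => ?_) fun t x y => ?_
  · exact (norm_add_le _ _).trans (by linarith [h1 t x, k1 t x])
  · rw [add_sub_add_comm]
    exact (norm_add_le _ _).trans (by linarith [h2 t x y, k2 t x y])

theorem ExpHolder.neg {h : ℝ → K → G} (hh : ExpHolder ι h) : ExpHolder ι (fun t x => -h t x) :=
  hh.clm (-(ContinuousLinearMap.id ℝ G))

theorem ExpHolder.sub {h k : ℝ → K → G} (hh : ExpHolder ι h) (hk : ExpHolder ι k) :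
    ExpHolder ι (fun t x => h t x - k t x) := by
  simpa only [sub_eq_add_neg] using hh.add hk.neg

theorem ExpHolder.neg_time {h : ℝ → K → G} (hh : ExpHolder ι h) :
    ExpHolder ι (fun t x => h (-t) x) := by
  obtain ⟨C, b, r, hC, hb, hr, hr1, h1, h2⟩ := hh
  exact ⟨C, b, r, hC, hb, hr, hr1, fun t x => by simpa using h1 (-t) x,
    fun t x y => by simpa using h2 (-t) x y⟩

/-- The Lipschitz constant of `φ t` grows at most exponentially in `|t|`. -/
def ExpLipschitz (ι : K → V) (φ : ℝ → K → K) : Prop :=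
  ∃ C b : ℝ, 0 ≤ C ∧ 0 ≤ b ∧
    ∀ t x y, ‖ι (φ t x) - ι (φ t y)‖ ≤ C * Real.exp (b * |t|) * ‖ι x - ι y‖

theorem ExpLipschitz.neg_time {φ : ℝ → K → K} (hφ : ExpLipschitz ι φ) :
    ExpLipschitz ι (fun t => φ (-t)) := by
  obtain ⟨C, b, hC, hb, h⟩ := hφ
  exact ⟨C, b, hC, hb, fun t x y => by simpa using h (-t) x y⟩

theorem ExpHolder.comp_flow {h : ℝ → K → G} (hh : ExpHolder ι h) {φ : ℝ → K → K}
    (hφ : ExpLipschitz ι φ) : ExpHolder ι (fun t x => h t (φ t x)) := by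
  obtain ⟨C, b, r, hC, hb, hr, hr1, h1, h2⟩ := hh
  obtain ⟨D, c, hD, hc, h3⟩ := hφ
  -- `1 + D` instead of `D` keeps the factor at least `1`, so that the same constant also serves the
  -- sup bound. The rate is `b + c` because `r ≤ 1` gives `(e^{c|t|})^r ≤ e^{c|t|}`.
  refine ExpHolder.of_le (C := C * (1 + D) ^ r) (b := b + c) hr (fun t x => ?_) fun t x y => ?_
  · refine (h1 _ _).trans ?_
    have e1 : 1 ≤ (1 + D) ^ r := Real.one_le_rpow (by linarith) hr.le
    have e2 : Real.exp (b * |t|) ≤ Real.exp ((b + c) * |t|) :=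
      Real.exp_le_exp.2 (mul_le_mul_of_nonneg_right (by linarith) (abs_nonneg t))
    refine mul_le_mul (le_mul_of_one_le_right hC e1) e2 (Real.exp_pos _).le (by positivity)
  · have hd := norm_nonneg (ι x - ι y)
    have hct : 1 ≤ Real.exp (c * |t|) := Real.one_le_exp (by positivity)
    calc _ ≤ C * Real.exp (b * |t|) * ‖ι (φ t x) - ι (φ t y)‖ ^ r := h2 _ _ _
      _ ≤ C * Real.exp (b * |t|) * ((1 + D) * Real.exp (c * |t|) * ‖ι x - ι y‖) ^ r := by
        gcongr
        refine (h3 t x y).trans ?_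
        gcongr
        linarith
      _ = C * Real.exp (b * |t|) * ((1 + D) ^ r * Real.exp (c * |t|) ^ r * ‖ι x - ι y‖ ^ r) := by
        rw [Real.mul_rpow (by positivity) hd, Real.mul_rpow (by positivity) (by positivity)]
      _ ≤ C * Real.exp (b * |t|) * ((1 + D) ^ r * Real.exp (c * |t|) * ‖ι x - ι y‖ ^ r) := by
        gcongr
        exact Real.rpow_le_self_of_one_le hct hr1
      _ = _ := by rw [add_mul, Real.exp_add]; ring

theorem BddHolder.comp_flow {g : K → G} (hg : BddHolder ι g) {φ : ℝ → K → K}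
    (hφ : ExpLipschitz ι φ) : ExpHolder ι (fun t x => g (φ t x)) :=
  ExpHolder.comp_flow (h := fun _ => g) hg hφ

theorem ExpHolder.at_time {h : ℝ → K → G} (hh : ExpHolder ι h) (t : ℝ) : BddHolder ι (h t) := by
  obtain ⟨C, b, r, hC, hb, hr, hr1, h1, h2⟩ := hh
  exact BddHolder.of_le hr (h1 t) (h2 t)

theorem BddHolder.continuous [TopologicalSpace K] {g : K → G} (hg : BddHolder ι g)
    (hι : Continuous ι) : Continuous g := by
  obtain ⟨C, r, hC, hr, hr1, -, h2⟩ := hg.exists_bound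
  rw [continuous_iff_continuousAt]
  intro x
  rw [ContinuousAt, tendsto_iff_norm_sub_tendsto_zero]
  refine squeeze_zero (fun _ => norm_nonneg _) (fun y => h2 y x) ?_
  have : Continuous fun y => C * ‖ι y - ι x‖ ^ r :=
    continuous_const.mul ((hι.sub continuous_const).norm.rpow_const fun _ => Or.inr hr.le)
  simpa [Real.zero_rpow hr.ne'] using this.tendsto x

/-- Pulling the distance back once more, along `c`, reduces this to `BddHolder.continuous` on `T`;
no topology on `K` is involved. -/
theorem BddHolder.continuous_comp {T : Type*} [TopologicalSpace T] {g : K → G}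
    (hg : BddHolder ι g) {c : T → K} (hc : Continuous (ι ∘ c)) : Continuous (g ∘ c) := by
  obtain ⟨C, r, hC, hr, hr1, h1, h2⟩ := hg.exists_bound
  have : BddHolder (ι ∘ c) (g ∘ c) :=
    BddHolder.of_le hr (fun x => h1 (c x)) (fun x y => h2 (c x) (c y))
  exact this.continuous hc

/-- A geometric interpolation between an exponentially decaying and an exponentially growing
bound. -/
theorem le_interpolate {A a b δ : ℝ} (ha : 0 < a) (hb : 0 ≤ b) (hδ : 0 ≤ δ) {z t : ℝ}
    (hz : 0 ≤ z) (h1 : z ≤ A * Real.exp (-a * t)) (h2 : z ≤ A * Real.exp (b * t) * δ) :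
    z ≤ A * Real.exp (-(a / 2) * t) * δ ^ (a / (2 * (a + b))) := by
  -- The weight is chosen so that `-a (1 - θ) + b θ = -a / 2`: half of the decay is given up in
  -- exchange for a positive power of `δ`.
  set θ := a / (2 * (a + b)) with hθ
  have hθ0 : 0 < θ := by positivity
  have hθ1 : θ < 1 := by
    rw [hθ, div_lt_one (by positivity)]; linarith
  have hA : 0 ≤ A := by
    by_contra hA
    have : A * Real.exp (-a * t) < 0 := mul_neg_of_neg_of_pos (not_le.1 hA) (Real.exp_pos _)
    linarith
  have e1 : z ^ (1 - θ) ≤ (A * Real.exp (-a * t)) ^ (1 - θ) :=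
    Real.rpow_le_rpow hz h1 (by linarith)
  have e2 : z ^ θ ≤ (A * Real.exp (b * t) * δ) ^ θ := Real.rpow_le_rpow hz h2 hθ0.le
  have e3 : z = z ^ (1 - θ) * z ^ θ := by
    rw [← Real.rpow_add_of_nonneg hz (by linarith) hθ0.le]; simp
  have e4 : A = A ^ (1 - θ) * A ^ θ := by
    rw [← Real.rpow_add_of_nonneg hA (by linarith) hθ0.le]; simp
  calc z = z ^ (1 - θ) * z ^ θ := e3
    _ ≤ (A * Real.exp (-a * t)) ^ (1 - θ) * (A * Real.exp (b * t) * δ) ^ θ :=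
      mul_le_mul e1 e2 (Real.rpow_nonneg hz _) (Real.rpow_nonneg (by positivity) _)
    _ = (A ^ (1 - θ) * A ^ θ) * (Real.exp (-a * t * (1 - θ)) * Real.exp (b * t * θ)) * δ ^ θ := by
      rw [Real.mul_rpow hA (Real.exp_pos _).le, Real.mul_rpow (by positivity) hδ,
        Real.mul_rpow hA (Real.exp_pos _).le, ← Real.exp_mul, ← Real.exp_mul]
      ring
    _ = A * Real.exp (-(a / 2) * t) * δ ^ θ := by
      rw [← e4, ← Real.exp_add]
      congr 3
      rw [hθ]; field_simp; ring

/-- A function is Hölder if its increments are, for every `T ≥ 0`, the sum of an error decaying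
exponentially in `T` and a Hölder term growing exponentially in `T`. -/
theorem BddHolder.of_forall_exp {g : K → G} {C a b r B : ℝ} (ha : 0 < a) (hb : 0 ≤ b)
    (hr : 0 < r) (hB : ∀ x, ‖g x‖ ≤ B)
    (h : ∀ T : ℝ, 0 ≤ T → ∀ x y,
      ‖g x - g y‖ ≤ C * (Real.exp (-a * T) + Real.exp (b * T) * ‖ι x - ι y‖ ^ r)) :
    BddHolder ι g := by
  set s := r * (a / (a + b)) with hs
  have hs0 : 0 < s := by positivity
  set D := 2 * |C| + 2 * |B| with hD
  have hD0 : 0 ≤ D := by positivity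
  refine BddHolder.of_le (C := D) hs0 (fun x => (hB x).trans ?_) fun x y => ?_
  · have := le_abs_self B
    have := abs_nonneg B
    have := abs_nonneg C
    linarith
  set d := ‖ι x - ι y‖ with hd
  have hd0 : 0 ≤ d := norm_nonneg _
  rcases le_or_gt 1 d with h1 | h1
  · calc ‖g x - g y‖ ≤ ‖g x‖ + ‖g y‖ := norm_sub_le _ _
      _ ≤ D * 1 := by linarith [hB x, hB y, le_abs_self B, abs_nonneg C]
      _ ≤ D * d ^ s := mul_le_mul_of_nonneg_left (Real.one_le_rpow h1 hs0.le) hD0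
  rcases hd0.eq_or_lt with h0 | h0
  -- At distance zero only the decaying error remains, and `T → ∞` removes it.
  · have hlim : Tendsto (fun T : ℝ => C * (Real.exp (-a * T) + Real.exp (b * T) * d ^ r)) atTop
        (𝓝 0) := by
      rw [← h0]
      simp only [Real.zero_rpow hr.ne', mul_zero, add_zero]
      have : Tendsto (fun T : ℝ => Real.exp (-a * T)) atTop (𝓝 0) :=
        Real.tendsto_exp_atBot.comp (tendsto_id.const_mul_atTop_of_neg (neg_neg_of_pos ha))
      simpa using this.const_mul C
    have : ‖g x - g y‖ ≤ 0 := ge_of_tendsto hlim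
      ((eventually_ge_atTop 0).mono fun T hT => h T hT x y)
    exact this.trans (mul_nonneg hD0 (Real.rpow_nonneg hd0 _))
  -- This time balances the two errors: `e^{-aT} = e^{bT} d^r = d^s`.
  · set T := -(r * Real.log d) / (a + b) with hT
    have hlog : Real.log d < 0 := Real.log_neg h0 h1
    have hT0 : 0 ≤ T := div_nonneg (by nlinarith) (by positivity)
    have hab : a + b ≠ 0 := by positivity
    have e1 : Real.exp (-a * T) = d ^ s := by
      rw [Real.rpow_def_of_pos h0]
      congr 1
      rw [hT, hs]; field_simp
    have e2 : Real.exp (b * T) * d ^ r = d ^ s := by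
      rw [Real.rpow_def_of_pos h0, Real.rpow_def_of_pos h0, ← Real.exp_add]
      congr 1
      rw [hT, hs]; field_simp; ring
    have := h T hT0 x y
    rw [e1, e2] at this
    have hds : 0 ≤ d ^ s := Real.rpow_nonneg hd0 _
    calc _ ≤ C * (d ^ s + d ^ s) := this
      _ ≤ |C| * (d ^ s + d ^ s) := mul_le_mul_of_nonneg_right (le_abs_self C) (by positivity)
      _ = 2 * |C| * d ^ s := by ring
      _ ≤ D * d ^ s := mul_le_mul_of_nonneg_right (by linarith [abs_nonneg B]) hds

theorem integrableOn_exp_neg_mul {a : ℝ} (ha : 0 < a) (s : ℝ) :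
    IntegrableOn (fun t => Real.exp (-a * t)) (Ici s) :=
  (integrableOn_Ici_iff_integrableOn_Ioi).2 (exp_neg_integrableOn_Ioi s ha)

theorem integrableOn_of_exp_decay {k : ℝ → G} (hk : Continuous k) {C a : ℝ} (ha : 0 < a)
    (h : ∀ t, 0 ≤ t → ‖k t‖ ≤ C * Real.exp (-a * t)) : IntegrableOn k (Ici 0) := by
  refine Integrable.mono' ((integrableOn_exp_neg_mul ha 0).const_mul C)
    hk.aestronglyMeasurable.restrict ?_
  exact (ae_restrict_mem measurableSet_Ici).mono fun t ht => h t ht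

/-- The integral over `[0, ∞)` of an exponentially decaying function is Hölder. -/
theorem ExpHolder.integral_Ici {h : ℝ → K → G} (hh : ExpHolder ι h)
    (hc : ∀ x, Continuous fun t => h t x) {C a : ℝ} (ha : 0 < a)
    (hd : ∀ t x, 0 ≤ t → ‖h t x‖ ≤ C * Real.exp (-a * t)) :
    BddHolder ι (fun x => ∫ t in Ici (0 : ℝ), h t x) := by
  obtain ⟨D, b, r, hD, hb, hr, hr1, h1, h2⟩ := hh
  set A := 2 * |C| + D with hA
  have hA0 : 0 ≤ A := by positivity
  have hint : ∀ x, IntegrableOn (fun t => h t x) (Ici 0) := fun x =>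
    integrableOn_of_exp_decay (hc x) ha fun t ht => hd t x ht
  set I1 := ∫ t in Ici (0 : ℝ), A * Real.exp (-a * t) with hI1
  set I2 := ∫ t in Ici (0 : ℝ), A * Real.exp (-(a / 2) * t) with hI2
  have hI1' : 0 ≤ I1 := integral_nonneg fun t => mul_nonneg hA0 (Real.exp_pos _).le
  have hI2' : 0 ≤ I2 := integral_nonneg fun t => mul_nonneg hA0 (Real.exp_pos _).le
  have hAC : C ≤ A := by linarith [le_abs_self C, abs_nonneg C]
  refine BddHolder.of_le (C := I1 + I2) (r := r * (a / (2 * (a + b)))) (by positivity)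
    (fun x => ?_) fun x y => ?_
  · have : ‖∫ t in Ici (0 : ℝ), h t x‖ ≤ I1 := by
      refine norm_integral_le_of_norm_le ((integrableOn_exp_neg_mul ha 0).const_mul A) ?_
      refine (ae_restrict_mem measurableSet_Ici).mono fun t ht => (hd t x ht).trans ?_
      exact mul_le_mul_of_nonneg_right hAC (Real.exp_pos _).le
    linarith
  · rw [← integral_sub (hint x) (hint y)]
    set δ := ‖ι x - ι y‖ ^ r with hδ
    have hδ0 : 0 ≤ δ := Real.rpow_nonneg (norm_nonneg _) _
    have hδ' : ‖ι x - ι y‖ ^ (r * (a / (2 * (a + b)))) = δ ^ (a / (2 * (a + b))) :=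
      Real.rpow_mul (norm_nonneg _) _ _
    have : ‖∫ t in Ici (0 : ℝ), (h t x - h t y)‖ ≤
        ∫ t in Ici (0 : ℝ), A * Real.exp (-(a / 2) * t) * δ ^ (a / (2 * (a + b))) := by
      refine norm_integral_le_of_norm_le
        (((integrableOn_exp_neg_mul (half_pos ha) 0).const_mul A).mul_const _) ?_
      refine (ae_restrict_mem measurableSet_Ici).mono fun t (ht : 0 ≤ t) => ?_
      -- The increment of the integrand decays like `e^{-at}` and is also at most a multiple of
      -- `e^{bt} δ`. The interpolated bound is integrable in time and keeps a power of `δ`.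
      refine le_interpolate ha hb hδ0 (norm_nonneg _) ?_ ?_
      · calc _ ≤ ‖h t x‖ + ‖h t y‖ := norm_sub_le _ _
          _ ≤ C * Real.exp (-a * t) + C * Real.exp (-a * t) := add_le_add (hd t x ht) (hd t y ht)
          _ = (2 * C) * Real.exp (-a * t) := by ring
          _ ≤ _ := mul_le_mul_of_nonneg_right (by linarith [le_abs_self C]) (Real.exp_pos _).le
      · have := h2 t x y
        rw [abs_of_nonneg ht] at this
        refine this.trans ?_
        gcongr
        linarith [abs_nonneg C]
    rw [integral_mul_const] at this
    rw [hδ']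
    refine this.trans (mul_le_mul_of_nonneg_right (by linarith) (Real.rpow_nonneg hδ0 _))

/-- The Hölder bound in the space variable is locally uniform in time, so separate continuity in
time is enough for continuity along a curve. -/
theorem ExpHolder.continuous_diag {h : ℝ → K → G} (hh : ExpHolder ι h)
    (hc : ∀ x, Continuous fun t => h t x) {c : ℝ → K} (hcc : Continuous fun t => ι (c t)) :
    Continuous fun t => h t (c t) := by
  obtain ⟨C, b, r, hC, hb, hr, hr1, -, h2⟩ := hh
  rw [continuous_iff_continuousAt]
  intro t₀
  have e1 : Tendsto (fun t => h t (c t) - h t (c t₀)) (𝓝 t₀) (𝓝 0) := by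
    rw [tendsto_zero_iff_norm_tendsto_zero]
    refine squeeze_zero (fun _ => norm_nonneg _) (fun t => h2 t (c t) (c t₀)) ?_
    have : Continuous fun t => C * Real.exp (b * |t|) * ‖ι (c t) - ι (c t₀)‖ ^ r :=
      (by fun_prop : Continuous fun t : ℝ => C * Real.exp (b * |t|)).mul
        ((hcc.sub continuous_const).norm.rpow_const fun _ => Or.inr hr.le)
    simpa [Real.zero_rpow hr.ne'] using this.tendsto t₀
  simpa [ContinuousAt] using e1.add ((hc (c t₀)).tendsto t₀)

/-- After translation the integral runs over a half-line starting at `s`. It differs from a constant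
by `∫_0^s k`, and the fundamental theorem of calculus applies. -/
theorem hasDerivAt_integral_Ici_comp_add [CompleteSpace G] {k : ℝ → G} (hk : Continuous k)
    (hi : IntegrableOn k (Ici 0)) :
    HasDerivAt (fun s => ∫ t in Ici (0 : ℝ), k (t + s)) (-k 0) 0 := by
  have e : ∀ s, ∫ t in Ici (0 : ℝ), k (t + s) =
      (∫ t in Ioi (0 : ℝ), k t) - ∫ t in (0 : ℝ)..s, k t := fun s => by
    have hs : ∫ t in Ioi (0 : ℝ), k (t + s) = ∫ t in Ioi s, k t := by
      simpa using (measurePreserving_add_right volume s).setIntegral_preimage_emb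
        (measurableEmbedding_addRight s) k (Ioi s)
    rw [integral_Ici_eq_integral_Ioi, hs]
    have hi' : IntegrableOn k (Ioi 0) := hi.mono_set Ioi_subset_Ici_self
    have := intervalIntegral.integral_Ioi_sub_Ioi' (a := 0) (b := s) (μ := volume) hi' ?_
    · rw [← this]; abel
    · rcases le_total 0 s with h | h
      · exact hi'.mono_set (Ioi_subset_Ioi h)
      · rw [← Ioc_union_Ioi_eq_Ioi h]
        exact (hk.integrableOn_Ioc).union hi'
  simp_rw [e]
  have := intervalIntegral.integral_hasDerivAt_right (hk.intervalIntegrable (μ := volume) 0 0)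
    (hk.stronglyMeasurableAtFilter _ _) hk.continuousAt
  simpa using this.const_sub (∫ t in Ioi (0 : ℝ), k t)

end ExpHolder

/-! ### Hyperbolic cocycles on a trivial bundle: Hölder regularity of the splitting. -/

/-- A hyperbolic linear cocycle `A` over a flow `φ` on `K`, acting on the image bundle of the
projections `A 0 x` of a trivial bundle with fibre `W`. The embedding `ι` provides the distance
on `K`. -/
structure HypCocycle (K V W : Type*) [NormedAddCommGroup V] [NormedAddCommGroup W]
    [NormedSpace ℝ W] where
  ι : K → V
  φ : ℝ → K → K
  A : ℝ → K → W →L[ℝ] W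
  Ps : K → W →L[ℝ] W
  Pu : K → W →L[ℝ] W
  F : K → W
  eps : K → W →L[ℝ] ℝ
  φ_zero : ∀ x, φ 0 x = x
  φ_add : ∀ s t x, φ (s + t) x = φ s (φ t x)
  A_add : ∀ s t x, A (s + t) x = (A s (φ t x)).comp (A t x)
  expLipschitz_φ : ExpLipschitz ι φ
  expHolder_A : ExpHolder ι A
  continuous_φ : ∀ x, Continuous fun t => ι (φ t x)
  continuous_A : ∀ x, Continuous fun t => A t x
  split : ∀ x, A 0 x = Ps x + Pu x + (eps x).smulRight (F x)
  A_zero_Ps : ∀ x, (A 0 x).comp (Ps x) = Ps x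
  A_zero_Pu : ∀ x, (A 0 x).comp (Pu x) = Pu x
  Ps_comm : ∀ t x, (Ps (φ t x)).comp (A t x) = (A t x).comp (Ps x)
  Pu_comm : ∀ t x, (Pu (φ t x)).comp (A t x) = (A t x).comp (Pu x)
  Ps_F : ∀ x, Ps x (F x) = 0
  Pu_F : ∀ x, Pu x (F x) = 0
  eps_F : ∀ x, eps x (F x) = 1
  eps_A : ∀ t x, (eps (φ t x)).comp (A t x) = eps x
  A_F : ∀ t x, A t x (F x) = F (φ t x)
  hyp_s : ∃ C a : ℝ, 0 < a ∧ ∀ x t, 0 ≤ t → ‖(A t x).comp (Ps x)‖ ≤ C * Real.exp (-a * t)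
  hyp_u : ∃ C a : ℝ, 0 < a ∧ ∀ x t, 0 ≤ t → ‖(A (-t) x).comp (Pu x)‖ ≤ C * Real.exp (-a * t)
  bound_eps : ∃ C : ℝ, ∀ x, ‖eps x‖ ≤ C
  holder_F : BddHolder ι F
  F_lower : ∃ m : ℝ, 0 < m ∧ ∀ x, m ≤ ‖F x‖

namespace HypCocycle

variable {K V W : Type*} [NormedAddCommGroup V] [NormedAddCommGroup W] [NormedSpace ℝ W]
  (c : HypCocycle K V W)

/-- The cocycle with time reversed. -/
def reverse : HypCocycle K V W where
  ι := c.ι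
  φ t := c.φ (-t)
  A t := c.A (-t)
  Ps := c.Pu
  Pu := c.Ps
  F := c.F
  eps := c.eps
  φ_zero x := by simp [c.φ_zero]
  φ_add s t x := by rw [neg_add, c.φ_add]
  A_add s t x := by rw [neg_add, c.A_add]
  expLipschitz_φ := c.expLipschitz_φ.neg_time
  expHolder_A := c.expHolder_A.neg_time
  continuous_φ x := (c.continuous_φ x).comp continuous_neg
  continuous_A x := (c.continuous_A x).comp continuous_neg
  split x := by rw [neg_zero, c.split, add_comm (c.Ps x)]
  A_zero_Ps x := by rw [neg_zero, c.A_zero_Pu]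
  A_zero_Pu x := by rw [neg_zero, c.A_zero_Ps]
  Ps_comm t x := c.Pu_comm _ x
  Pu_comm t x := c.Ps_comm _ x
  Ps_F := c.Pu_F
  Pu_F := c.Ps_F
  eps_F := c.eps_F
  eps_A t x := c.eps_A _ x
  A_F t x := c.A_F _ x
  hyp_s := c.hyp_u
  hyp_u := by simpa using c.hyp_s
  bound_eps := c.bound_eps
  holder_F := c.holder_F
  F_lower := c.F_lower

theorem φ_neg_φ (t : ℝ) (x : K) : c.φ (-t) (c.φ t x) = x := by
  rw [← c.φ_add, neg_add_cancel, c.φ_zero]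

theorem A_comp_A_zero (t : ℝ) (x : K) : (c.A t x).comp (c.A 0 x) = c.A t x := by
  have := c.A_add t 0 x
  rw [c.φ_zero, add_zero] at this
  exact this.symm

theorem A_zero_comp_A (t : ℝ) (x : K) : (c.A 0 (c.φ t x)).comp (c.A t x) = c.A t x := by
  rw [← c.A_add, zero_add]

theorem A_neg_comp_A (t : ℝ) (x : K) : (c.A (-t) (c.φ t x)).comp (c.A t x) = c.A 0 x := by
  rw [← c.A_add, neg_add_cancel]

theorem A_comp_A_neg (t : ℝ) (x : K) : (c.A t x).comp (c.A (-t) (c.φ t x)) = c.A 0 (c.φ t x) := by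
  have := c.A_add t (-t) (c.φ t x)
  rw [c.φ_neg_φ, add_neg_cancel] at this
  exact this.symm

theorem Ps_A_zero (x : K) : (c.Ps x).comp (c.A 0 x) = c.Ps x := by
  have := c.Ps_comm 0 x
  rw [c.φ_zero] at this
  rw [this, c.A_zero_Ps]

theorem exists_bound_Ps : ∃ C, 0 ≤ C ∧ ∀ x, ‖c.Ps x‖ ≤ C := by
  obtain ⟨C, a, ha, h⟩ := c.hyp_s
  refine ⟨|C|, abs_nonneg C, fun x => ?_⟩
  have := h x 0 le_rfl
  rw [c.A_zero_Ps, mul_zero, Real.exp_zero, mul_one] at this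
  exact this.trans (le_abs_self C)

/-- The center-unstable projection. -/
def Pcu (x : K) : W →L[ℝ] W := c.A 0 x - c.Ps x

theorem Pcu_comm (t : ℝ) (x : K) :
    (c.Pcu (c.φ t x)).comp (c.A t x) = (c.A t x).comp (c.Pcu x) := by
  rw [Pcu, Pcu, ContinuousLinearMap.sub_comp, ContinuousLinearMap.comp_sub, c.Ps_comm,
    c.A_zero_comp_A, c.A_comp_A_zero]

theorem A_zero_comp_A_zero (x : K) : (c.A 0 x).comp (c.A 0 x) = c.A 0 x := c.A_comp_A_zero 0 x

theorem A_zero_Pcu (x : K) : (c.A 0 x).comp (c.Pcu x) = c.Pcu x := by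
  rw [Pcu, ContinuousLinearMap.comp_sub, c.A_zero_comp_A_zero, c.A_zero_Ps]

/-- Backward in time the unstable part contracts, and the center part only moves `F` along the
orbit, where it stays bounded. -/
theorem exists_bound_Pcu : ∃ C, 0 ≤ C ∧ ∀ x t, 0 ≤ t → ‖(c.A (-t) x).comp (c.Pcu x)‖ ≤ C := by
  obtain ⟨C, a, ha, h⟩ := c.hyp_u
  obtain ⟨B, hB⟩ := c.bound_eps
  obtain ⟨D, r, hD, -, -, h1, -⟩ := c.holder_F.exists_bound
  refine ⟨|C| + |B| * D, by positivity, fun x t ht => ?_⟩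
  have e : (c.A (-t) x).comp (c.Pcu x) =
      (c.A (-t) x).comp (c.Pu x) + (c.eps x).smulRight (c.F (c.φ (-t) x)) := by
    ext w
    simp [Pcu, c.split, c.A_F]
    abel
  rw [e]
  refine (norm_add_le _ _).trans (add_le_add ?_ ?_)
  · refine (h x t ht).trans ?_
    calc C * Real.exp (-a * t) ≤ |C| * 1 := by
          gcongr
          · exact le_abs_self C
          · exact Real.exp_le_one_iff.2 (by nlinarith)
      _ = |C| := mul_one _
  · rw [ContinuousLinearMap.norm_smulRight_apply]
    exact mul_le_mul ((hB x).trans (le_abs_self B)) (h1 _) (norm_nonneg _) (abs_nonneg _)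

/-- A stable vector at `x` has only a small center-unstable component at `y`, and conversely:
transporting that component for time `T`, forward or backward, shows that it is at most a
contraction error plus the difference of the cocycles at `x` and `y`. Only uniform bounds on the
projections enter, not their continuity. -/
theorem holder_Ps : BddHolder c.ι c.Ps := by
  obtain ⟨C, a, ha, hs⟩ := c.hyp_s
  obtain ⟨D, hD, hcu⟩ := c.exists_bound_Pcu
  obtain ⟨B, hB, hPs⟩ := c.exists_bound_Ps
  obtain ⟨L, b, r, hL, hb, hr, hr1, hA1, hA2⟩ := c.expHolder_A
  have hs' : ∀ x t, 0 ≤ t → ‖(c.A t x).comp (c.Ps x)‖ ≤ |C| * Real.exp (-a * t) := fun x t ht =>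
    (hs x t ht).trans (mul_le_mul_of_nonneg_right (le_abs_self C) (Real.exp_pos _).le)
  have hcu0 : ∀ x, ‖c.Pcu x‖ ≤ D := fun x => by
    have := hcu x 0 le_rfl
    rwa [neg_zero, c.A_zero_Pcu] at this
  have est1 : ∀ T : ℝ, 0 ≤ T → ∀ x y, ‖(c.Pcu y).comp (c.Ps x)‖ ≤
      D * (|C| * Real.exp (-a * T) + L * Real.exp (b * T) * ‖c.ι x - c.ι y‖ ^ r * B) := by
    intro T hT x y
    -- `Pcu y` is factored as transport to `φ_T y`, projection, and bounded transport back. The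
    -- forward transport is then replaced by the one along the orbit of `x`, which contracts the
    -- range of `Ps x`.
    have e : (c.Pcu y).comp (c.Ps x) = ((c.A (-T) (c.φ T y)).comp (c.Pcu (c.φ T y))).comp
        ((c.A T x).comp (c.Ps x) - (c.A T x - c.A T y).comp (c.Ps x)) := by
      have : (c.A T x).comp (c.Ps x) - (c.A T x - c.A T y).comp (c.Ps x)
          = (c.A T y).comp (c.Ps x) := by
        rw [ContinuousLinearMap.sub_comp]; abel
      rw [this]
      have h3 : ((c.A (-T) (c.φ T y)).comp (c.Pcu (c.φ T y))).comp (c.A T y) = c.Pcu y := by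
        rw [ContinuousLinearMap.comp_assoc, c.Pcu_comm, ← ContinuousLinearMap.comp_assoc,
          c.A_neg_comp_A, c.A_zero_Pcu]
      rw [← ContinuousLinearMap.comp_assoc, h3]
    rw [e]
    refine (ContinuousLinearMap.opNorm_comp_le _ _).trans
      (mul_le_mul (hcu _ _ hT) ?_ (norm_nonneg _) hD)
    refine (norm_sub_le _ _).trans (add_le_add (hs' _ _ hT) ?_)
    refine (ContinuousLinearMap.opNorm_comp_le _ _).trans ?_
    have := hA2 T x y
    rw [abs_of_nonneg hT] at this
    exact mul_le_mul this (hPs x) (norm_nonneg _) (by positivity)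
  have est2 : ∀ T : ℝ, 0 ≤ T → ∀ x y, ‖(c.Ps y).comp (c.Pcu x)‖ ≤
      |C| * Real.exp (-a * T) * (D + L * Real.exp (b * T) * ‖c.ι x - c.ι y‖ ^ r * D) := by
    intro T hT x y
    have e : (c.Ps y).comp (c.Pcu x) =
        ((c.A T (c.φ (-T) y)).comp (c.Ps (c.φ (-T) y))).comp
        ((c.A (-T) x).comp (c.Pcu x) - (c.A (-T) x - c.A (-T) y).comp (c.Pcu x)) := by
      have : (c.A (-T) x).comp (c.Pcu x) - (c.A (-T) x - c.A (-T) y).comp (c.Pcu x)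
          = (c.A (-T) y).comp (c.Pcu x) := by
        rw [ContinuousLinearMap.sub_comp]; abel
      rw [this]
      have h3 : ((c.A T (c.φ (-T) y)).comp (c.Ps (c.φ (-T) y))).comp (c.A (-T) y) = c.Ps y := by
        rw [ContinuousLinearMap.comp_assoc, c.Ps_comm, ← ContinuousLinearMap.comp_assoc]
        have := c.A_neg_comp_A (-T) y
        rw [neg_neg] at this
        rw [this, c.A_zero_Ps]
      rw [← ContinuousLinearMap.comp_assoc, h3]
    rw [e]
    refine (ContinuousLinearMap.opNorm_comp_le _ _).trans
      (mul_le_mul (hs' _ _ hT) ?_ (norm_nonneg _) (by positivity))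
    refine (norm_sub_le _ _).trans (add_le_add (hcu _ _ hT) ?_)
    refine (ContinuousLinearMap.opNorm_comp_le _ _).trans ?_
    have := hA2 (-T) x y
    rw [abs_neg, abs_of_nonneg hT] at this
    exact mul_le_mul this (hcu0 x) (norm_nonneg _) (by positivity)
  refine BddHolder.of_forall_exp (C := (D * |C| + D * L * B + |C| * D + |C| * L * D + 2 * B * L))
    ha hb hr hPs fun T hT x y => ?_
  set d := ‖c.ι x - c.ι y‖ ^ r with hd
  have hd0 : 0 ≤ d := Real.rpow_nonneg (norm_nonneg _) _
  have hE1 : Real.exp (-a * T) ≤ 1 := Real.exp_le_one_iff.2 (by nlinarith)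
  have hE0 := Real.exp_pos (-a * T)
  have hF0 : 1 ≤ Real.exp (b * T) := Real.one_le_exp (by positivity)
  have hQ : ‖c.A 0 x - c.A 0 y‖ ≤ L * d := by simpa using hA2 0 x y
  -- Expanding `Pcu = A 0 - Ps` makes the products `Ps y ∘ Ps x` cancel. The last two terms are
  -- needed because the fibre projections `A 0 x` and `A 0 y` differ.
  have e : c.Ps x - c.Ps y = (c.Pcu y).comp (c.Ps x) - (c.Ps y).comp (c.Pcu x)
      + ((c.A 0 x - c.A 0 y).comp (c.Ps x) + (c.Ps y).comp (c.A 0 x - c.A 0 y)) := by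
    simp only [Pcu, ContinuousLinearMap.sub_comp, ContinuousLinearMap.comp_sub, c.A_zero_Ps,
      c.Ps_A_zero]
    abel
  have n3 : ‖(c.A 0 x - c.A 0 y).comp (c.Ps x)‖ ≤ L * d * B :=
    (ContinuousLinearMap.opNorm_comp_le _ _).trans
      (mul_le_mul hQ (hPs x) (norm_nonneg _) (by positivity))
  have n4 : ‖(c.Ps y).comp (c.A 0 x - c.A 0 y)‖ ≤ B * (L * d) :=
    (ContinuousLinearMap.opNorm_comp_le _ _).trans
      (mul_le_mul (hPs y) hQ (norm_nonneg _) (by positivity))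
  have n1 := est1 T hT x y
  have n2 := est2 T hT x y
  rw [← hd] at n1 n2
  have key : ‖c.Ps x - c.Ps y‖ ≤
      D * (|C| * Real.exp (-a * T) + L * Real.exp (b * T) * d * B)
      + |C| * Real.exp (-a * T) * (D + L * Real.exp (b * T) * d * D)
      + (L * d * B + B * (L * d)) := by
    rw [e]
    refine (norm_add_le _ _).trans (add_le_add ((norm_sub_le _ _).trans (add_le_add n1 n2)) ?_)
    exact (norm_add_le _ _).trans (add_le_add n3 n4)
  refine key.trans ?_
  have hC := abs_nonneg C
  have m1 : |C| * Real.exp (-a * T) * (L * Real.exp (b * T) * d * D)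
      ≤ |C| * 1 * (L * Real.exp (b * T) * d * D) := by gcongr
  have m2 : L * d * B ≤ L * (Real.exp (b * T) * d) * B := by
    gcongr
    exact le_mul_of_one_le_left hd0 hF0
  have p1 : 0 ≤ Real.exp (b * T) * d := by positivity
  have q1 : 0 ≤ D * |C| * (Real.exp (b * T) * d) := by positivity
  have q2 : 0 ≤ |C| * L * D * Real.exp (-a * T) := by positivity
  have q3 : 0 ≤ D * L * B * Real.exp (-a * T) := by positivity
  have q4 : 0 ≤ B * L * Real.exp (-a * T) := by positivity
  nlinarith [m1, m2, p1, q1, q2, q3, q4]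

/-- Reversing time exchanges the stable and unstable projections. -/
theorem holder_Pu : BddHolder c.ι c.Pu := c.reverse.holder_Ps

/-- The center projection `eps ⊗ F = A 0 - Ps - Pu` is Hölder. So is `F`, which is bounded away from
zero and can therefore be divided out. -/
theorem holder_eps : BddHolder c.ι c.eps := by
  have h1 : BddHolder c.ι (fun x => (c.eps x).smulRight (c.F x)) := by
    have : BddHolder c.ι (fun x => c.A 0 x - c.Ps x - c.Pu x) :=
      ((c.expHolder_A.at_time 0).sub c.holder_Ps).sub c.holder_Pu
    have e : ∀ x, c.A 0 x - c.Ps x - c.Pu x = (c.eps x).smulRight (c.F x) := fun x => by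
      rw [c.split]; abel
    simpa only [e] using this
  obtain ⟨C, b, r, hC, hb, hr, ⟨-, h2⟩, -, k2⟩ := ExpHolder.common h1 c.holder_F
  obtain ⟨m, hm, hF⟩ := c.F_lower
  obtain ⟨B, hB⟩ := c.bound_eps
  refine BddHolder.of_le (C := |B| + m⁻¹ * (C * (1 + |B|))) hr (fun x => ?_) fun x y => ?_
  · have : 0 ≤ m⁻¹ * (C * (1 + |B|)) := by positivity
    linarith [hB x, le_abs_self B]
  have hd0 : 0 ≤ ‖c.ι x - c.ι y‖ ^ r := Real.rpow_nonneg (norm_nonneg _) _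
  have a2 : ‖(c.eps x).smulRight (c.F x) - (c.eps y).smulRight (c.F y)‖
      ≤ C * ‖c.ι x - c.ι y‖ ^ r := by simpa using h2 0 x y
  have b2 : ‖c.F x - c.F y‖ ≤ C * ‖c.ι x - c.ι y‖ ^ r := by simpa using k2 0 x y
  have e : (c.eps x - c.eps y).smulRight (c.F x) =
      ((c.eps x).smulRight (c.F x) - (c.eps y).smulRight (c.F y))
        - (c.eps y).smulRight (c.F x - c.F y) := by
    ext w
    simp only [ContinuousLinearMap.smulRight_apply, sub_apply, sub_smul, smul_sub]
    abel
  have h3 : ‖c.eps x - c.eps y‖ * ‖c.F x‖ ≤ C * ‖c.ι x - c.ι y‖ ^ r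
      + |B| * (C * ‖c.ι x - c.ι y‖ ^ r) := by
    rw [← ContinuousLinearMap.norm_smulRight_apply, e]
    refine (norm_sub_le _ _).trans (add_le_add a2 ?_)
    rw [ContinuousLinearMap.norm_smulRight_apply]
    exact mul_le_mul ((hB y).trans (le_abs_self B)) b2 (norm_nonneg _) (abs_nonneg _)
  have h4 : ‖c.eps x - c.eps y‖ * m ≤ C * ‖c.ι x - c.ι y‖ ^ r
      + |B| * (C * ‖c.ι x - c.ι y‖ ^ r) :=
    (mul_le_mul_of_nonneg_left (hF x) (norm_nonneg _)).trans h3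
  rw [← le_div_iff₀ hm] at h4
  refine h4.trans ?_
  have : 0 ≤ |B| * ‖c.ι x - c.ι y‖ ^ r := by positivity
  rw [div_eq_inv_mul, add_mul]
  linarith

/-! ### The split-propagate formula for a cocycle. -/

section Covector

variable (ξ : K → W →L[ℝ] ℝ)

/-- The integrand of the stable part of the split-propagate formula. -/
def sPart (x : K) (t : ℝ) : W →L[ℝ] ℝ := ((ξ (c.φ t x)).comp (c.Ps (c.φ t x))).comp (c.A t x)

/-- The stable part of the split-propagate formula. -/
def sInt (x : K) : W →L[ℝ] ℝ := ∫ t in Ici (0 : ℝ), c.sPart ξ x t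

variable {ξ} (hξ : BddHolder c.ι ξ)
include hξ

theorem expHolder_sPart : ExpHolder c.ι (fun t x => c.sPart ξ x t) :=
  ((hξ.comp_flow c.expLipschitz_φ).comp_clm
    (c.holder_Ps.comp_flow c.expLipschitz_φ)).comp_clm c.expHolder_A

theorem continuous_sPart (x : K) : Continuous (c.sPart ξ x) :=
  ((hξ.continuous_comp (c.continuous_φ x)).clm_comp
    (c.holder_Ps.continuous_comp (c.continuous_φ x))).clm_comp (c.continuous_A x)

theorem sPart_decay : ∃ C a : ℝ, 0 < a ∧ ∀ t x, 0 ≤ t →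
    ‖c.sPart ξ x t‖ ≤ C * Real.exp (-a * t) := by
  obtain ⟨C, a, ha, hs⟩ := c.hyp_s
  obtain ⟨B, r, hB, -, -, h1, -⟩ := hξ.exists_bound
  refine ⟨B * C, a, ha, fun t x ht => ?_⟩
  rw [sPart, ContinuousLinearMap.comp_assoc, c.Ps_comm, mul_assoc]
  exact (ContinuousLinearMap.opNorm_comp_le _ _).trans
    (mul_le_mul (h1 _) (hs x t ht) (norm_nonneg _) hB)

theorem integrableOn_sPart (x : K) : IntegrableOn (c.sPart ξ x) (Ici 0) := by
  obtain ⟨C, a, ha, h⟩ := c.sPart_decay hξ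
  exact integrableOn_of_exp_decay (c.continuous_sPart hξ x) ha fun t ht => h t x ht

theorem holder_sInt : BddHolder c.ι (c.sInt ξ) := by
  obtain ⟨C, a, ha, h⟩ := c.sPart_decay hξ
  exact (c.expHolder_sPart hξ).integral_Ici (c.continuous_sPart hξ) ha h

theorem sInt_apply (x : K) (w : W) : c.sInt ξ x w = ∫ t in Ici (0 : ℝ), c.sPart ξ x t w :=
  ContinuousLinearMap.integral_apply (c.integrableOn_sPart hξ x) w

/-- By the cocycle identity, pulling back over time `s` only shifts the time variable of the
integrand; differentiation in `s` thus becomes differentiation of a shifted integral. -/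
theorem sInt_comp_A (x : K) (s : ℝ) :
    (c.sInt ξ (c.φ s x)).comp (c.A s x) = ∫ t in Ici (0 : ℝ), c.sPart ξ x (t + s) := by
  have := ContinuousLinearMap.integral_comp_comm
    ((ContinuousLinearMap.compL ℝ W W ℝ).flip (c.A s x))
    (c.integrableOn_sPart hξ (c.φ s x))
  have e : ∀ t, c.sPart ξ x (t + s) = (c.sPart ξ (c.φ s x) t).comp (c.A s x) := fun t => by
    simp only [sPart, c.φ_add, c.A_add, ContinuousLinearMap.comp_assoc]
  simp_rw [e]
  exact this.symm

theorem hasDerivAt_sInt (x : K) :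
    HasDerivAt (fun s => (c.sInt ξ (c.φ s x)).comp (c.A s x)) (-(ξ x).comp (c.Ps x)) 0 := by
  have := hasDerivAt_integral_Ici_comp_add (c.continuous_sPart hξ x) (c.integrableOn_sPart hξ x)
  have e : c.sPart ξ x 0 = (ξ x).comp (c.Ps x) := by
    rw [sPart, c.φ_zero, ContinuousLinearMap.comp_assoc, c.Ps_A_zero]
  rw [e] at this
  simpa only [c.sInt_comp_A hξ] using this

theorem sInt_F (x : K) : c.sInt ξ x (c.F x) = 0 := by
  rw [c.sInt_apply hξ]
  simp [sPart, c.A_F, c.Ps_F]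

omit hξ in
theorem hasDerivAt_eps {ψ : K → ℝ} {p : ℝ} {x : K} (hψ : HasDerivAt (fun t => ψ (c.φ t x)) p 0) :
    HasDerivAt (fun t => (ψ (c.φ t x) • c.eps (c.φ t x)).comp (c.A t x)) (p • c.eps x) 0 := by
  simp only [ContinuousLinearMap.smul_comp, c.eps_A]
  exact HasDerivAt.smul_const hψ (c.eps x)

omit hξ in
/-- The split-propagate formula. -/
def adj (ξ : K → W →L[ℝ] ℝ) (ψ : K → ℝ) (x : K) : W →L[ℝ] ℝ :=
  c.sInt ξ x - c.reverse.sInt ξ x - ψ x • c.eps x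

theorem holder_adj {ψ : K → ℝ} (hψ : BddHolder c.ι ψ) : BddHolder c.ι (c.adj ξ ψ) :=
  ((c.holder_sInt hξ).sub (c.reverse.holder_sInt hξ)).sub (hψ.smul c.holder_eps)

/-- The three terms contribute `-ξ Ps`, `-ξ Pu` and `-ξ(F) eps`, which add up to `-ξ ∘ A 0`. In the
unstable term the sign from reversing time cancels against the minus sign of the derivative in
`hasDerivAt_sInt`, and the subtraction in `adj` remains; the center term uses that the pullback of
`eps` is constant. -/
theorem hasDerivAt_adj {ψ : K → ℝ} {x : K}
    (hψ : HasDerivAt (fun t => ψ (c.φ t x)) (ξ x (c.F x)) 0) :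
    HasDerivAt (fun s => (c.adj ξ ψ (c.φ s x)).comp (c.A s x)) (-(ξ x).comp (c.A 0 x)) 0 := by
  have h2 := HasDerivAt.scomp (0 : ℝ) (by simpa using c.reverse.hasDerivAt_sInt hξ x)
    (hasDerivAt_neg (0 : ℝ))
  have h := ((c.hasDerivAt_sInt hξ x).sub h2).sub (c.hasDerivAt_eps hψ)
  refine (h.congr_deriv ?_).congr_of_eventuallyEq (Eventually.of_forall fun s => ?_)
  rotate_left
  · simp [adj, ContinuousLinearMap.sub_comp, reverse]
  · rw [c.split]
    ext w
    simp [reverse]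
    ring

theorem adj_F (ψ : K → ℝ) (x : K) : c.adj ξ ψ x (c.F x) = -ψ x := by
  have : c.reverse.sInt ξ x (c.F x) = 0 := c.reverse.sInt_F hξ x
  simp [adj, c.sInt_F hξ, this, c.eps_F]

end Covector

/-! ### The shadowing vector field of a cocycle. -/

section Vector

variable (X : K → W)

/-- The vector at `x` collects the stable parts of `X` from the past of the orbit, since stable
vectors contract on their way forward to `x`. -/
def vPart (x : K) (t : ℝ) : W := c.A t (c.φ (-t) x) (c.Ps (c.φ (-t) x) (X (c.φ (-t) x)))

/-- The stable part of the shadowing vector field. -/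
def vInt (x : K) : W := ∫ t in Ici (0 : ℝ), c.vPart X x t

variable {X} (hX : BddHolder c.ι X)
include hX

theorem expHolder_vPart : ExpHolder c.ι (fun t x => c.vPart X x t) :=
  (c.expHolder_A.comp_flow c.expLipschitz_φ.neg_time).clm_apply
    ((c.holder_Ps.comp_flow c.expLipschitz_φ.neg_time).clm_apply
      (hX.comp_flow c.expLipschitz_φ.neg_time))

theorem continuous_vPart (x : K) : Continuous (c.vPart X x) := by
  have h : Continuous fun t => c.ι (c.φ (-t) x) := (c.continuous_φ x).comp continuous_neg
  exact (c.expHolder_A.continuous_diag c.continuous_A h).clm_apply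
    ((c.holder_Ps.continuous_comp h).clm_apply (hX.continuous_comp h))

theorem vPart_decay : ∃ C a : ℝ, 0 < a ∧ ∀ t x, 0 ≤ t →
    ‖c.vPart X x t‖ ≤ C * Real.exp (-a * t) := by
  obtain ⟨C, a, ha, hs⟩ := c.hyp_s
  obtain ⟨B, r, hB, -, -, h1, -⟩ := hX.exists_bound
  refine ⟨C * B, a, ha, fun t x ht => ?_⟩
  have h := hs (c.φ (-t) x) t ht
  rw [vPart, mul_right_comm]
  exact (((c.A t _).comp (c.Ps _)).le_opNorm _).trans
    (mul_le_mul h (h1 _) (norm_nonneg _) ((norm_nonneg _).trans h))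

theorem integrableOn_vPart (x : K) : IntegrableOn (c.vPart X x) (Ici 0) := by
  obtain ⟨C, a, ha, h⟩ := c.vPart_decay hX
  exact integrableOn_of_exp_decay (c.continuous_vPart hX x) ha fun t ht => h t x ht

theorem holder_vInt : BddHolder c.ι (c.vInt X) := by
  obtain ⟨C, a, ha, h⟩ := c.vPart_decay hX
  exact (c.expHolder_vPart hX).integral_Ici (c.continuous_vPart hX) ha h

variable [CompleteSpace W]

/-- Transport back from `φ_s x` to `x` lowers the propagation time by `s` while the starting point
`φ_{s-t} x` is unchanged, so the integrand is shifted by `-s`. -/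
theorem A_vInt (x : K) (s : ℝ) :
    c.A (-s) (c.φ s x) (c.vInt X (c.φ s x)) = ∫ t in Ici (0 : ℝ), c.vPart X x (t + -s) := by
  have := (c.A (-s) (c.φ s x)).integral_comp_comm (c.integrableOn_vPart hX (c.φ s x))
  rw [vInt, ← this]
  congr 1
  funext t
  have e : c.φ (-t) (c.φ s x) = c.φ (-(t + -s)) x := by
    rw [← c.φ_add]; congr 1; ring
  have e2 : c.φ t (c.φ (-(t + -s)) x) = c.φ s x := by
    rw [← c.φ_add]; congr 1; ring
  rw [vPart, vPart, e, add_comm t (-s), c.A_add (-s) t, add_comm (-s) t, e2]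
  rfl

theorem hasDerivAt_vInt (x : K) :
    HasDerivAt (fun s => c.A (-s) (c.φ s x) (c.vInt X (c.φ s x))) (c.Ps x (X x)) 0 := by
  have h := hasDerivAt_integral_Ici_comp_add (c.continuous_vPart hX x) (c.integrableOn_vPart hX x)
  have e : c.vPart X x 0 = c.Ps x (X x) := by
    rw [vPart, neg_zero, c.φ_zero, ← ContinuousLinearMap.comp_apply, c.A_zero_Ps]
  rw [e] at h
  have h2 := HasDerivAt.scomp (0 : ℝ) (by simpa using h) (hasDerivAt_neg (0 : ℝ))
  simpa only [c.A_vInt hX, Function.comp_def, neg_smul, one_smul, neg_neg] using h2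

omit hX [CompleteSpace W] in
/-- The shadowing vector field. -/
def shadow (X : K → W) (x : K) : W := c.vInt X x - c.reverse.vInt X x

omit [CompleteSpace W] in
theorem holder_shadow : BddHolder c.ι (c.shadow X) :=
  (c.holder_vInt hX).sub (c.reverse.holder_vInt hX)

/-- The stable and unstable integrals produce `Ps X + Pu X`. The missing center part `eps(X) F` is
what `η = eps(X)` supplies in a shadowing pair. -/
theorem hasDerivAt_shadow (x : K) :
    HasDerivAt (fun s => c.A (-s) (c.φ s x) (c.shadow X (c.φ s x)))
      (c.A 0 x (X x) - c.eps x (X x) • c.F x) 0 := by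
  have h2 := HasDerivAt.scomp (0 : ℝ) (by simpa using c.reverse.hasDerivAt_vInt hX x)
    (hasDerivAt_neg (0 : ℝ))
  have h := (c.hasDerivAt_vInt hX x).sub h2
  convert h using 1
  · funext s
    simp [shadow, reverse]
  · rw [c.split]
    simp [reverse]

end Vector

/-! ### Uniqueness of bounded adjoint solutions along an orbit. -/

theorem tendsto_const_mul_exp {C a : ℝ} (ha : 0 < a) :
    Tendsto (fun t : ℝ => C * Real.exp (-a * t)) atTop (𝓝 0) := by
  have : Tendsto (fun T : ℝ => Real.exp (-a * T)) atTop (𝓝 0) :=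
    Real.tendsto_exp_atBot.comp (tendsto_id.const_mul_atTop_of_neg (neg_neg_of_pos ha))
  simpa using this.const_mul C

/-- On stable vectors `μ` equals a bounded covector applied to a vector that tends to zero. -/
theorem comp_Ps_eq_zero {μ : W →L[ℝ] ℝ} {N : ℝ → W →L[ℝ] ℝ} {x : K} {B : ℝ}
    (hN : ∀ t, (N t).comp (c.A t x) = μ) (hB : ∀ t, ‖N t‖ ≤ B) : μ.comp (c.Ps x) = 0 := by
  obtain ⟨C, a, ha, hs⟩ := c.hyp_s
  have hB0 : 0 ≤ B := (norm_nonneg _).trans (hB 0)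
  have : ‖μ.comp (c.Ps x)‖ ≤ 0 := by
    refine ge_of_tendsto (tendsto_const_mul_exp (C := B * C) ha)
      ((eventually_ge_atTop 0).mono fun t ht => ?_)
    rw [← hN t, ContinuousLinearMap.comp_assoc, mul_assoc]
    exact (ContinuousLinearMap.opNorm_comp_le _ _).trans
      (mul_le_mul (hB t) (hs x t ht) (norm_nonneg _) hB0)
  exact norm_le_zero_iff.1 this

/-- A homogeneous adjoint solution which is bounded along an orbit and vanishes on the flow
direction is zero. -/
theorem comp_A_zero_eq_zero {μ : W →L[ℝ] ℝ} {N : ℝ → W →L[ℝ] ℝ} {x : K} {B : ℝ}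
    (hN : ∀ t, (N t).comp (c.A t x) = μ) (hB : ∀ t, ‖N t‖ ≤ B) (hF : μ (c.F x) = 0) :
    μ.comp (c.A 0 x) = 0 := by
  have h1 := c.comp_Ps_eq_zero hN hB
  have h2 : μ.comp (c.Pu x) = 0 :=
    c.reverse.comp_Ps_eq_zero (N := fun t => N (-t)) (fun t => hN (-t)) (fun t => hB (-t))
  rw [c.split, ContinuousLinearMap.comp_add, ContinuousLinearMap.comp_add, h1, h2]
  ext w
  simp [hF]

end HypCocycle

/-! ### The maximal ergodic inequality. -/

section MaximalErgodic

variable {Ω : Type*} [MeasurableSpace Ω] {ρ : Measure Ω} {T : Ω → Ω} {f : Ω → ℝ}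

/-- The maximum of `0` and the first `n` Birkhoff sums of `f`. -/
def birkhoffMax (T : Ω → Ω) (f : Ω → ℝ) : ℕ → Ω → ℝ
  | 0, _ => 0
  | n + 1, x => max 0 (f x + birkhoffMax T f n (T x))

theorem birkhoffMax_nonneg (n : ℕ) (x : Ω) : 0 ≤ birkhoffMax T f n x := by
  cases n with
  | zero => exact le_rfl
  | succ n => exact le_max_left _ _

theorem birkhoffMax_le_succ (n : ℕ) (x : Ω) : birkhoffMax T f n x ≤ birkhoffMax T f (n + 1) x := by
  induction n generalizing x with
  | zero => exact le_max_left _ _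
  | succ n ih => exact max_le_max le_rfl (add_le_add le_rfl (ih _))

theorem birkhoffSum_le_birkhoffMax (n : ℕ) (x : Ω) : birkhoffSum T f n x ≤ birkhoffMax T f n x := by
  induction n generalizing x with
  | zero => simp [birkhoffMax]
  | succ n ih =>
    rw [birkhoffSum_succ']
    exact (add_le_add le_rfl (ih _)).trans (le_max_right _ _)

theorem measurable_birkhoffMax (hT : Measurable T) (hf : Measurable f) (n : ℕ) :
    Measurable (birkhoffMax T f n) := by
  induction n with
  | zero => exact measurable_const
  | succ n ih => exact measurable_const.max (hf.add (ih.comp hT))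

theorem birkhoffMax_le {B : ℝ} (hB : ∀ x, |f x| ≤ B) (n : ℕ) (x : Ω) :
    birkhoffMax T f n x ≤ n * B := by
  induction n generalizing x with
  | zero => simp [birkhoffMax]
  | succ n ih =>
    have hB0 : 0 ≤ B := (abs_nonneg _).trans (hB x)
    refine max_le (by positivity) ?_
    push_cast
    linarith [ih (T x), (le_abs_self _).trans (hB x)]

/-- A form of the maximal ergodic theorem. -/
theorem integral_nonneg_of_birkhoffSum_pos [IsProbabilityMeasure ρ] (hT : MeasurePreserving T ρ ρ)
    (hf : Measurable f) {B : ℝ} (hB : ∀ x, |f x| ≤ B)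
    (h : ∀ᵐ x ∂ρ, ∃ n, 0 < birkhoffSum T f n x) : 0 ≤ ∫ x, f x ∂ρ := by
  set M := birkhoffMax T f with hM
  have hMm : ∀ n, Measurable (M n) := measurable_birkhoffMax hT.measurable hf
  have hMi : ∀ n, Integrable (M n) ρ := fun n =>
    Integrable.of_bound (hMm n).aestronglyMeasurable (n * B) (ae_of_all _ fun x => by
      rw [Real.norm_eq_abs, abs_of_nonneg (birkhoffMax_nonneg n x)]
      exact birkhoffMax_le hB n x)
  have hset : ∀ n, MeasurableSet {x | 0 < M n x} := fun n =>
    measurableSet_lt measurable_const (hMm n)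
  have hbound : ∀ n x, ‖({x | 0 < M n x}.indicator f) x‖ ≤ B := fun n x =>
    (norm_indicator_le_norm_self _ _).trans (hB x)
  have hfi : ∀ n, Integrable ({x | 0 < M n x}.indicator f) ρ := fun n =>
    Integrable.of_bound (hf.indicator (hset n)).aestronglyMeasurable B (ae_of_all _ (hbound n))
  -- Garsia's argument: where `M n > 0` the recursion and monotonicity in `n` give `M n ≤ f + M n ∘
  -- T`; elsewhere `M n = 0 ≤ M n ∘ T`. Hence `M n - M n ∘ T`, whose integral is zero by invariance,
  -- lies below `f` restricted to `{M n > 0}`.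
  have hpos : ∀ n, 0 ≤ ∫ x, ({x | 0 < M n x}.indicator f) x ∂ρ := by
    intro n
    have e : ∫ x, (M n x - M n (T x)) ∂ρ = 0 := by
      have hi : Integrable (fun x => M n (T x)) ρ := hT.integrable_comp_of_integrable (hMi n)
      rw [integral_sub (hMi n) hi,
        ← integral_map hT.measurable.aemeasurable (by
          rw [hT.map_eq]; exact (hMm n).aestronglyMeasurable), hT.map_eq, sub_self]
    refine e.symm.le.trans (integral_mono ((hMi n).sub (hT.integrable_comp_of_integrable (hMi n))) (hfi n)
      fun x => ?_)
    by_cases hx : 0 < M n x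
    · rw [indicator_of_mem (show x ∈ {x | 0 < M n x} from hx)]
      cases n with
      | zero => exact absurd hx (lt_irrefl 0)
      | succ n =>
        have h1 : M (n + 1) x = f x + M n (T x) := by
          have : M (n + 1) x = max 0 (f x + M n (T x)) := rfl
          rw [this, max_eq_right_iff]
          by_contra hc
          rw [this, max_eq_left (not_le.1 hc).le] at hx
          exact lt_irrefl _ hx
        have h2 : M n (T x) ≤ M (n + 1) (T x) := birkhoffMax_le_succ n (T x)
        change M (n + 1) x - M (n + 1) (T x) ≤ f x
        linarith
    · rw [indicator_of_notMem (show x ∉ {x | 0 < M n x} from hx)]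
      have := birkhoffMax_nonneg (T := T) (f := f) n (T x)
      have hx' : M n x ≤ 0 := not_lt.1 hx
      change M n x - M n (T x) ≤ 0
      linarith
  -- The sets `{M n > 0}` increase to a set of full measure by hypothesis, so the restricted
  -- functions converge to `f` almost everywhere.
  refine ge_of_tendsto' (tendsto_integral_of_dominated_convergence (fun _ => B)
    (fun n => (hfi n).aestronglyMeasurable) (integrable_const B)
    (fun n => ae_of_all _ (hbound n)) ?_) hpos
  filter_upwards [h] with x ⟨n, hn⟩
  refine tendsto_const_nhds.congr' ?_
  filter_upwards [eventually_ge_atTop n] with k hk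
  have : 0 < M k x := (hn.trans_le (birkhoffSum_le_birkhoffMax n x)).trans_le
    (monotone_nat_of_le_succ (f := fun n => M n x) (fun n => birkhoffMax_le_succ n x) hk)
  exact (indicator_of_mem (show x ∈ {x | 0 < M k x} from this) f).symm

end MaximalErgodic

/-! ### Measure preserving flows on compact spaces: derivatives along the flow and Birkhoff
averages. -/

section FlowAverages

variable {K : Type*} [TopologicalSpace K] [CompactSpace K] [SecondCountableTopology K]
  [MeasurableSpace K] [BorelSpace K] {φ : ℝ → K → K} {ρ : Measure K} [IsProbabilityMeasure ρ]

theorem exists_abs_bound {g : K → ℝ} (hg : Continuous g) : ∃ B : ℝ, 0 ≤ B ∧ ∀ x, |g x| ≤ B := by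
  obtain ⟨B, hB⟩ := isCompact_univ.exists_bound_of_continuousOn hg.continuousOn
  exact ⟨max B 0, le_max_right _ _, fun x => (hB x (mem_univ x)).trans (le_max_left _ _)⟩

theorem integrable_of_continuous {g : K → ℝ} (hg : Continuous g) : Integrable g ρ := by
  obtain ⟨B, -, hB⟩ := exists_abs_bound hg
  exact Integrable.of_bound hg.aestronglyMeasurable B (ae_of_all _ hB)

/-- The derivative of a function along a measure preserving flow has integral zero. -/
theorem integral_deriv_along_flow_eq_zero (hadd : ∀ s t x, φ (s + t) x = φ s (φ t x))
    (hρ : ∀ t, MeasurePreserving (φ t) ρ ρ) {g h : K → ℝ} (hg : Continuous g)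
    (hh : Continuous h) (h0 : ∀ x, φ 0 x = x)
    (hgh : ∀ x, HasDerivAt (fun t => g (φ t x)) (h x) 0) : ∫ x, h x ∂ρ = 0 := by
  obtain ⟨B, hB0, hB⟩ := exists_abs_bound hh
  have hd : ∀ x t, HasDerivAt (fun t => g (φ t x)) (h (φ t x)) t := fun x t => by
    have h1 : HasDerivAt (fun s => g (φ s (φ t x))) (h (φ t x)) (t - t) := by
      rw [sub_self]; exact hgh (φ t x)
    have := HasDerivAt.comp_sub_const t t h1
    simpa [← hadd] using this
  -- Difference quotients at times `1 / (n + 1)`: their integrals vanish by invariance, the mean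
  -- value inequality bounds them by the sup of `|h|`, and they converge to `h`.
  set q : ℕ → K → ℝ := fun n x => ((n : ℝ) + 1) * (g (φ (1 / ((n : ℝ) + 1)) x) - g x) with hq
  have hgm : ∀ t, Measurable fun x => g (φ t x) := fun t =>
    hg.measurable.comp (hρ t).measurable
  have hgi : ∀ t, Integrable (fun x => g (φ t x)) ρ := fun t =>
    (hρ t).integrable_comp_of_integrable (integrable_of_continuous hg)
  have hint : ∀ n, ∫ x, q n x ∂ρ = 0 := fun n => by
    simp only [hq]
    rw [integral_const_mul, integral_sub (hgi _) (integrable_of_continuous hg),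
      ← integral_map (hρ _).measurable.aemeasurable (by
        rw [(hρ _).map_eq]; exact hg.aestronglyMeasurable), (hρ _).map_eq, sub_self, mul_zero]
  have hlim := tendsto_integral_of_dominated_convergence (μ := ρ) (F := q) (f := h) (fun _ => B)
    (fun n => ((hgm _).sub hg.measurable |>.const_mul _).aestronglyMeasurable)
    (integrable_const B) (fun n => ae_of_all _ fun x => ?_) (ae_of_all _ fun x => ?_)
  · simp only [hint] at hlim
    exact tendsto_nhds_unique hlim tendsto_const_nhds
  · have hn : (0 : ℝ) < (n : ℝ) + 1 := by positivity
    have := Convex.norm_image_sub_le_of_norm_hasDerivWithin_le (s := univ) (C := B)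
      (fun t _ => (hd x t).hasDerivWithinAt) (fun t _ => hB _) convex_univ (mem_univ 0)
      (mem_univ (1 / ((n : ℝ) + 1)))
    rw [h0, sub_zero, Real.norm_of_nonneg (by positivity : 0 ≤ 1 / ((n : ℝ) + 1))] at this
    rw [hq, norm_mul, Real.norm_of_nonneg hn.le]
    calc _ ≤ ((n : ℝ) + 1) * (B * (1 / ((n : ℝ) + 1))) :=
          mul_le_mul_of_nonneg_left this hn.le
      _ = B := by field_simp
  · have h1 := (hgh x).tendsto_slope
    have h2 : Tendsto (fun n : ℕ => 1 / ((n : ℝ) + 1)) atTop (𝓝[≠] 0) :=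
      tendsto_nhdsWithin_iff.2 ⟨tendsto_one_div_add_atTop_nhds_zero_nat,
        Eventually.of_forall fun n => (by positivity : (1 : ℝ) / ((n : ℝ) + 1) ≠ 0)⟩
    refine (h1.comp h2).congr fun n => ?_
    simp [slope_def_field, hq, h0, div_eq_mul_inv, mul_comm]

variable (hφ : Continuous fun p : ℝ × K => φ p.1 p.2)
  (hadd : ∀ s t x, φ (s + t) x = φ s (φ t x)) (h0 : ∀ x, φ 0 x = x)
  (hρ : ∀ t, MeasurePreserving (φ t) ρ ρ)
include hφ

theorem continuous_flow_integral {g : K → ℝ} (hg : Continuous g) (T : ℝ) :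
    Continuous fun x => ∫ t in (0 : ℝ)..T, g (φ t x) :=
  intervalIntegral.continuous_parametric_intervalIntegral_of_continuous'
    (f := fun x t => g (φ t x)) (hg.comp (hφ.comp continuous_swap)) 0 T

theorem intervalIntegrable_flow {g : K → ℝ} (hg : Continuous g) (x : K) (a b : ℝ) :
    IntervalIntegrable (fun t => g (φ t x)) volume a b :=
  (hg.comp (hφ.comp (continuous_id.prodMk continuous_const))).intervalIntegrable a b

include hadd in
theorem flow_integral_shift {g : K → ℝ} (a b : ℝ) (x : K) :
    ∫ t in (0 : ℝ)..b, g (φ t (φ a x)) = ∫ t in a..(a + b), g (φ t x) := by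
  have := intervalIntegral.integral_comp_add_right (a := 0) (b := b) (fun t => g (φ t x)) a
  simp only [hadd] at this
  rw [this, zero_add, add_comm]

include hadd h0 in
theorem birkhoffSum_flow {g : K → ℝ} (hg : Continuous g) (n : ℕ) (x : K) :
    birkhoffSum (φ 1) (fun x => ∫ t in (0 : ℝ)..1, g (φ t x)) n x
      = ∫ t in (0 : ℝ)..n, g (φ t x) := by
  induction n with
  | zero => simp
  | succ n ih =>
    have e : ∀ n : ℕ, (φ 1)^[n] x = φ n x := fun n => by
      induction n with
      | zero => simp [h0]
      | succ n ih => rw [Function.iterate_succ_apply', ih, ← hadd]; push_cast; rw [add_comm]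
    rw [birkhoffSum_succ, ih, e, flow_integral_shift hφ hadd, Nat.cast_succ]
    exact intervalIntegral.integral_add_adjacent_intervals (intervalIntegrable_flow hφ hg x _ _)
      (intervalIntegrable_flow hφ hg x _ _)

include hρ in
theorem integral_flow_integral {g : K → ℝ} (hg : Continuous g) :
    ∫ x, (∫ t in (0 : ℝ)..1, g (φ t x)) ∂ρ = ∫ x, g x ∂ρ := by
  have hgc : Continuous fun p : K × ℝ => g (φ p.2 p.1) := hg.comp (hφ.comp continuous_swap)
  obtain ⟨B, -, hB⟩ := exists_abs_bound hg
  have hi : Integrable (Function.uncurry fun (x : K) (t : ℝ) => g (φ t x))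
      (ρ.prod (volume.restrict (Ioc (0 : ℝ) 1))) :=
    Integrable.of_bound hgc.aestronglyMeasurable B (ae_of_all _ fun p => hB _)
  simp only [intervalIntegral.integral_of_le zero_le_one]
  rw [integral_integral_swap hi]
  have : ∀ t, ∫ x, g (φ t x) ∂ρ = ∫ x, g x ∂ρ := fun t => by
    rw [← integral_map (hρ t).measurable.aemeasurable (by
        rw [(hρ t).map_eq]; exact hg.aestronglyMeasurable), (hρ t).map_eq]
  simp [this]

variable (herg : ∀ s : Set K, MeasurableSet s → (∀ t, φ t ⁻¹' s = s) → ρ s = 0 ∨ ρ sᶜ = 0)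
include hadd h0 hρ herg

/-- The set where the integrals over `[0, n]` exceed `a n` by arbitrarily large amounts is
invariant. Were it co-null, the maximal inequality for the time-one map would give `∫ g ≥ a`.
Ergodicity is used for the flow only, and the time-one map need not be ergodic. -/
theorem ae_flow_integral_le {g : K → ℝ} (hg : Continuous g) {a : ℝ} (ha : ∫ x, g x ∂ρ < a) :
    ∀ᵐ x ∂ρ, ∃ C : ℝ, ∀ᶠ n : ℕ in atTop, ∫ t in (0 : ℝ)..n, g (φ t x) ≤ a * n + C := by
  obtain ⟨B, hB0, hB⟩ := exists_abs_bound hg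
  set S : ℕ → K → ℝ := fun n x => ∫ t in (0 : ℝ)..n, g (φ t x) with hS
  have hSc : ∀ n, Continuous (S n) := fun n => continuous_flow_integral hφ hg n
  set s : Set K := {x | ∀ C : ℕ, ∃ᶠ n : ℕ in atTop, a * n + C < S n x} with hs
  have hsm : MeasurableSet s := by
    have : s = ⋂ C : ℕ, ⋂ N : ℕ, ⋃ n : ℕ, ⋃ _ : N ≤ n, {x | a * n + C < S n x} := by
      ext x
      simp [hs, frequently_atTop]
    rw [this]
    exact MeasurableSet.iInter fun C => MeasurableSet.iInter fun N => MeasurableSet.iUnion fun n =>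
      MeasurableSet.iUnion fun _ => measurableSet_lt measurable_const (hSc n).measurable
  -- The two time windows differ only near their ends, by pieces of length `|t|`. The error is
  -- uniform in `n`, and this makes `s` invariant under every `φ t`.
  have hshift : ∀ t x n, |S n (φ t x) - S n x| ≤ 2 * |t| * B := by
    intro t x n
    have e : S n (φ t x) - S n x
        = (∫ r in (n : ℝ)..(t + n), g (φ r x)) - ∫ r in (0 : ℝ)..t, g (φ r x) := by
      simp only [hS]
      rw [flow_integral_shift hφ hadd]
      exact intervalIntegral.integral_interval_sub_interval_comm
        (intervalIntegrable_flow hφ hg x _ _) (intervalIntegrable_flow hφ hg x _ _)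
        (intervalIntegrable_flow hφ hg x _ _) |>.trans (by
          rw [intervalIntegral.integral_symm (0 : ℝ) t,
            intervalIntegral.integral_symm (n : ℝ) (t + n)]; ring)
    rw [e]
    have b1 := intervalIntegral.norm_integral_le_of_norm_le_const
      (a := (n : ℝ)) (b := t + n) (f := fun r => g (φ r x)) (C := B) fun r _ => hB _
    have b2 := intervalIntegral.norm_integral_le_of_norm_le_const
      (a := (0 : ℝ)) (b := t) (f := fun r => g (φ r x)) (C := B) fun r _ => hB _
    rw [add_sub_cancel_right] at b1
    rw [sub_zero] at b2
    refine (abs_sub _ _).trans ?_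
    rw [Real.norm_eq_abs] at b1 b2
    linarith
  have hsub : ∀ t x, x ∈ s → φ t x ∈ s := by
    intro t x hx C
    obtain ⟨D, hD⟩ := exists_nat_ge (C + 2 * |t| * B)
    refine (hx D).mono fun n hn => ?_
    have := abs_le.1 (hshift t x n)
    linarith [this.1]
  have hinv : ∀ t, φ t ⁻¹' s = s := by
    intro t
    ext x
    refine ⟨fun hx => ?_, hsub t x⟩
    have := hsub (-t) _ hx
    rwa [← hadd, neg_add_cancel, h0] at this
  rcases herg s hsm hinv with h | h
  · have : ∀ᵐ x ∂ρ, x ∉ s := measure_eq_zero_iff_ae_notMem.1 h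
    filter_upwards [this] with x hx
    simp only [hs, mem_ofPred_eq, not_forall, not_frequently, not_lt] at hx
    obtain ⟨C, hC⟩ := hx
    exact ⟨C, hC⟩
  · exfalso
    set f : K → ℝ := fun x => (∫ t in (0 : ℝ)..1, g (φ t x)) - a with hf
    have hfc : Continuous f := (continuous_flow_integral hφ hg 1).sub continuous_const
    obtain ⟨D, -, hD⟩ := exists_abs_bound hfc
    have h1 : ∀ᵐ x ∂ρ, ∃ n, 0 < birkhoffSum (φ 1) f n x := by
      have : ∀ᵐ x ∂ρ, x ∈ s := mem_ae_iff.2 h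
      filter_upwards [this] with x hx
      obtain ⟨n, hn⟩ := (hx 0).exists
      refine ⟨n, ?_⟩
      have e : birkhoffSum (φ 1) f n x = S n x - n * a := by
        simp only [hS]
        rw [← birkhoffSum_flow hφ hadd h0 hg]
        simp [birkhoffSum, hf, Finset.sum_sub_distrib]
      rw [e]
      push_cast at hn
      linarith
    have h2 := integral_nonneg_of_birkhoffSum_pos (hρ 1) hfc.measurable hD h1
    simp only [hf] at h2
    rw [integral_sub (integrable_of_continuous (continuous_flow_integral hφ hg 1))
      (integrable_const a), integral_flow_integral hφ hρ hg] at h2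
    simp at h2
    linarith

theorem ae_eventually_flow_average_le {g : K → ℝ} (hg : Continuous g) {a : ℝ}
    (ha : ∫ x, g x ∂ρ < a) :
    ∀ᵐ x ∂ρ, ∀ᶠ T : ℝ in atTop, T⁻¹ * ∫ t in (0 : ℝ)..T, g (φ t x) < a := by
  -- The gap between `b` and `a` absorbs, for large `T`, the additive constant `C` and the passage
  -- from integer to real times.
  obtain ⟨b, hb, hba⟩ := exists_between ha
  obtain ⟨B, hB0, hB⟩ := exists_abs_bound hg
  filter_upwards [ae_flow_integral_le hφ hadd h0 hρ herg hg hb] with x ⟨C, hC⟩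
  have hfl : ∀ᶠ T : ℝ in atTop,
      ∫ t in (0 : ℝ)..(⌊T⌋₊ : ℝ), g (φ t x) ≤ b * ⌊T⌋₊ + C :=
    tendsto_nat_floor_atTop.eventually hC
  have hlarge : ∀ᶠ T : ℝ in atTop, C + |b| + B < (a - b) * T :=
    (tendsto_id.const_mul_atTop (sub_pos.2 hba)).eventually_gt_atTop _
  filter_upwards [hfl, hlarge, eventually_gt_atTop 0] with T h1 h2 hT
  rw [inv_mul_lt_iff₀ hT]
  have e := intervalIntegral.integral_add_adjacent_intervals
    (intervalIntegrable_flow hφ hg x 0 (⌊T⌋₊ : ℝ)) (intervalIntegrable_flow hφ hg x (⌊T⌋₊ : ℝ) T)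
  have f1 : (⌊T⌋₊ : ℝ) ≤ T := Nat.floor_le hT.le
  have f2 : T < (⌊T⌋₊ : ℝ) + 1 := Nat.lt_floor_add_one T
  have b1 := intervalIntegral.norm_integral_le_of_norm_le_const
      (a := (⌊T⌋₊ : ℝ)) (b := T) (f := fun r => g (φ r x)) (C := B) fun r _ => hB _
  have b2 : B * |T - (⌊T⌋₊ : ℝ)| ≤ B := by
    rw [abs_of_nonneg (by linarith)]
    exact mul_le_of_le_one_right hB0 (by linarith)
  have b3 := (le_abs_self _).trans (b1.trans b2)
  have b4 : b * ⌊T⌋₊ ≤ b * T + |b| := by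
    have : -(b * (T - ⌊T⌋₊)) ≤ |b| := by
      refine (neg_le_abs _).trans ?_
      rw [abs_mul, abs_of_nonneg (by linarith : 0 ≤ T - (⌊T⌋₊ : ℝ))]
      exact mul_le_of_le_one_right (abs_nonneg _) (by linarith)
    linarith
  linarith

/-- Birkhoff's ergodic theorem for continuous functions and continuous flows on compact spaces. -/
theorem ae_tendsto_flow_average {g : K → ℝ} (hg : Continuous g) :
    ∀ᵐ x ∂ρ, Tendsto (fun T : ℝ => T⁻¹ * ∫ t in (0 : ℝ)..T, g (φ t x)) atTop
      (𝓝 (∫ x, g x ∂ρ)) := by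
  have h1 : ∀ᵐ x ∂ρ, ∀ k : ℕ, ∀ᶠ T : ℝ in atTop,
      T⁻¹ * ∫ t in (0 : ℝ)..T, g (φ t x) < (∫ x, g x ∂ρ) + 1 / ((k : ℝ) + 1) :=
    ae_all_iff.2 fun k => ae_eventually_flow_average_le hφ hadd h0 hρ herg hg
      (lt_add_of_pos_right _ (by positivity))
  -- The upper bound for `-g` is the lower bound for `g`.
  have h2 : ∀ᵐ x ∂ρ, ∀ k : ℕ, ∀ᶠ T : ℝ in atTop,
      T⁻¹ * ∫ t in (0 : ℝ)..T, -g (φ t x) < (∫ x, -g x ∂ρ) + 1 / ((k : ℝ) + 1) :=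
    ae_all_iff.2 fun k => ae_eventually_flow_average_le hφ hadd h0 hρ herg hg.neg
      (lt_add_of_pos_right _ (by positivity))
  filter_upwards [h1, h2] with x k1 k2
  rw [Metric.tendsto_nhds]
  intro ε hε
  obtain ⟨k, hk⟩ := exists_nat_one_div_lt hε
  filter_upwards [k1 k, k2 k] with T m1 m2
  rw [integral_neg, intervalIntegral.integral_neg] at m2
  rw [Real.dist_eq, abs_lt]
  constructor <;> linarith

end FlowAverages

/-! ### Global constants from local ones. -/

section Compactness

theorem exists_const_of_locally_le {X : Type*} [TopologicalSpace X] {s : Set X} (hs : IsCompact s)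
    {a b : X → ℝ} (hb : ∀ x, 0 ≤ b x)
    (h : ∀ p ∈ s, ∃ C, ∀ᶠ q in 𝓝[s] p, a q ≤ C * b q) :
    ∃ C, 0 ≤ C ∧ ∀ q ∈ s, a q ≤ C * b q := by
  refine hs.induction_on (p := fun s => ∃ C, 0 ≤ C ∧ ∀ q ∈ s, a q ≤ C * b q)
    ⟨0, le_rfl, fun q hq => hq.elim⟩ ?_ ?_ ?_
  · rintro s t hst ⟨C, hC, h⟩
    exact ⟨C, hC, fun q hq => h q (hst hq)⟩
  · rintro s t ⟨C, hC, h1⟩ ⟨D, hD, h2⟩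
    refine ⟨max C D, hC.trans (le_max_left _ _), ?_⟩
    rintro q (hq | hq)
    · exact (h1 q hq).trans (mul_le_mul_of_nonneg_right (le_max_left _ _) (hb q))
    · exact (h2 q hq).trans (mul_le_mul_of_nonneg_right (le_max_right _ _) (hb q))
  · intro x hx
    obtain ⟨C, hC⟩ := h x hx
    exact ⟨_, hC, max C 0, le_max_right _ _, fun q hq =>
      hq.trans (mul_le_mul_of_nonneg_right (le_max_left _ _) (hb q))⟩

end Compactness

/-! ### Hölder and Lipschitz estimates in charts. -/

section LocalHolder

variable {E : Type*} [NormedAddCommGroup E] [NormedSpace ℝ E]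
  {M : Type*} [TopologicalSpace M] [ChartedSpace E M]
  {G G₁ G₂ G₃ : Type*} [NormedAddCommGroup G] [NormedSpace ℝ G]
  [NormedAddCommGroup G₁] [NormedSpace ℝ G₁] [NormedAddCommGroup G₂] [NormedSpace ℝ G₂]
  [NormedAddCommGroup G₃] [NormedSpace ℝ G₃] {K : Set M}

/-- Hölder continuity with exponent `r` near `x₀` in the chart centred at `x₀`. -/
def HolderNear (E : Type*) [NormedAddCommGroup E] [NormedSpace ℝ E] [ChartedSpace E M] (r : ℝ)
    (x₀ : K) (u : K → G) : Prop :=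
  ∃ C : ℝ, ∀ᶠ p : K × K in 𝓝 (x₀, x₀), ‖u p.1 - u p.2‖ ≤
    C * ‖extChartAt 𝓘(ℝ, E) (x₀ : M) p.1 - extChartAt 𝓘(ℝ, E) (x₀ : M) p.2‖ ^ r

theorem HolderNear.mono {r s : ℝ} {x₀ : K} {u : K → G} (h : HolderNear E r x₀ u) (hs : 0 ≤ s)
    (hsr : s ≤ r) : HolderNear E s x₀ u := by
  obtain ⟨C, hC⟩ := h
  refine ⟨|C|, ?_⟩
  filter_upwards [hC, eventually_chart_le_one (E := E) x₀] with p hp h1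
  refine hp.trans (mul_le_mul (le_abs_self C)
    (Real.rpow_le_rpow_of_exponent_ge' (norm_nonneg _) h1 hs hsr)
    (Real.rpow_nonneg (norm_nonneg _) _) (abs_nonneg _))

theorem eventually_nhds_prod {x₀ : K} {P : K → Prop} (h : ∀ᶠ x in 𝓝 x₀, P x) :
    ∀ᶠ p : K × K in 𝓝 (x₀, x₀), P p.1 ∧ P p.2 :=
  (continuousAt_fst.eventually h).and (continuousAt_snd.eventually h)

theorem HolderNear.congr {r : ℝ} {x₀ : K} {u v : K → G} (h : HolderNear E r x₀ u)
    (huv : u =ᶠ[𝓝 x₀] v) : HolderNear E r x₀ v := by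
  obtain ⟨C, hC⟩ := h
  refine ⟨C, ?_⟩
  filter_upwards [hC, eventually_nhds_prod huv] with p hp h1
  rwa [← h1.1, ← h1.2]

theorem HolderNear.eventually_bound {r : ℝ} (hr : 0 ≤ r) {x₀ : K} {u : K → G}
    (h : HolderNear E r x₀ u) : ∃ B, 0 ≤ B ∧ ∀ᶠ x in 𝓝 x₀, ‖u x‖ ≤ B := by
  obtain ⟨C, hC⟩ := h
  refine ⟨‖u x₀‖ + |C|, by positivity, ?_⟩
  have hc : Tendsto (fun x : K => (x, x₀)) (𝓝 x₀) (𝓝 (x₀, x₀)) :=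
    (continuous_id.prodMk continuous_const).tendsto x₀
  filter_upwards [hc.eventually hC, hc.eventually (eventually_chart_le_one (E := E) x₀)]
    with x h1 h2
  have h3 : ‖u x - u x₀‖ ≤ |C| * 1 := h1.trans (mul_le_mul (le_abs_self C)
    (Real.rpow_le_one (norm_nonneg _) h2 hr) (Real.rpow_nonneg (norm_nonneg _) _) (abs_nonneg _))
  have := norm_le_norm_add_norm_sub' (u x) (u x₀)
  linarith

theorem HolderNear.bilin (L : G₁ →L[ℝ] G₂ →L[ℝ] G₃) {r : ℝ} (hr : 0 ≤ r) {x₀ : K} {u : K → G₁}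
    {v : K → G₂} (hu : HolderNear E r x₀ u) (hv : HolderNear E r x₀ v) :
    HolderNear E r x₀ (fun x => L (u x) (v x)) := by
  obtain ⟨B, hB, hu'⟩ := hu.eventually_bound hr
  obtain ⟨B', hB', hv'⟩ := hv.eventually_bound hr
  obtain ⟨C, hC⟩ := hu
  obtain ⟨D, hD⟩ := hv
  refine ⟨‖L‖ * |C| * B' + ‖L‖ * B * |D|, ?_⟩
  filter_upwards [hC, hD, eventually_nhds_prod hu', eventually_nhds_prod hv'] with p h1 h2 h3 h4
  set δ := ‖extChartAt 𝓘(ℝ, E) (x₀ : M) p.1 - extChartAt 𝓘(ℝ, E) (x₀ : M) p.2‖ ^ r with hδ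
  have hδ0 : 0 ≤ δ := Real.rpow_nonneg (norm_nonneg _) _
  have e : L (u p.1) (v p.1) - L (u p.2) (v p.2)
      = L (u p.1 - u p.2) (v p.1) + L (u p.2) (v p.1 - v p.2) := by
    simp only [map_sub, sub_apply]; abel
  rw [e]
  calc _ ≤ ‖L‖ * ‖u p.1 - u p.2‖ * ‖v p.1‖ + ‖L‖ * ‖u p.2‖ * ‖v p.1 - v p.2‖ :=
        (norm_add_le _ _).trans (add_le_add (L.le_opNorm₂ _ _) (L.le_opNorm₂ _ _))
    _ ≤ ‖L‖ * (|C| * δ) * B' + ‖L‖ * B * (|D| * δ) := by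
      gcongr
      · exact h1.trans (mul_le_mul_of_nonneg_right (le_abs_self C) hδ0)
      · exact h4.1
      · exact h3.2
      · exact h2.trans (mul_le_mul_of_nonneg_right (le_abs_self D) hδ0)
    _ = _ := by ring

variable [IsManifold 𝓘(ℝ, E) ∞ M]

theorem contMDiffAt_comp_chart_symm {u : ℝ × M → G} {t₀ : ℝ} {x₀ : M}
    (hu : ContMDiffAt (𝓘(ℝ, ℝ).prod 𝓘(ℝ, E)) 𝓘(ℝ, G) 1 u (t₀, x₀)) :
    ContDiffAt ℝ 1 (fun p : ℝ × E => u (p.1, (extChartAt 𝓘(ℝ, E) x₀).symm p.2))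
      (t₀, extChartAt 𝓘(ℝ, E) x₀ x₀) := by
  have h1 : ContMDiffAt 𝓘(ℝ, E) 𝓘(ℝ, E) 1 (extChartAt 𝓘(ℝ, E) x₀).symm
      (extChartAt 𝓘(ℝ, E) x₀ x₀) :=
    ((contMDiffOn_extChartAt_symm (n := 1) x₀).contMDiffAt
      ((isOpen_extChartAt_target x₀).mem_nhds (mem_extChartAt_target x₀)))
  have h2 : ContMDiffAt 𝓘(ℝ, ℝ × E) 𝓘(ℝ, ℝ) 1 (fun p : ℝ × E => p.1)
      (t₀, extChartAt 𝓘(ℝ, E) x₀ x₀) := contDiffAt_fst.contMDiffAt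
  have h3 : ContMDiffAt 𝓘(ℝ, ℝ × E) 𝓘(ℝ, E) 1 (fun p : ℝ × E => p.2)
      (t₀, extChartAt 𝓘(ℝ, E) x₀ x₀) := contDiffAt_snd.contMDiffAt
  have h4 : ContMDiffAt 𝓘(ℝ, ℝ × E) (𝓘(ℝ, ℝ).prod 𝓘(ℝ, E)) 1
      (fun p : ℝ × E => (p.1, (extChartAt 𝓘(ℝ, E) x₀).symm p.2))
      (t₀, extChartAt 𝓘(ℝ, E) x₀ x₀) := h2.prodMk
        (ContMDiffAt.comp (I' := 𝓘(ℝ, E)) (f := fun p : ℝ × E => p.2) (t₀, extChartAt 𝓘(ℝ, E) x₀ x₀)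
          h1 h3)
  have h5 : ContMDiffAt 𝓘(ℝ, ℝ × E) 𝓘(ℝ, G) 1
      (fun p : ℝ × E => u (p.1, (extChartAt 𝓘(ℝ, E) x₀).symm p.2))
      (t₀, extChartAt 𝓘(ℝ, E) x₀ x₀) := by
    refine ContMDiffAt.comp (I' := 𝓘(ℝ, ℝ).prod 𝓘(ℝ, E)) _ ?_ h4
    simpa using hu
  exact h5.contDiffAt

/-- A `C¹` function of time and position is locally Lipschitz in position, uniformly in time. -/
theorem eventually_norm_sub_le_of_contMDiffAt {u : ℝ × M → G} {t₀ : ℝ} {x₀ : M}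
    (hu : ContMDiffAt (𝓘(ℝ, ℝ).prod 𝓘(ℝ, E)) 𝓘(ℝ, G) 1 u (t₀, x₀)) :
    ∃ C : ℝ, 0 ≤ C ∧ ∀ᶠ q : ℝ × M × M in 𝓝 (t₀, x₀, x₀), ‖u (q.1, q.2.1) - u (q.1, q.2.2)‖ ≤
      C * ‖extChartAt 𝓘(ℝ, E) x₀ q.2.1 - extChartAt 𝓘(ℝ, E) x₀ q.2.2‖ := by
  obtain ⟨C, s, hs, hC⟩ := (contMDiffAt_comp_chart_symm hu).exists_lipschitzOnWith
  refine ⟨C, C.2, ?_⟩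
  have hchart : ContinuousAt (extChartAt 𝓘(ℝ, E) x₀) x₀ := continuousAt_extChartAt x₀
  have t1 : Tendsto (fun q : ℝ × M × M => (q.1, extChartAt 𝓘(ℝ, E) x₀ q.2.1)) (𝓝 (t₀, x₀, x₀))
      (𝓝 (t₀, extChartAt 𝓘(ℝ, E) x₀ x₀)) :=
    continuousAt_fst.tendsto.prodMk_nhds
      (hchart.tendsto.comp (continuousAt_fst.comp continuousAt_snd : ContinuousAt
        (Prod.fst ∘ fun q : ℝ × M × M => q.2) (t₀, x₀, x₀)).tendsto)
  have t2 : Tendsto (fun q : ℝ × M × M => (q.1, extChartAt 𝓘(ℝ, E) x₀ q.2.2)) (𝓝 (t₀, x₀, x₀))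
      (𝓝 (t₀, extChartAt 𝓘(ℝ, E) x₀ x₀)) :=
    continuousAt_fst.tendsto.prodMk_nhds
      (hchart.tendsto.comp (continuousAt_snd.comp continuousAt_snd : ContinuousAt
        (Prod.snd ∘ fun q : ℝ × M × M => q.2) (t₀, x₀, x₀)).tendsto)
  have s1 : ∀ᶠ q : ℝ × M × M in 𝓝 (t₀, x₀, x₀), q.2.1 ∈ (extChartAt 𝓘(ℝ, E) x₀).source :=
    ((continuousAt_fst.comp continuousAt_snd : ContinuousAt
        (Prod.fst ∘ fun q : ℝ × M × M => q.2) (t₀, x₀, x₀)).tendsto).eventually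
      (extChartAt_source_mem_nhds x₀)
  have s2 : ∀ᶠ q : ℝ × M × M in 𝓝 (t₀, x₀, x₀), q.2.2 ∈ (extChartAt 𝓘(ℝ, E) x₀).source :=
    ((continuousAt_snd.comp continuousAt_snd : ContinuousAt
        (Prod.snd ∘ fun q : ℝ × M × M => q.2) (t₀, x₀, x₀)).tendsto).eventually
      (extChartAt_source_mem_nhds x₀)
  filter_upwards [t1.eventually hs, t2.eventually hs, s1, s2] with q h1 h2 h3 h4
  have := hC.norm_sub_le h1 h2
  simp only [PartialEquiv.left_inv _ h3, PartialEquiv.left_inv _ h4] at this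
  refine this.trans (mul_le_mul_of_nonneg_left ?_ C.2)
  simp [Prod.norm_def]

theorem HolderNear.of_contMDiffAt {u : M → G} {x₀ : K}
    (hu : ContMDiffAt 𝓘(ℝ, E) 𝓘(ℝ, G) 1 u x₀) : HolderNear E 1 x₀ (fun x => u x) := by
  obtain ⟨C, -, h⟩ := eventually_norm_sub_le_of_contMDiffAt (E := E) (u := fun p : ℝ × M => u p.2)
    (t₀ := 0) (x₀ := x₀) (hu.comp (0, (x₀ : M)) contMDiffAt_snd)
  refine ⟨C, ?_⟩
  have ht : Tendsto (fun p : K × K => ((0 : ℝ), (p.1 : M), (p.2 : M))) (𝓝 (x₀, x₀))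
      (𝓝 (0, (x₀ : M), (x₀ : M))) := by
    have : Continuous (fun p : K × K => ((0 : ℝ), (p.1 : M), (p.2 : M))) := by fun_prop
    exact this.tendsto (x₀, x₀)
  filter_upwards [ht.eventually h] with p hp
  rwa [Real.rpow_one]

end LocalHolder

/-! ### Embedding `K` in a normed space and its tangent spaces in a trivial bundle. -/

/-- A finite family of bump functions on `M` such that near each point of `K` one of them is
equal to `1`. -/
structure BumpCover (E : Type*) {M : Type*} [NormedAddCommGroup E] [NormedSpace ℝ E]
    [FiniteDimensional ℝ E] [TopologicalSpace M] [ChartedSpace E M] (K : Set M) where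
  n : ℕ
  center : Fin n → M
  bump : ∀ i, SmoothBumpFunction 𝓘(ℝ, E) (center i)
  cover : ∀ x ∈ K, ∃ i, (bump i : M → ℝ) =ᶠ[𝓝 x] 1

namespace BumpCover

variable {E : Type*} [NormedAddCommGroup E] [NormedSpace ℝ E] [FiniteDimensional ℝ E]
  {M : Type*} [TopologicalSpace M] [ChartedSpace E M] {K : Set M}
  {G : Type*} [NormedAddCommGroup G] [NormedSpace ℝ G]

theorem nonempty_of_isCompact (hK : IsCompact K) : Nonempty (BumpCover E K) := by
  classical
  let b : ∀ x : M, SmoothBumpFunction 𝓘(ℝ, E) x := fun x => Classical.arbitrary _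
  obtain ⟨t, -, ht⟩ := hK.elim_nhds_subcover (fun x => {y | b x =ᶠ[𝓝 y] 1}) fun x _ =>
    (b x).eventuallyEq_one.eventually_nhds
  refine ⟨⟨t.card, fun i => (t.equivFin.symm i : M), fun i => b _, fun x hx => ?_⟩⟩
  obtain ⟨y, hy, hxy⟩ := mem_iUnion₂.1 (ht hx)
  refine ⟨t.equivFin ⟨y, hy⟩, ?_⟩
  have : ∀ z : t, z = ⟨y, hy⟩ → (b z : M → ℝ) =ᶠ[𝓝 x] 1 := by
    rintro z rfl
    exact hxy
  exact this _ (t.equivFin.symm_apply_apply _)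

variable (b : BumpCover E K)

/-- The product of the charts, cut off by the bump functions, and of the bump functions. -/
def emb (x : M) : Fin b.n → E × ℝ :=
  fun i => (b.bump i x • extChartAt 𝓘(ℝ, E) (b.center i) x, b.bump i x)

theorem source_of_ne_zero {i : Fin b.n} {x : M} (h : b.bump i x ≠ 0) :
    x ∈ (chartAt E (b.center i)).source :=
  (b.bump i).support_subset_source h

/-- The bump coordinate serves here: if a bump equals `1` at `x` and the images agree, it equals `1`
at `y` too. Both points then lie in that chart, with equal coordinates. -/
theorem emb_injOn : InjOn b.emb K := by
  intro x hx y _ hxy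
  obtain ⟨i, hi⟩ := b.cover x hx
  have hi1 : b.bump i x = 1 := hi.self_of_nhds
  have h := congrFun hxy i
  simp only [emb, Prod.mk.injEq, hi1, one_smul] at h
  have hy1 : 1 = b.bump i y := h.2
  rw [← hy1, one_smul] at h
  have hxs : x ∈ (extChartAt 𝓘(ℝ, E) (b.center i)).source := by
    rw [extChartAt_source]; exact b.source_of_ne_zero (by simp [hi1])
  have hys : y ∈ (extChartAt 𝓘(ℝ, E) (b.center i)).source := by
    rw [extChartAt_source]; exact b.source_of_ne_zero (by rw [← hy1]; exact one_ne_zero)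
  exact (extChartAt 𝓘(ℝ, E) (b.center i)).injOn hxs hys h.1

theorem one_le_sum_sq {x : M} (hx : x ∈ K) : 1 ≤ ∑ i, b.bump i x ^ 2 := by
  obtain ⟨i, hi⟩ := b.cover x hx
  have hi1 : b.bump i x = 1 := hi.self_of_nhds
  calc (1 : ℝ) = b.bump i x ^ 2 := by simp [hi1]
    _ ≤ _ := Finset.single_le_sum (f := fun i => b.bump i x ^ 2) (fun i _ => sq_nonneg _)
      (Finset.mem_univ i)

variable [IsManifold 𝓘(ℝ, E) ∞ M]

/-- The inclusion of the tangent bundle into a trivial bundle. -/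
def J (x : M) : TangentSpace 𝓘(ℝ, E) x →L[ℝ] (Fin b.n → E) :=
  ∑ i, (ContinuousLinearMap.single ℝ (fun _ : Fin b.n => E) i).comp
    (b.bump i x •
      (trivializationAt E (TangentSpace 𝓘(ℝ, E)) (b.center i)).continuousLinearMapAt ℝ x)

/-- A left inverse of `J` over `K`. -/
def R (x : M) : (Fin b.n → E) →L[ℝ] TangentSpace 𝓘(ℝ, E) x :=
  (∑ i, b.bump i x ^ 2)⁻¹ • ∑ i,
    (b.bump i x • (trivializationAt E (TangentSpace 𝓘(ℝ, E)) (b.center i)).symmL ℝ x).comp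
      (ContinuousLinearMap.proj (R := ℝ) (φ := fun _ : Fin b.n => E) i)

theorem J_apply (x : M) (v : TangentSpace 𝓘(ℝ, E) x) (i : Fin b.n) : b.J x v i = b.bump i x •
    (trivializationAt E (TangentSpace 𝓘(ℝ, E)) (b.center i)).continuousLinearMapAt ℝ x v := by
  simp only [J, sum_apply, Finset.sum_apply, ContinuousLinearMap.comp_apply,
    ContinuousLinearMap.single_apply]
  rw [Finset.sum_eq_single i]
  · simp
  · intro j _ hj
    simp [hj.symm]
  · simp

theorem R_apply (x : M) (w : Fin b.n → E) : b.R x w = (∑ i, b.bump i x ^ 2)⁻¹ • ∑ i,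
    b.bump i x • (trivializationAt E (TangentSpace 𝓘(ℝ, E)) (b.center i)).symmL ℝ x (w i) := by
  simp [R]

theorem mem_baseSet {i : Fin b.n} {x : M} (h : b.bump i x ≠ 0) :
    x ∈ (trivializationAt E (TangentSpace 𝓘(ℝ, E)) (b.center i)).baseSet := by
  simpa using b.source_of_ne_zero h

/-- Each bump occurs once in `J` and once in `R`, so `v` returns with total weight `∑ bump²`, which
the normalisation divides out; over `K` this sum is at least `1`. -/
theorem R_J {x : M} (hx : x ∈ K) (v : TangentSpace 𝓘(ℝ, E) x) : b.R x (b.J x v) = v := by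
  have h : ∀ i, b.bump i x • (trivializationAt E (TangentSpace 𝓘(ℝ, E)) (b.center i)).symmL ℝ x
      (b.J x v i) = (b.bump i x ^ 2) • v := fun i => by
    by_cases h : b.bump i x = 0
    · simp [h]
    · rw [J_apply, map_smul, Trivialization.symmL_continuousLinearMapAt _ (b.mem_baseSet h),
        smul_smul, sq]
  rw [R_apply]
  simp only [h]
  rw [← Finset.sum_smul, smul_smul,
    inv_mul_cancel₀ (by linarith [b.one_le_sum_sq hx]), one_smul]

variable [T2Space M]

theorem contMDiff_emb : ContMDiff 𝓘(ℝ, E) 𝓘(ℝ, Fin b.n → E × ℝ) ∞ b.emb := by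
  rw [contMDiff_pi_space]
  intro i
  exact ((b.bump i).contMDiff_smul contMDiffOn_extChartAt).prodMk_space (b.bump i).contMDiff

theorem continuous_emb : Continuous b.emb := b.contMDiff_emb.continuous

theorem eventually_bump_eq_zero {i : Fin b.n} {x : M}
    (h : x ∉ (trivializationAt E (TangentSpace 𝓘(ℝ, E)) (b.center i)).baseSet) :
    ∀ᶠ y in 𝓝 x, b.bump i y = 0 := by
  have : x ∉ tsupport (b.bump i) := fun hx => h (by
    simpa using (b.bump i).tsupport_subset_chartAt_source hx)
  exact (notMem_tsupport_iff_eventuallyEq.1 this)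

theorem eventually_mem_baseSet (x : M) :
    ∀ᶠ y in 𝓝 x, y ∈ (trivializationAt E (TangentSpace 𝓘(ℝ, E)) x).baseSet :=
  (trivializationAt E (TangentSpace 𝓘(ℝ, E)) x).open_baseSet.mem_nhds
    (FiberBundle.mem_baseSet_trivializationAt' x)

theorem contMDiffAt_coord_change {x c : M}
    (h : x ∈ (trivializationAt E (TangentSpace 𝓘(ℝ, E)) c).baseSet) :
    ContMDiffAt 𝓘(ℝ, E) 𝓘(ℝ, E →L[ℝ] E) ∞ (fun y =>
      ((trivializationAt E (TangentSpace 𝓘(ℝ, E)) c).continuousLinearMapAt ℝ y).comp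
        ((trivializationAt E (TangentSpace 𝓘(ℝ, E)) x).symmL ℝ y)) x ∧
    ContMDiffAt 𝓘(ℝ, E) 𝓘(ℝ, E →L[ℝ] E) ∞ (fun y =>
      ((trivializationAt E (TangentSpace 𝓘(ℝ, E)) x).continuousLinearMapAt ℝ y).comp
        ((trivializationAt E (TangentSpace 𝓘(ℝ, E)) c).symmL ℝ y)) x := by
  have hx : x ∈ (trivializationAt E (TangentSpace 𝓘(ℝ, E)) x).baseSet :=
    FiberBundle.mem_baseSet_trivializationAt' x
  have h1 : ∀ᶠ y in 𝓝 x, y ∈ (trivializationAt E (TangentSpace 𝓘(ℝ, E)) c).baseSet :=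
    (trivializationAt E (TangentSpace 𝓘(ℝ, E)) c).open_baseSet.mem_nhds h
  constructor
  · refine (contMDiffAt_coordChangeL (IB := 𝓘(ℝ, E)) (n := ∞) hx h).congr_of_eventuallyEq ?_
    filter_upwards [eventually_mem_baseSet (E := E) x, h1] with y hy hy1
    ext v
    simp [Trivialization.coordChangeL_apply _ _ ⟨hy, hy1⟩, Trivialization.symmL_apply _ hy,
      Trivialization.coe_linearMapAt_of_mem _ hy1]
  · refine (contMDiffAt_coordChangeL (IB := 𝓘(ℝ, E)) (n := ∞) h hx).congr_of_eventuallyEq ?_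
    filter_upwards [eventually_mem_baseSet (E := E) x, h1] with y hy hy1
    ext v
    simp [Trivialization.coordChangeL_apply _ _ ⟨hy1, hy⟩, Trivialization.symmL_apply _ hy1,
      Trivialization.coe_linearMapAt_of_mem _ hy]

/-- Away from the chart domain the bump vanishes on a neighbourhood, so smoothness of `g` matters
only inside it. -/
theorem contMDiffAt_bump_smul {i : Fin b.n} {x : M} {g : M → G}
    (hg : x ∈ (trivializationAt E (TangentSpace 𝓘(ℝ, E)) (b.center i)).baseSet →
      ContMDiffAt 𝓘(ℝ, E) 𝓘(ℝ, G) ∞ g x) :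
    ContMDiffAt 𝓘(ℝ, E) 𝓘(ℝ, G) ∞ (fun y => b.bump i y • g y) x := by
  by_cases h : x ∈ (trivializationAt E (TangentSpace 𝓘(ℝ, E)) (b.center i)).baseSet
  · exact (b.bump i).contMDiffAt.smul (hg h)
  · refine (contMDiffAt_const (c := (0 : G))).congr_of_eventuallyEq ?_
    filter_upwards [b.eventually_bump_eq_zero h] with y hy
    rw [hy, zero_smul]

/-- `J` is smooth. -/
theorem contMDiffAt_J (x : M) : ContMDiffAt 𝓘(ℝ, E) 𝓘(ℝ, E →L[ℝ] (Fin b.n → E)) ∞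
    (fun y => (b.J y).comp ((trivializationAt E (TangentSpace 𝓘(ℝ, E)) x).symmL ℝ y)) x := by
  have e : ∀ y, (b.J y).comp ((trivializationAt E (TangentSpace 𝓘(ℝ, E)) x).symmL ℝ y)
      = ∑ i, (ContinuousLinearMap.single ℝ (fun _ : Fin b.n => E) i).comp (b.bump i y •
        ((trivializationAt E (TangentSpace 𝓘(ℝ, E)) (b.center i)).continuousLinearMapAt ℝ y).comp
        ((trivializationAt E (TangentSpace 𝓘(ℝ, E)) x).symmL ℝ y)) := fun y => by
    ext v
    simp [J]
  simp only [e]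
  refine contMDiffAt_finsetSum fun i _ => ?_
  exact contMDiffAt_const.clm_comp
    (b.contMDiffAt_bump_smul fun h => (contMDiffAt_coord_change h).1)

/-- `R` is smooth near `K`. -/
theorem contMDiffAt_R {x : M} (hx : x ∈ K) :
    ContMDiffAt 𝓘(ℝ, E) 𝓘(ℝ, (Fin b.n → E) →L[ℝ] E) ∞
    (fun y => ((trivializationAt E (TangentSpace 𝓘(ℝ, E)) x).continuousLinearMapAt ℝ y).comp
      (b.R y)) x := by
  have e : ∀ y, ((trivializationAt E (TangentSpace 𝓘(ℝ, E)) x).continuousLinearMapAt ℝ y).comp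
      (b.R y) = (∑ i, b.bump i y ^ 2)⁻¹ • ∑ i, (b.bump i y •
        ((trivializationAt E (TangentSpace 𝓘(ℝ, E)) x).continuousLinearMapAt ℝ y).comp
        ((trivializationAt E (TangentSpace 𝓘(ℝ, E)) (b.center i)).symmL ℝ y)).comp
      (ContinuousLinearMap.proj (R := ℝ) (φ := fun _ : Fin b.n => E) i) := fun y => by
    ext v
    simp [R_apply]
  simp only [e]
  have hsum : ContMDiffAt 𝓘(ℝ, E) 𝓘(ℝ, ℝ) ∞ (fun y => ∑ i, b.bump i y ^ 2) x :=
    contMDiffAt_finsetSum fun i _ => (b.bump i).contMDiffAt.pow 2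
  have hne : ∑ i, b.bump i x ^ 2 ≠ 0 := by linarith [b.one_le_sum_sq hx]
  refine ContMDiffAt.smul (hsum.inv₀ hne) ?_
  refine contMDiffAt_finsetSum fun i _ => ?_
  exact (b.contMDiffAt_bump_smul fun h => (contMDiffAt_coord_change h).2).clm_comp
    contMDiffAt_const

/-- The chart distance is locally bounded by the distance pulled back by `emb`. -/
theorem eventually_chart_le {x₀ : M} (hx : x₀ ∈ K) : ∃ C : ℝ, 0 ≤ C ∧
    ∀ᶠ p : M × M in 𝓝 (x₀, x₀), ‖extChartAt 𝓘(ℝ, E) x₀ p.1 - extChartAt 𝓘(ℝ, E) x₀ p.2‖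
      ≤ C * ‖b.emb p.1 - b.emb p.2‖ := by
  obtain ⟨i, hi⟩ := b.cover x₀ hx
  have hi1 : b.bump i x₀ = 1 := hi.self_of_nhds
  have hs : x₀ ∈ (chartAt E (b.center i)).source := b.source_of_ne_zero (by simp [hi1])
  have hs' : x₀ ∈ (extChartAt 𝓘(ℝ, E) (b.center i)).source := by rwa [extChartAt_source]
  set c := extChartAt 𝓘(ℝ, E) (b.center i) with hc
  have h1 : ContMDiffAt 𝓘(ℝ, E) 𝓘(ℝ, E) 1 c.symm (c x₀) :=
    (contMDiffOn_extChartAt_symm (n := 1) (b.center i)).contMDiffAt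
      ((isOpen_extChartAt_target (b.center i)).mem_nhds (c.map_source hs'))
  have h2 : ContMDiffAt 𝓘(ℝ, E) 𝓘(ℝ, E) 1 (extChartAt 𝓘(ℝ, E) x₀) (c.symm (c x₀)) := by
    rw [c.left_inv hs']
    exact contMDiffAt_extChartAt
  -- The transition from chart `i` to the chart at `x₀` is locally Lipschitz, and chart `i` is a
  -- component of `emb` where its bump equals `1`.
  have h3 : ContDiffAt ℝ 1 (extChartAt 𝓘(ℝ, E) x₀ ∘ c.symm) (c x₀) := (h2.comp _ h1).contDiffAt
  obtain ⟨C, s, hsn, hC⟩ := h3.exists_lipschitzOnWith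
  have hcc : ContinuousAt c x₀ := continuousAt_extChartAt' hs'
  have hsrc : ∀ᶠ x in 𝓝 x₀, x ∈ c.source := extChartAt_source_mem_nhds' hs'
  have e1 : ∀ᶠ x in 𝓝 x₀, c x ∈ s ∧ x ∈ c.source ∧ b.bump i x = 1 :=
    (hcc.eventually hsn).and (hsrc.and hi)
  refine ⟨C, C.2, ?_⟩
  have a1 : ContinuousAt (Prod.fst : M × M → M) (x₀, x₀) := continuousAt_fst
  have a2 : ContinuousAt (Prod.snd : M × M → M) (x₀, x₀) := continuousAt_snd
  filter_upwards [a1.eventually e1, a2.eventually e1] with p p1 p2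
  have := hC.norm_sub_le p1.1 p2.1
  simp only [Function.comp_apply, c.left_inv p1.2.1, c.left_inv p2.2.1] at this
  refine this.trans (mul_le_mul_of_nonneg_left ?_ C.2)
  have h5 : c p.1 - c p.2 = ((b.emb p.1 - b.emb p.2) i).1 := by
    simp [emb, p1.2.2, p2.2.2, hc]
  rw [h5]
  exact (norm_fst_le _).trans (norm_le_pi_norm (b.emb p.1 - b.emb p.2) i)

/-- The map `emb` restricted to `K`. -/
def ι (x : K) : Fin b.n → E × ℝ := b.emb x

theorem continuous_ι : Continuous b.ι := b.continuous_emb.comp continuous_subtype_val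

theorem ι_injective : Function.Injective b.ι := fun x y h =>
  Subtype.ext (b.emb_injOn x.2 y.2 h)

/-- A family of functions which is `C¹` at every point of `[-1, 1] × K` is uniformly bounded and
uniformly Lipschitz on `K`. -/
theorem exists_lipschitz (hK : IsCompact K) {u : ℝ × M → G}
    (hu : ∀ t, ∀ x ∈ K, ContMDiffAt (𝓘(ℝ, ℝ).prod 𝓘(ℝ, E)) 𝓘(ℝ, G) 1 u (t, x)) :
    ∃ C : ℝ, 0 ≤ C ∧ (∀ t, |t| ≤ 1 → ∀ x : K, ‖u (t, x)‖ ≤ C) ∧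
      ∀ t, |t| ≤ 1 → ∀ x y : K, ‖u (t, x) - u (t, y)‖ ≤ C * ‖b.ι x - b.ι y‖ := by
  have hcomp : IsCompact (Icc (-1 : ℝ) 1 ×ˢ K) := isCompact_Icc.prod hK
  obtain ⟨B, hB⟩ := hcomp.exists_bound_of_continuousOn (f := u)
    fun p hp => (hu p.1 p.2 hp.2).continuousAt.continuousWithinAt
  obtain ⟨C, hC, h⟩ := exists_const_of_locally_le (s := Icc (-1 : ℝ) 1 ×ˢ (K ×ˢ K))
    (isCompact_Icc.prod (hK.prod hK)) (a := fun q => ‖u (q.1, q.2.1) - u (q.1, q.2.2)‖)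
    (b := fun q => ‖b.emb q.2.1 - b.emb q.2.2‖) (fun _ => norm_nonneg _) (by
      rintro ⟨t, x, y⟩ ⟨ht, hx, hy⟩
      by_cases hxy : x = y
      · subst hxy
        obtain ⟨C, hC, h⟩ := eventually_norm_sub_le_of_contMDiffAt (hu t x hx)
        obtain ⟨D, hD, h'⟩ := b.eventually_chart_le hx
        refine ⟨C * D, ?_⟩
        have h3 : ContinuousAt (Prod.snd : ℝ × M × M → M × M) (t, x, x) := continuousAt_snd
        have h'' := h3.eventually h'
        filter_upwards [mem_nhdsWithin_of_mem_nhds h, mem_nhdsWithin_of_mem_nhds h''] with q h1 h2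
        rw [mul_assoc]
        exact h1.trans (mul_le_mul_of_nonneg_left h2 hC)
      -- Off the diagonal the distance is locally bounded below, so boundedness of `u` suffices.
      · have hne : 0 < ‖b.emb x - b.emb y‖ :=
          norm_pos_iff.2 (sub_ne_zero.2 fun h => hxy (b.emb_injOn hx hy h))
        have hcont : Continuous fun q : ℝ × M × M => ‖b.emb q.2.1 - b.emb q.2.2‖ :=
          ((b.continuous_emb.comp (continuous_fst.comp continuous_snd)).sub
            (b.continuous_emb.comp (continuous_snd.comp continuous_snd))).norm
        have hev : ∀ᶠ q : ℝ × M × M in 𝓝 (t, x, y),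
            ‖b.emb x - b.emb y‖ / 2 < ‖b.emb q.2.1 - b.emb q.2.2‖ :=
          (hcont.tendsto (t, x, y)).eventually_const_lt (half_lt_self hne)
        refine ⟨2 * |B| / (‖b.emb x - b.emb y‖ / 2), ?_⟩
        filter_upwards [mem_nhdsWithin_of_mem_nhds hev, self_mem_nhdsWithin] with q h1 h2
        rw [div_mul_eq_mul_div, le_div_iff₀ (half_pos hne)]
        have n1 := hB (q.1, q.2.1) ⟨h2.1, h2.2.1⟩
        have n2 := hB (q.1, q.2.2) ⟨h2.1, h2.2.2⟩
        have n3 : ‖u (q.1, q.2.1) - u (q.1, q.2.2)‖ ≤ 2 * |B| :=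
          (norm_sub_le _ _).trans (by linarith [le_abs_self B])
        exact mul_le_mul n3 h1.le (by linarith) (by positivity))
  refine ⟨C + |B|, by positivity, fun t ht x => ?_, fun t ht x y => ?_⟩
  · exact (hB (t, x) ⟨abs_le.1 ht, x.2⟩).trans (by linarith [le_abs_self B])
  · refine (h (t, x, y) ⟨abs_le.1 ht, x.2, y.2⟩).trans ?_
    exact mul_le_mul_of_nonneg_right (by linarith [abs_nonneg B]) (norm_nonneg _)

theorem bddHolder_of_contMDiffAt (hK : IsCompact K) {u : M → G}
    (hu : ∀ x ∈ K, ContMDiffAt 𝓘(ℝ, E) 𝓘(ℝ, G) 1 u x) : BddHolder b.ι (fun x : K => u x) := by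
  obtain ⟨C, hC, h1, h2⟩ := b.exists_lipschitz hK (u := fun p => u p.2)
    fun t x hx => (hu x hx).comp (t, x) contMDiffAt_snd
  exact BddHolder.of_le one_pos (h1 0 (by simp)) (by simpa using h2 0 (by simp))

/-- Near the diagonal, chart distances and the distance pulled back by `ι` bound each other up to
constants. Away from it a bound on `g` is enough, and compactness makes the constants uniform. -/
theorem isHolder_iff (hK : IsCompact K) {g : K → G} :
    IsHolder (E := E) (fun _ x => g x) ↔ BddHolder b.ι g := by
  have : CompactSpace K := isCompact_iff_compactSpace.1 hK
  constructor
  · rintro ⟨r, hr, h⟩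
    have hloc : ∀ x₀ : K, HolderNear E r x₀ g := h
    obtain ⟨B, hB0, hB⟩ := exists_const_of_locally_le (X := K) (s := univ) isCompact_univ
      (a := fun x => ‖g x‖) (b := fun _ => 1) (fun _ => zero_le_one) fun x _ => by
        obtain ⟨B, -, hB⟩ := (hloc x).eventually_bound hr.le
        refine ⟨B, ?_⟩
        rw [nhdsWithin_univ]
        simpa using hB
    have hB' : ∀ x, ‖g x‖ ≤ B := fun x => by simpa using hB x (mem_univ x)
    obtain ⟨C, hC, hCb⟩ := exists_const_of_locally_le (X := K × K) (s := univ) isCompact_univ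
      (a := fun p => ‖g p.1 - g p.2‖) (b := fun p => ‖b.ι p.1 - b.ι p.2‖ ^ r)
      (fun _ => Real.rpow_nonneg (norm_nonneg _) _) (by
      rintro ⟨x, y⟩ -
      rw [nhdsWithin_univ]
      by_cases hxy : x = y
      · subst hxy
        obtain ⟨C, h⟩ := hloc x
        obtain ⟨D, hD, h'⟩ := b.eventually_chart_le x.2
        have ht : ContinuousAt (fun p : K × K => ((p.1 : M), (p.2 : M))) (x, x) :=
          Continuous.continuousAt (by fun_prop)
        refine ⟨|C| * D ^ r, ?_⟩
        filter_upwards [h, ht.eventually h'] with p h1 h2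
        calc _ ≤ C * _ := h1
          _ ≤ |C| * (D * ‖b.ι p.1 - b.ι p.2‖) ^ r :=
            mul_le_mul (le_abs_self C) (Real.rpow_le_rpow (norm_nonneg _) h2 hr.le)
              (Real.rpow_nonneg (norm_nonneg _) _) (abs_nonneg _)
          _ = _ := by rw [Real.mul_rpow hD (norm_nonneg _), mul_assoc]
      · have hne : 0 < ‖b.ι x - b.ι y‖ :=
          norm_pos_iff.2 (sub_ne_zero.2 fun h => hxy (b.ι_injective h))
        have hne' : 0 < ‖b.ι x - b.ι y‖ ^ r := Real.rpow_pos_of_pos hne _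
        have hcont : Continuous fun q : K × K => ‖b.ι q.1 - b.ι q.2‖ ^ r :=
          ((b.continuous_ι.comp continuous_fst).sub
            (b.continuous_ι.comp continuous_snd)).norm.rpow_const fun _ => Or.inr hr.le
        have hev : ∀ᶠ q : K × K in 𝓝 (x, y),
            ‖b.ι x - b.ι y‖ ^ r / 2 < ‖b.ι q.1 - b.ι q.2‖ ^ r :=
          (hcont.tendsto (x, y)).eventually_const_lt (half_lt_self hne')
        refine ⟨2 * B / (‖b.ι x - b.ι y‖ ^ r / 2), ?_⟩
        filter_upwards [hev] with q h1
        rw [div_mul_eq_mul_div, le_div_iff₀ (half_pos hne')]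
        have n3 : ‖g q.1 - g q.2‖ ≤ 2 * B :=
          (norm_sub_le _ _).trans (by linarith [hB' q.1, hB' q.2])
        exact mul_le_mul n3 h1.le (by linarith) (by positivity))
    refine BddHolder.of_le (C := B + C) hr (fun x => ?_) fun x y => ?_
    · linarith [hB' x]
    · refine (hCb (x, y) (mem_univ _)).trans (mul_le_mul_of_nonneg_right (by linarith)
        (Real.rpow_nonneg (norm_nonneg _) _))
  · intro h
    obtain ⟨C, r, hC, hr, -, -, h2⟩ := h.exists_bound
    refine ⟨r, hr, fun x₀ => ?_⟩
    obtain ⟨D, h3⟩ := HolderNear.of_contMDiffAt (x₀ := x₀)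
      ((b.contMDiff_emb.contMDiffAt (x := (x₀ : M))).of_le (by simp))
    refine ⟨C * |D| ^ r, ?_⟩
    filter_upwards [h3] with p hp
    rw [Real.rpow_one] at hp
    have hp' : ‖b.ι p.1 - b.ι p.2‖ ≤ |D| * ‖extChartAt 𝓘(ℝ, E) (x₀ : M) p.1
        - extChartAt 𝓘(ℝ, E) (x₀ : M) p.2‖ :=
      hp.trans (mul_le_mul_of_nonneg_right (le_abs_self D) (norm_nonneg _))
    calc ‖g p.1 - g p.2‖ ≤ C * ‖b.ι p.1 - b.ι p.2‖ ^ r := h2 _ _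
      _ ≤ C * (|D| * ‖extChartAt 𝓘(ℝ, E) (x₀ : M) p.1
        - extChartAt 𝓘(ℝ, E) (x₀ : M) p.2‖) ^ r := by gcongr
      _ = _ := by rw [Real.mul_rpow (abs_nonneg _) (norm_nonneg _), mul_assoc]

/-- Transfer of the Hölder property between two local expressions of a field related by `C¹`
families of linear maps. -/
theorem isHolder_transfer {G₁ G₂ G₃ : Type*} [NormedAddCommGroup G₁] [NormedSpace ℝ G₁]
    [NormedAddCommGroup G₂] [NormedSpace ℝ G₂] [NormedAddCommGroup G₃] [NormedSpace ℝ G₃]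
    (L : G₁ →L[ℝ] G₂ →L[ℝ] G₃) {u : K → K → G₂} {v : K → K → G₃} {B : K → M → G₁}
    (hB : ∀ x₀ : K, ContMDiffAt 𝓘(ℝ, E) 𝓘(ℝ, G₁) ∞ (B x₀) x₀)
    (huv : ∀ x₀ : K, ∀ᶠ x : K in 𝓝 x₀, L (B x₀ x) (u x₀ x) = v x₀ x)
    (hu : IsHolder (E := E) u) : IsHolder (E := E) v := by
  obtain ⟨r, hr, h⟩ := hu
  refine ⟨min r 1, lt_min hr one_pos, fun x₀ => ?_⟩
  have h1 : HolderNear E r x₀ (u x₀) := h x₀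
  have h2 : HolderNear E 1 x₀ (fun x => B x₀ x) :=
    HolderNear.of_contMDiffAt ((hB x₀).of_le (by simp))
  have h0 : 0 ≤ min r 1 := (lt_min hr one_pos).le
  exact ((h2.mono h0 (min_le_right _ _)).bilin L h0 (h1.mono h0 (min_le_left _ _))).congr
    (huv x₀)

theorem eventually_mem_baseSet' (x₀ : K) : ∀ᶠ x : K in 𝓝 x₀,
    (x : M) ∈ (trivializationAt E (TangentSpace 𝓘(ℝ, E)) (x₀ : M)).baseSet :=
  continuous_subtype_val.continuousAt.eventually (eventually_mem_baseSet (x₀ : M))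

/-- The smooth local expression of `J` carries the chart expression to the global one, and that of
`R` carries it back because `R J = id`. -/
theorem mem_holderVec_iff (hK : IsCompact K) {X : (x : K) → TangentSpace 𝓘(ℝ, E) (x : M)} :
    X ∈ HolderVec E K ↔ BddHolder b.ι (fun x => b.J x (X x)) := by
  have hdef : X ∈ HolderVec E K ↔ IsHolder (E := E) (fun x₀ x : K =>
    (trivializationAt E (TangentSpace 𝓘(ℝ, E)) (x₀ : M)).continuousLinearMapAt ℝ (x : M) (X x)) :=
    Iff.rfl
  rw [← b.isHolder_iff hK, hdef]
  constructor
  · refine isHolder_transfer (ContinuousLinearMap.id ℝ (E →L[ℝ] (Fin b.n → E)))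
      (fun x₀ => b.contMDiffAt_J x₀) (fun x₀ => ?_)
    filter_upwards [eventually_mem_baseSet' (E := E) x₀] with x hx
    exact congrArg (b.J x) (Trivialization.symmL_continuousLinearMapAt _ hx (X x))
  · refine isHolder_transfer (ContinuousLinearMap.id ℝ ((Fin b.n → E) →L[ℝ] E))
      (fun x₀ => b.contMDiffAt_R x₀.2) (fun x₀ => Eventually.of_forall fun x => ?_)
    exact congrArg
      ((trivializationAt E (TangentSpace 𝓘(ℝ, E)) (x₀ : M)).continuousLinearMapAt ℝ (x : M))
      (b.R_J x.2 (X x))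

/-- Covectors transform by precomposition, so `R` and `J` exchange their roles. -/
theorem mem_holderCovec_iff (hK : IsCompact K)
    {ξ : (x : K) → (TangentSpace 𝓘(ℝ, E) (x : M) →L[ℝ] ℝ)} :
    ξ ∈ HolderCovec E K ↔ BddHolder b.ι (fun x => (ξ x).comp (b.R x)) := by
  have hdef : ξ ∈ HolderCovec E K ↔ IsHolder (E := E) (fun x₀ x : K =>
    (ξ x).comp ((trivializationAt E (TangentSpace 𝓘(ℝ, E)) (x₀ : M)).symmL ℝ (x : M))) :=
    Iff.rfl
  rw [← b.isHolder_iff hK, hdef]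
  constructor
  · refine isHolder_transfer (ContinuousLinearMap.compL ℝ (Fin b.n → E) E ℝ).flip
      (fun x₀ => b.contMDiffAt_R x₀.2) (fun x₀ => ?_)
    filter_upwards [eventually_mem_baseSet' (E := E) x₀] with x hx
    ext w
    exact congrArg (ξ x) (Trivialization.symmL_continuousLinearMapAt _ hx (b.R x w))
  · refine isHolder_transfer (ContinuousLinearMap.compL ℝ E (Fin b.n → E) ℝ).flip
      (fun x₀ => b.contMDiffAt_J x₀) (fun x₀ => Eventually.of_forall fun x => ?_)
    ext w
    exact congrArg (ξ x) (b.R_J x.2 _)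

end BumpCover

/-! ### From unit time to exponential growth. -/

section Iterate

variable {K V W : Type*} [NormedAddCommGroup V] [NormedAddCommGroup W] [NormedSpace ℝ W]
  {ι : K → V} {φ : ℝ → K → K} {A : ℝ → K → W →L[ℝ] W}

/-- A flow and a cocycle over it which are uniformly bounded and Lipschitz for `|t| ≤ 1` grow at
most exponentially. -/
theorem exp_growth_of_unit_time (hφ : ∀ s t x, φ (s + t) x = φ s (φ t x))
    (hA : ∀ s t x, A (s + t) x = (A s (φ t x)).comp (A t x)) {B : ℝ}
    (h1 : ∀ t, |t| ≤ 1 → ∀ x y, ‖ι (φ t x) - ι (φ t y)‖ ≤ B * ‖ι x - ι y‖)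
    (h2 : ∀ t, |t| ≤ 1 → ∀ x, ‖A t x‖ ≤ B)
    (h3 : ∀ t, |t| ≤ 1 → ∀ x y, ‖A t x - A t y‖ ≤ B * ‖ι x - ι y‖) (hB : 2 ≤ B) :
    ExpLipschitz ι φ ∧ ExpHolder ι A := by
  have hB1 : 1 ≤ B := by linarith
  have hB0 : 0 ≤ B := by linarith
  -- The exponent `3 (n + 1)` closes the induction for the Lipschitz constant of `A t`: a product
  -- contributes `B^(2n+3) + B^(3n+4)`, which is at most `B^(3n+6)` since `B ≥ 2`.
  have key : ∀ n : ℕ, ∀ t : ℝ, |t| ≤ n + 1 →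
      (∀ x y, ‖ι (φ t x) - ι (φ t y)‖ ≤ B ^ (n + 1) * ‖ι x - ι y‖) ∧
      (∀ x, ‖A t x‖ ≤ B ^ (n + 1)) ∧
      ∀ x y, ‖A t x - A t y‖ ≤ B ^ (3 * (n + 1)) * ‖ι x - ι y‖ := by
    intro n
    induction n with
    | zero =>
      intro t ht
      have ht' : |t| ≤ 1 := by simpa using ht
      refine ⟨by simpa using h1 t ht', by simpa using h2 t ht', fun x y => (h3 t ht' x y).trans ?_⟩
      gcongr
      exact le_self_pow₀ hB1 (by norm_num)
    | succ n ih =>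
      intro t ht
      push_cast at ht
      -- Splitting `t` in the ratio `1 : n + 1` leaves `|s| ≤ 1` and `|r| ≤ n + 1` for either sign
      -- of `t`.
      set s := t / (n + 2) with hs
      set r := t * ((n + 1) / (n + 2)) with hr
      have hn : (0 : ℝ) < (n : ℝ) + 2 := by positivity
      have hsr : t = s + r := by rw [hs, hr]; field_simp; ring
      have hs1 : |s| ≤ 1 := by
        rw [hs, abs_div, abs_of_pos hn, div_le_one hn]; linarith
      have hr1 : |r| ≤ n + 1 := by
        rw [hr, abs_mul, abs_of_nonneg (by positivity : (0 : ℝ) ≤ ((n : ℝ) + 1) / (n + 2)),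
          ← mul_div_assoc, div_le_iff₀ hn]
        nlinarith
      obtain ⟨i1, i2, i3⟩ := ih r hr1
      have d0 : ∀ x y, 0 ≤ ‖ι x - ι y‖ := fun x y => norm_nonneg _
      refine ⟨fun x y => ?_, fun x => ?_, fun x y => ?_⟩
      · rw [hsr, hφ, hφ]
        refine (h1 s hs1 _ _).trans ((mul_le_mul_of_nonneg_left (i1 x y) hB0).trans_eq ?_)
        ring
      · rw [hsr, hA]
        refine (ContinuousLinearMap.opNorm_comp_le _ _).trans
          ((mul_le_mul (h2 s hs1 _) (i2 x) (norm_nonneg _) hB0).trans_eq ?_)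
        ring
      · rw [hsr, hA, hA]
        have e : (A s (φ r x)).comp (A r x) - (A s (φ r y)).comp (A r y) =
            (A s (φ r x) - A s (φ r y)).comp (A r x) + (A s (φ r y)).comp (A r x - A r y) := by
          simp only [ContinuousLinearMap.sub_comp, ContinuousLinearMap.comp_sub]
          abel
        rw [e]
        have n1 : ‖(A s (φ r x) - A s (φ r y)).comp (A r x)‖
            ≤ B * (B ^ (n + 1) * ‖ι x - ι y‖) * B ^ (n + 1) :=
          (ContinuousLinearMap.opNorm_comp_le _ _).trans
            (mul_le_mul ((h3 s hs1 _ _).trans (mul_le_mul_of_nonneg_left (i1 x y) hB0)) (i2 x)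
              (norm_nonneg _) (by positivity))
        have n2 : ‖(A s (φ r y)).comp (A r x - A r y)‖
            ≤ B * (B ^ (3 * (n + 1)) * ‖ι x - ι y‖) :=
          (ContinuousLinearMap.opNorm_comp_le _ _).trans
            (mul_le_mul (h2 s hs1 _) (i3 x y) (norm_nonneg _) hB0)
        have p1 : B ^ (2 * n + 3) ≤ B ^ (3 * n + 4) := pow_le_pow_right₀ hB1 (by omega)
        have p2 : 2 * B ^ (3 * n + 4) ≤ B ^ (3 * n + 6) := by
          have : B ^ (3 * n + 6) = B ^ 2 * B ^ (3 * n + 4) := by ring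
          rw [this]
          exact mul_le_mul_of_nonneg_right (by nlinarith) (by positivity)
        calc _ ≤ B * (B ^ (n + 1) * ‖ι x - ι y‖) * B ^ (n + 1)
              + B * (B ^ (3 * (n + 1)) * ‖ι x - ι y‖) := (norm_add_le _ _).trans (add_le_add n1 n2)
          _ = (B ^ (2 * n + 3) + B ^ (3 * n + 4)) * ‖ι x - ι y‖ := by ring
          _ ≤ B ^ (3 * n + 6) * ‖ι x - ι y‖ :=
            mul_le_mul_of_nonneg_right (by linarith) (d0 x y)
          _ = _ := by ring
  have hlog : 0 ≤ Real.log B := Real.log_nonneg hB1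
  have hexp : ∀ t : ℝ, B ^ (3 * (⌊|t|⌋₊ + 1)) ≤ B ^ 3 * Real.exp (3 * Real.log B * |t|) := by
    intro t
    have e1 : ∀ n : ℕ, B ^ n = Real.exp (n * Real.log B) := fun n => by
      rw [mul_comm, Real.exp_mul, Real.exp_log (by linarith), Real.rpow_natCast]
    rw [e1, e1, ← Real.exp_add]
    refine Real.exp_le_exp.2 ?_
    push_cast
    have : (⌊|t|⌋₊ : ℝ) ≤ |t| := Nat.floor_le (abs_nonneg t)
    nlinarith [mul_le_mul_of_nonneg_right this hlog]
  have hle : ∀ t : ℝ, |t| ≤ (⌊|t|⌋₊ : ℝ) + 1 := fun t => (Nat.lt_floor_add_one _).le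
  have hpow : ∀ n : ℕ, B ^ (n + 1) ≤ B ^ (3 * (n + 1)) := fun n =>
    pow_le_pow_right₀ hB1 (by omega)
  refine ⟨⟨B ^ 3, 3 * Real.log B, by positivity, by positivity, fun t x y => ?_⟩, ?_⟩
  · exact ((key _ t (hle t)).1 x y).trans (mul_le_mul_of_nonneg_right
      ((hpow _).trans (hexp t)) (norm_nonneg _))
  · refine ExpHolder.of_le (C := B ^ 3) (b := 3 * Real.log B) one_pos (fun t x => ?_)
      fun t x y => ?_
    · exact ((key _ t (hle t)).2.1 x).trans ((hpow _).trans (hexp t))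
    · rw [Real.rpow_one]
      exact ((key _ t (hle t)).2.2 x y).trans (mul_le_mul_of_nonneg_right (hexp t)
        (norm_nonneg _))

end Iterate

/-! ### Invariance of the splitting and the derivative cocycle in the trivial bundle. -/

namespace HyperbolicFlow

variable {E M : Type*} [NormedAddCommGroup E] [NormedSpace ℝ E] [FiniteDimensional ℝ E]
  [TopologicalSpace M] [ChartedSpace E M] [IsManifold 𝓘(ℝ, E) ∞ M]
  [RiemannianBundle (fun x : M => TangentSpace 𝓘(ℝ, E) x)]
  (H : HyperbolicFlow E M)

section Splitting

theorem exists_decomposition (x : H.K) (v : TangentSpace 𝓘(ℝ, E) (x : M)) :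
    ∃ s ∈ H.Vs x, ∃ u ∈ H.Vu x, ∃ c : ℝ, v = s + u + c • H.F x := by
  have hv : v ∈ H.Vs x ⊔ (H.Vu x ⊔ ℝ ∙ H.F x) := by
    rw [(H.isCompl_s x).sup_eq_top]; trivial
  obtain ⟨s, hs, w, hw, rfl⟩ := Submodule.mem_sup.1 hv
  obtain ⟨u, hu, c, hc, rfl⟩ := Submodule.mem_sup.1 hw
  obtain ⟨r, rfl⟩ := Submodule.mem_span_singleton.1 hc
  exact ⟨s, hs, u, hu, r, by rw [add_assoc]⟩

theorem smul_F_mem (x : H.K) (c : ℝ) : c • H.F x ∈ (ℝ ∙ H.F x) :=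
  Submodule.smul_mem _ _ (Submodule.mem_span_singleton_self _)

variable {H}

theorem Ps_eq {x : H.K} {s u : TangentSpace 𝓘(ℝ, E) (x : M)} (hs : s ∈ H.Vs x) (hu : u ∈ H.Vu x)
    (c : ℝ) : H.Ps x (s + u + c • H.F x) = s := by
  change (H.Vs x).projection _ (H.isCompl_s x) (s + u + c • H.F x) = s
  rw [add_assoc, map_add, Submodule.projection_apply_of_mem_left _ hs,
    (Submodule.projection_apply_eq_zero_iff _).2, add_zero]
  exact Submodule.add_mem_sup hu (H.smul_F_mem x c)

theorem Pu_eq {x : H.K} {s u : TangentSpace 𝓘(ℝ, E) (x : M)} (hs : s ∈ H.Vs x) (hu : u ∈ H.Vu x)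
    (c : ℝ) : H.Pu x (s + u + c • H.F x) = u := by
  change (H.Vu x).projection _ (H.isCompl_u x) (s + u + c • H.F x) = u
  rw [add_comm s u, add_assoc, map_add, Submodule.projection_apply_of_mem_left _ hu,
    (Submodule.projection_apply_eq_zero_iff _).2, add_zero]
  exact Submodule.add_mem_sup hs (H.smul_F_mem x c)

theorem Pc_eq {x : H.K} {s u : TangentSpace 𝓘(ℝ, E) (x : M)} (hs : s ∈ H.Vs x) (hu : u ∈ H.Vu x)
    (c : ℝ) : H.Pc x (s + u + c • H.F x) = c • H.F x := by
  change (ℝ ∙ H.F x).projection _ (H.isCompl_c x) (s + u + c • H.F x) = _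
  rw [add_comm, map_add, Submodule.projection_apply_of_mem_left _ (H.smul_F_mem x c),
    (Submodule.projection_apply_eq_zero_iff _).2, add_zero]
  exact Submodule.add_mem_sup hs hu

variable (H)

theorem epsc_smul (x : H.K) (w : TangentSpace 𝓘(ℝ, E) (x : M)) :
    H.epsc x w • H.F x = H.Pc x w :=
  LinearEquiv.coord_apply_smul ℝ (TangentSpace 𝓘(ℝ, E) (x : M)) (H.F x) (H.F_ne_zero x x.2) _

variable {H}

theorem epsc_eq {x : H.K} {s u : TangentSpace 𝓘(ℝ, E) (x : M)} (hs : s ∈ H.Vs x)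
    (hu : u ∈ H.Vu x) (c : ℝ) : H.epsc x (s + u + c • H.F x) = c := by
  have h := H.epsc_smul x (s + u + c • H.F x)
  rw [Pc_eq hs hu] at h
  exact smul_left_injective ℝ (H.F_ne_zero x x.2) h

variable (H)

theorem decomposition (x : H.K) (v : TangentSpace 𝓘(ℝ, E) (x : M)) :
    v = H.Ps x v + H.Pu x v + H.epsc x v • H.F x := by
  obtain ⟨s, hs, u, hu, c, rfl⟩ := H.exists_decomposition x v
  rw [Ps_eq hs hu, Pu_eq hs hu, epsc_eq hs hu]

theorem Ps_mem (x : H.K) (v : TangentSpace 𝓘(ℝ, E) (x : M)) : H.Ps x v ∈ H.Vs x :=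
  Submodule.projection_apply_mem (H.isCompl_s x) v

theorem Pu_mem (x : H.K) (v : TangentSpace 𝓘(ℝ, E) (x : M)) : H.Pu x v ∈ H.Vu x :=
  Submodule.projection_apply_mem (H.isCompl_u x) v

theorem Ps_F (x : H.K) : H.Ps x (H.F x) = 0 := by
  simpa using Ps_eq (H.Vs x).zero_mem (H.Vu x).zero_mem 1

theorem Pu_F (x : H.K) : H.Pu x (H.F x) = 0 := by
  simpa using Pu_eq (H.Vs x).zero_mem (H.Vu x).zero_mem 1

theorem epsc_F (x : H.K) : H.epsc x (H.F x) = 1 := by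
  simpa using epsc_eq (H.Vs x).zero_mem (H.Vu x).zero_mem 1

theorem epsc_comp_Pc (x : H.K) : (H.epsc x).comp (H.Pc x) = H.epsc x := by
  ext v
  rw [ContinuousLinearMap.comp_apply, ← epsc_smul, map_smul, epsc_F, smul_eq_mul, mul_one]

end Splitting

section Push

theorem mdifferentiable_f (t : ℝ) : MDifferentiable 𝓘(ℝ, E) 𝓘(ℝ, E) (H.f t) := by
  have h : ContMDiff 𝓘(ℝ, E) 𝓘(ℝ, E) ∞ (H.f t) :=
    H.smooth_f.comp (contMDiff_const (c := t) |>.prodMk contMDiff_id)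
  exact h.mdifferentiable (by simp)

theorem orb_add (s t : ℝ) (x : H.K) : H.orb (s + t) x = H.orb s (H.orb t x) :=
  Subtype.ext (H.f.map_add s t x)

theorem orb_zero (x : H.K) : H.orb 0 x = x := Subtype.ext (H.f.map_zero_apply x)

/-- The time `t` map carries the integral curve through `x` to the one through `f^t x`; comparing
velocities at time zero gives the claim. -/
theorem push_F (t : ℝ) (x : H.K) : H.push t x (H.F x) = H.F (H.orb t x) := by
  have h1 : HasMFDerivAt 𝓘(ℝ, ℝ) 𝓘(ℝ, E) (fun s => H.f s x) (0 : ℝ)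
      ((1 : ℝ →L[ℝ] ℝ).smulRight (H.F (H.f 0 x))) := H.integralCurve x 0
  have h2 : HasMFDerivAt 𝓘(ℝ, ℝ) 𝓘(ℝ, E) (fun s => H.f s (H.f t x)) (0 : ℝ)
      ((1 : ℝ →L[ℝ] ℝ).smulRight (H.F (H.f 0 (H.f t x)))) := H.integralCurve _ 0
  have h3 : HasMFDerivAt 𝓘(ℝ, E) 𝓘(ℝ, E) (H.f t) (H.f 0 x)
      (mfderiv 𝓘(ℝ, E) 𝓘(ℝ, E) (H.f t) (H.f 0 x)) := (H.mdifferentiable_f t _).hasMFDerivAt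
  have h4 := h3.comp (0 : ℝ) h1
  have e : (H.f t) ∘ (fun s => H.f s x) = fun s => H.f s (H.f t x) := by
    funext s
    simp only [Function.comp_apply, ← H.f.map_add, add_comm]
  rw [e] at h4
  have h5 := hasMFDerivAt_unique h4 h2
  -- The base points `f^0 x` and `x` are equal but not definitionally so; free points `y` and `z`
  -- allow the substitution in dependent types.
  have h6 : ∀ y z : M, y = x → z = H.f t x →
      ((mfderiv 𝓘(ℝ, E) 𝓘(ℝ, E) (H.f t) y).comp ((1 : ℝ →L[ℝ] ℝ).smulRight (H.F y)) : ℝ →L[ℝ] E)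
        = ((1 : ℝ →L[ℝ] ℝ).smulRight (H.F z) : ℝ →L[ℝ] E) →
      mfderiv 𝓘(ℝ, E) 𝓘(ℝ, E) (H.f t) x (H.F x) = H.F (H.f t x) := by
    rintro y z rfl rfl h
    have h1 := DFunLike.congr_fun h (1 : ℝ)
    rw [ContinuousLinearMap.comp_apply] at h1
    have h2 : ∀ w : E, ((1 : ℝ →L[ℝ] ℝ).smulRight w) (1 : ℝ) = w := fun w => by simp
    have h3 := h2 (H.F x)
    have h4 := h2 (H.F (H.f t x))
    exact (congrArg (mfderiv 𝓘(ℝ, E) 𝓘(ℝ, E) (H.f t) x) h3).symm.trans (h1.trans h4)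
  exact h6 _ _ (H.f.map_zero_apply x) (H.f.map_zero_apply _) h5

theorem push_decomposition (t : ℝ) (x : H.K) (s u : TangentSpace 𝓘(ℝ, E) (x : M)) (c : ℝ) :
    H.push t x (s + u + c • H.F x) = H.push t x s + H.push t x u + c • H.F (H.orb t x) := by
  rw [map_add, map_add, map_smul, push_F]

theorem Ps_push (t : ℝ) (x : H.K) (v : TangentSpace 𝓘(ℝ, E) (x : M)) :
    H.Ps (H.orb t x) (H.push t x v) = H.push t x (H.Ps x v) := by
  obtain ⟨s, hs, u, hu, c, rfl⟩ := H.exists_decomposition x v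
  rw [Ps_eq hs hu, push_decomposition]
  exact Ps_eq (H.invariant_s t x s hs) (H.invariant_u t x u hu) c

theorem Pu_push (t : ℝ) (x : H.K) (v : TangentSpace 𝓘(ℝ, E) (x : M)) :
    H.Pu (H.orb t x) (H.push t x v) = H.push t x (H.Pu x v) := by
  obtain ⟨s, hs, u, hu, c, rfl⟩ := H.exists_decomposition x v
  rw [Pu_eq hs hu, push_decomposition]
  exact Pu_eq (H.invariant_s t x s hs) (H.invariant_u t x u hu) c

theorem epsc_push (t : ℝ) (x : H.K) (v : TangentSpace 𝓘(ℝ, E) (x : M)) :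
    H.epsc (H.orb t x) (H.push t x v) = H.epsc x v := by
  obtain ⟨s, hs, u, hu, c, rfl⟩ := H.exists_decomposition x v
  rw [epsc_eq hs hu, push_decomposition]
  exact epsc_eq (H.invariant_s t x s hs) (H.invariant_u t x u hu) c

end Push

variable (b : BumpCover E H.K)

/-- The derivative of the time `t` map read in the trivial bundle. -/
def hat (t : ℝ) (x : M) : (Fin b.n → E) →L[ℝ] (Fin b.n → E) :=
  (b.J (H.f t x)).comp ((mfderiv 𝓘(ℝ, E) 𝓘(ℝ, E) (H.f t) x).comp (b.R x))

theorem hat_apply (t : ℝ) (x : H.K) (w : Fin b.n → E) :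
    H.hat b t x w = b.J (H.orb t x) (H.push t x (b.R x w)) := rfl

theorem J_push (t : ℝ) (x : H.K) (v : TangentSpace 𝓘(ℝ, E) (x : M)) :
    b.J (H.orb t x) (H.push t x v) = H.hat b t x (b.J x v) := by
  rw [hat_apply, b.R_J x.2]

theorem hat_zero (x : H.K) : H.hat b 0 x = (b.J x).comp (b.R x) := by
  have h : ∀ g : M → M, g = id → (b.J (g x)).comp ((mfderiv 𝓘(ℝ, E) 𝓘(ℝ, E) g x).comp (b.R x))
      = (b.J x).comp (b.R x) := by
    rintro g rfl
    rw [mfderiv_id]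
    rfl
  exact h _ H.f.map_zero

/-- Between the two derivatives the factor `R J` is the identity on the tangent space at `f^t x`, so
the chain rule survives the passage to the trivial bundle. -/
theorem hat_add (s t : ℝ) (x : H.K) :
    H.hat b (s + t) x = (H.hat b s (H.orb t x)).comp (H.hat b t x) := by
  have h : ∀ k : M → M, k = H.f s ∘ H.f t →
      (b.J (k x)).comp ((mfderiv 𝓘(ℝ, E) 𝓘(ℝ, E) k x).comp (b.R x))
      = (H.hat b s (H.orb t x)).comp (H.hat b t x) := by
    rintro k rfl
    rw [mfderiv_comp (I' := 𝓘(ℝ, E)) _ (H.mdifferentiable_f s _) (H.mdifferentiable_f t _)]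
    ext1 w
    exact congrArg (fun v => b.J (H.f s (H.f t x))
      (mfderiv 𝓘(ℝ, E) 𝓘(ℝ, E) (H.f s) (H.f t x) v)) (b.R_J (H.orb t x).2 _).symm
  exact h _ (funext fun y => H.f.map_add s t y)

end HyperbolicFlow

/-! ### Comparison of Riemannian norms with norms in the trivial bundle. -/

namespace BumpCover

variable {E : Type*} [NormedAddCommGroup E] [NormedSpace ℝ E] [FiniteDimensional ℝ E]
  {M : Type*} [TopologicalSpace M] [T2Space M] [ChartedSpace E M] [IsManifold 𝓘(ℝ, E) ∞ M]
  {K : Set M} (b : BumpCover E K)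

section Norm

variable [RiemannianBundle (fun x : M => TangentSpace 𝓘(ℝ, E) x)]
  [IsContMDiffRiemannianBundle 𝓘(ℝ, E) ∞ E (fun x : M => TangentSpace 𝓘(ℝ, E) x)]

theorem isContinuousRiemannianBundle :
    IsContinuousRiemannianBundle E (fun x : M => TangentSpace 𝓘(ℝ, E) x) := by
  obtain ⟨g, hg, h⟩ := IsContMDiffRiemannianBundle.exists_contMDiff (IB := 𝓘(ℝ, E)) (n := ∞)
    (F := E) (E := fun x : M => TangentSpace 𝓘(ℝ, E) x)
  exact ⟨g, hg.continuous, h⟩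

/-- Locally `J` is a continuous matrix composed with a trivialization, whose Riemannian operator
norm is locally bounded because the metric is continuous. -/
theorem exists_norm_J_le (hK : IsCompact K) :
    ∃ C : ℝ, 0 ≤ C ∧ ∀ x ∈ K, ∀ v : TangentSpace 𝓘(ℝ, E) x, ‖b.J x v‖ ≤ C * ‖v‖ := by
  have := isContinuousRiemannianBundle (E := E) (M := M)
  obtain ⟨C, hC, h⟩ := exists_const_of_locally_le hK
    (a := fun x => ‖(b.J x : TangentSpace 𝓘(ℝ, E) x →L[ℝ] (Fin b.n → E))‖) (b := fun _ => 1)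
    (fun _ => zero_le_one) (fun x₀ _ => by
      obtain ⟨C, hC, h⟩ := eventually_norm_trivializationAt_lt E
        (fun x : M => TangentSpace 𝓘(ℝ, E) x) x₀
      have h2 := (b.contMDiffAt_J x₀).continuousAt.norm.eventually (eventually_lt_nhds
        (lt_add_one ‖(b.J x₀).comp ((trivializationAt E (TangentSpace 𝓘(ℝ, E)) x₀).symmL ℝ x₀)‖))
      refine ⟨(‖(b.J x₀).comp ((trivializationAt E (TangentSpace 𝓘(ℝ, E)) x₀).symmL ℝ x₀)‖ + 1)
        * C, ?_⟩
      filter_upwards [mem_nhdsWithin_of_mem_nhds h, mem_nhdsWithin_of_mem_nhds h2,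
        mem_nhdsWithin_of_mem_nhds (eventually_mem_baseSet (E := E) x₀)] with y h1 h2 hy
      rw [mul_one]
      refine ContinuousLinearMap.opNorm_le_bound _ (by positivity) fun v => ?_
      have e : b.J y v = ((b.J y).comp
          ((trivializationAt E (TangentSpace 𝓘(ℝ, E)) x₀).symmL ℝ y))
          ((trivializationAt E (TangentSpace 𝓘(ℝ, E)) x₀).continuousLinearMapAt ℝ y v) :=
        congrArg (b.J y) (Trivialization.symmL_continuousLinearMapAt _ hy v).symm
      rw [e, mul_assoc]
      refine (ContinuousLinearMap.le_opNorm _ _).trans ?_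
      refine mul_le_mul h2.le ?_ (norm_nonneg _) (by positivity)
      exact (ContinuousLinearMap.le_opNorm _ _).trans
        (mul_le_mul_of_nonneg_right h1.le (norm_nonneg _)))
  exact ⟨C, hC, fun x hx v => (ContinuousLinearMap.le_opNorm _ _).trans
    (mul_le_mul_of_nonneg_right ((h x hx).trans_eq (mul_one C)) (norm_nonneg _))⟩

theorem exists_norm_R_le (hK : IsCompact K) :
    ∃ C : ℝ, 0 ≤ C ∧ ∀ x ∈ K, ∀ w, ‖b.R x w‖ ≤ C * ‖w‖ := by
  have := isContinuousRiemannianBundle (E := E) (M := M)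
  obtain ⟨C, hC, h⟩ := exists_const_of_locally_le hK
    (a := fun x => ‖(b.R x : (Fin b.n → E) →L[ℝ] TangentSpace 𝓘(ℝ, E) x)‖) (b := fun _ => 1)
    (fun _ => zero_le_one) (fun x₀ hx₀ => by
      obtain ⟨C, hC, h⟩ := eventually_norm_symmL_trivializationAt_lt E
        (fun x : M => TangentSpace 𝓘(ℝ, E) x) x₀
      have h2 := (b.contMDiffAt_R hx₀).continuousAt.norm.eventually (eventually_lt_nhds
        (lt_add_one ‖((trivializationAt E (TangentSpace 𝓘(ℝ, E)) x₀).continuousLinearMapAt ℝ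
          x₀).comp (b.R x₀)‖))
      refine ⟨C * (‖((trivializationAt E (TangentSpace 𝓘(ℝ, E)) x₀).continuousLinearMapAt ℝ
          x₀).comp (b.R x₀)‖ + 1), ?_⟩
      filter_upwards [mem_nhdsWithin_of_mem_nhds h, mem_nhdsWithin_of_mem_nhds h2,
        mem_nhdsWithin_of_mem_nhds (eventually_mem_baseSet (E := E) x₀)] with y h1 h2 hy
      rw [mul_one]
      refine ContinuousLinearMap.opNorm_le_bound _ (by positivity) fun w => ?_
      have e : b.R y w = (trivializationAt E (TangentSpace 𝓘(ℝ, E)) x₀).symmL ℝ y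
          ((((trivializationAt E (TangentSpace 𝓘(ℝ, E)) x₀).continuousLinearMapAt ℝ y).comp
            (b.R y)) w) :=
        (Trivialization.symmL_continuousLinearMapAt _ hy _).symm
      rw [e, mul_assoc]
      refine (ContinuousLinearMap.le_opNorm _ _).trans ?_
      refine mul_le_mul h1.le ?_ (norm_nonneg _) hC.le
      exact (ContinuousLinearMap.le_opNorm _ _).trans
        (mul_le_mul_of_nonneg_right h2.le (norm_nonneg _)))
  exact ⟨C, hC, fun x hx v => (ContinuousLinearMap.le_opNorm _ _).trans
    (mul_le_mul_of_nonneg_right ((h x hx).trans_eq (mul_one C)) (norm_nonneg _))⟩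

end Norm

/-- A smooth vector field is smooth in the trivial bundle. -/
theorem contMDiff_J_section {X : (x : M) → TangentSpace 𝓘(ℝ, E) x}
    (hX : ContMDiff 𝓘(ℝ, E) 𝓘(ℝ, E).tangent ∞
      (fun x => (⟨x, X x⟩ : TangentBundle 𝓘(ℝ, E) M))) :
    ContMDiff 𝓘(ℝ, E) 𝓘(ℝ, Fin b.n → E) ∞ (fun x => b.J x (X x)) := by
  intro x₀
  have h := (contMDiffAt_section (x₀ := x₀)).1 (hX x₀)
  refine ((b.contMDiffAt_J x₀).clm_apply h).congr_of_eventuallyEq ?_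
  filter_upwards [eventually_mem_baseSet (E := E) x₀] with y hy
  have := congrArg (b.J y) (Trivialization.symmL_continuousLinearMapAt
    (trivializationAt E (TangentSpace 𝓘(ℝ, E)) x₀) (R := ℝ) hy (X y)).symm
  refine this.trans ?_
  rw [ContinuousLinearMap.comp_apply, Trivialization.continuousLinearMapAt_apply,
    Trivialization.coe_linearMapAt_of_mem _ hy]

/-- The family of linear maps `J ∘ P ∘ R` is bounded if `P` is a continuous bundle map. -/
theorem exists_norm_J_comp_R_le (hK : IsCompact K)
    (P : (x : K) → TangentSpace 𝓘(ℝ, E) (x : M) →L[ℝ] TangentSpace 𝓘(ℝ, E) (x : M))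
    (hP : Continuous (fun w : {w : TangentBundle 𝓘(ℝ, E) M // w.proj ∈ K} =>
      (⟨w.1.proj, P ⟨w.1.proj, w.2⟩ w.1.2⟩ : TangentBundle 𝓘(ℝ, E) M))) :
    ∃ C : ℝ, ∀ x : K, ‖(b.J x).comp ((P x).comp (b.R x))‖ ≤ C := by
  have : CompactSpace K := isCompact_iff_compactSpace.1 hK
  have hR : Continuous fun q : K × (Fin b.n → E) =>
      (⟨q.1, b.R q.1 q.2⟩ : TangentBundle 𝓘(ℝ, E) M) := by
    refine continuous_iff_continuousAt.2 fun q₀ => ?_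
    rw [FiberBundle.continuousAt_totalSpace]
    refine ⟨(continuous_subtype_val.comp continuous_fst).continuousAt, ?_⟩
    have h1 : ContinuousAt (fun q : K × (Fin b.n → E) =>
        (((trivializationAt E (TangentSpace 𝓘(ℝ, E)) (q₀.1 : M)).continuousLinearMapAt ℝ
          (q.1 : M)).comp (b.R q.1) : (Fin b.n → E) →L[ℝ] E) q.2) q₀ :=
      ((b.contMDiffAt_R q₀.1.2).continuousAt.comp_of_eq
        (continuous_subtype_val.comp continuous_fst).continuousAt rfl).clm_apply
        continuous_snd.continuousAt
    refine h1.congr ?_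
    filter_upwards [continuous_fst.continuousAt.eventually
      (eventually_mem_baseSet' (E := E) q₀.1)] with q hq
    rw [ContinuousLinearMap.comp_apply, Trivialization.continuousLinearMapAt_apply,
      Trivialization.coe_linearMapAt_of_mem _ hq]
  have hJ : Continuous fun w : TangentBundle 𝓘(ℝ, E) M => b.J w.proj w.2 := by
    refine continuous_iff_continuousAt.2 fun w₀ => ?_
    have h0 := (FiberBundle.continuousAt_totalSpace E (E := TangentSpace 𝓘(ℝ, E))
      (fun w : TangentBundle 𝓘(ℝ, E) M => w) (x₀ := w₀)).1 continuousAt_id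
    have h1 := ((b.contMDiffAt_J w₀.proj).continuousAt.comp_of_eq h0.1 rfl).clm_apply h0.2
    refine h1.congr ?_
    filter_upwards [h0.1.eventually (eventually_mem_baseSet (E := E) w₀.proj)] with w hw
    have := congrArg (b.J w.proj) (Trivialization.symmL_continuousLinearMapAt
      (trivializationAt E (TangentSpace 𝓘(ℝ, E)) w₀.proj) (R := ℝ) hw w.2)
    refine Eq.trans ?_ this
    rw [Trivialization.continuousLinearMapAt_apply, Trivialization.coe_linearMapAt_of_mem _ hw]
    rfl
  have hR' : Continuous fun q : K × (Fin b.n → E) =>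
      (⟨⟨q.1, b.R q.1 q.2⟩, q.1.2⟩ : {w : TangentBundle 𝓘(ℝ, E) M // w.proj ∈ K}) :=
    hR.subtype_mk fun q => q.1.2
  have hPR : Continuous fun q : K × (Fin b.n → E) =>
      (⟨q.1, P q.1 (b.R q.1 q.2)⟩ : TangentBundle 𝓘(ℝ, E) M) := hP.comp hR'
  have hcont : Continuous fun q : K × (Fin b.n → E) => b.J q.1 (P q.1 (b.R q.1 q.2)) := by
    have h := hJ.comp hPR
    rw [Function.comp_def] at h
    exact h
  -- Joint continuity on the compact product of `K` with the unit ball bounds the operator norms,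
  -- without any continuity of `P` in operator norm.
  obtain ⟨C, hC⟩ := (isCompact_univ.prod (isCompact_closedBall (0 : Fin b.n → E) 1)
    : IsCompact ((univ : Set K) ×ˢ _)).exists_bound_of_continuousOn hcont.continuousOn
  refine ⟨|C|, fun x => ContinuousLinearMap.opNorm_le_of_unit_norm (abs_nonneg C)
    fun w hw => (hC (x, w) ⟨trivial, by simp [hw]⟩).trans (le_abs_self C)⟩

end BumpCover

/-! ### Smoothness and growth of the derivative cocycle. -/

namespace HyperbolicFlow

variable {E M : Type*} [NormedAddCommGroup E] [NormedSpace ℝ E] [FiniteDimensional ℝ E]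
  [TopologicalSpace M] [T2Space M] [ChartedSpace E M] [IsManifold 𝓘(ℝ, E) ∞ M]
  [RiemannianBundle (fun x : M => TangentSpace 𝓘(ℝ, E) x)]
  (H : HyperbolicFlow E M) (b : BumpCover E H.K)

/-- Near `(t₀, x₀)` the map factors through trivializations at `f^{t₀} x₀` and `x₀`, into local
expressions of `J`, of the derivative of the flow, and of `R`, each smooth in time and position. -/
theorem contMDiffAt_hat (t₀ : ℝ) {x₀ : M} (hx₀ : x₀ ∈ H.K) :
    ContMDiffAt (𝓘(ℝ, ℝ).prod 𝓘(ℝ, E)) 𝓘(ℝ, (Fin b.n → E) →L[ℝ] (Fin b.n → E)) ∞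
      (fun p : ℝ × M => H.hat b p.1 p.2) (t₀, x₀) := by
  have hf := H.smooth_f (t₀, x₀)
  have h1 : ContMDiffAt (𝓘(ℝ, ℝ).prod 𝓘(ℝ, E)) 𝓘(ℝ, E →L[ℝ] (Fin b.n → E)) ∞
      (fun p : ℝ × M => (b.J (H.f p.1 p.2)).comp
        ((trivializationAt E (TangentSpace 𝓘(ℝ, E)) (H.f t₀ x₀)).symmL ℝ (H.f p.1 p.2)))
      (t₀, x₀) := (b.contMDiffAt_J (H.f t₀ x₀)).comp (t₀, x₀) hf
  have h2 : ContMDiffAt (𝓘(ℝ, ℝ).prod 𝓘(ℝ, E)) 𝓘(ℝ, (Fin b.n → E) →L[ℝ] E) ∞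
      (fun p : ℝ × M => ((trivializationAt E (TangentSpace 𝓘(ℝ, E)) x₀).continuousLinearMapAt ℝ
        p.2).comp (b.R p.2)) (t₀, x₀) := (b.contMDiffAt_R hx₀).comp (t₀, x₀) contMDiffAt_snd
  have h3 := ContMDiffAt.mfderiv (I := 𝓘(ℝ, E)) (I' := 𝓘(ℝ, E)) (J := 𝓘(ℝ, ℝ).prod 𝓘(ℝ, E))
    (m := ∞) (n := ∞) (x₀ := (t₀, x₀)) (fun (p : ℝ × M) y => H.f p.1 y) Prod.snd
    (H.smooth_f.contMDiffAt.comp ((t₀, x₀), x₀)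
      ((contMDiffAt_fst.comp _ contMDiffAt_fst).prodMk contMDiffAt_snd)) contMDiffAt_snd (by simp)
  have h4 := (h1.clm_comp h3).clm_comp h2
  refine h4.congr_of_eventuallyEq ?_
  have e1 : ∀ᶠ p : ℝ × M in 𝓝 (t₀, x₀), p.2 ∈
      (trivializationAt E (TangentSpace 𝓘(ℝ, E)) x₀).baseSet :=
    continuousAt_snd.eventually (BumpCover.eventually_mem_baseSet (E := E) x₀)
  have e2 : ∀ᶠ p : ℝ × M in 𝓝 (t₀, x₀), H.f p.1 p.2 ∈
      (trivializationAt E (TangentSpace 𝓘(ℝ, E)) (H.f t₀ x₀)).baseSet :=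
    hf.continuousAt.eventually (BumpCover.eventually_mem_baseSet (E := E) (H.f t₀ x₀))
  filter_upwards [e1, e2] with p hp1 hp2
  ext1 w
  have a1 := Trivialization.symmL_continuousLinearMapAt
    (trivializationAt E (TangentSpace 𝓘(ℝ, E)) x₀) (R := ℝ) hp1 (b.R p.2 w)
  have a2 := Trivialization.symmL_continuousLinearMapAt
    (trivializationAt E (TangentSpace 𝓘(ℝ, E)) (H.f t₀ x₀)) (R := ℝ) hp2
    (mfderiv 𝓘(ℝ, E) 𝓘(ℝ, E) (H.f p.1) p.2 (b.R p.2 w))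
  refine (congrArg (b.J (H.f p.1 p.2)) a2).symm.trans ?_
  exact congrArg (fun v => b.J (H.f p.1 p.2)
    ((trivializationAt E (TangentSpace 𝓘(ℝ, E)) (H.f t₀ x₀)).symmL ℝ (H.f p.1 p.2)
    ((trivializationAt E (TangentSpace 𝓘(ℝ, E)) (H.f t₀ x₀)).continuousLinearMapAt ℝ
      (H.f p.1 p.2) (mfderiv 𝓘(ℝ, E) 𝓘(ℝ, E) (H.f p.1) p.2 v)))) a1.symm

theorem exp_growth :
    ExpLipschitz b.ι H.orb ∧ ExpHolder b.ι (fun t (x : H.K) => H.hat b t x) := by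
  obtain ⟨B, hB, h1, h2⟩ := b.exists_lipschitz H.isCompact_K
    (u := fun p : ℝ × M => H.hat b p.1 p.2)
    fun t x hx => (H.contMDiffAt_hat b t hx).of_le (by simp)
  obtain ⟨D, hD, -, h3⟩ := b.exists_lipschitz H.isCompact_K
    (u := fun p : ℝ × M => b.emb (H.f p.1 p.2))
    fun t x hx => ((b.contMDiff_emb.comp H.smooth_f) (t, x)).of_le (by simp)
  have hle : ∀ x y : H.K, 0 ≤ ‖b.ι x - b.ι y‖ := fun _ _ => norm_nonneg _
  refine exp_growth_of_unit_time (B := B + D + 2) H.orb_add (H.hat_add b)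
    (fun t ht x y => (h3 t ht x y).trans ?_) (fun t ht x => (h1 t ht x).trans (by linarith))
    (fun t ht x y => (h2 t ht x y).trans ?_) (by linarith)
  · exact mul_le_mul_of_nonneg_right (by linarith) (hle _ _)
  · exact mul_le_mul_of_nonneg_right (by linarith) (hle _ _)

theorem continuous_hat (x : H.K) : Continuous fun t => H.hat b t x :=
  continuous_iff_continuousAt.2 fun t =>
    ContinuousAt.comp (f := fun t : ℝ => (t, (x : M))) (H.contMDiffAt_hat b t x.2).continuousAt
      (by fun_prop)

theorem continuous_orb : Continuous fun p : ℝ × H.K => H.orb p.1 p.2 :=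
  (H.smooth_f.continuous.comp
    (continuous_fst.prodMk (continuous_subtype_val.comp continuous_snd))).subtype_mk _

end HyperbolicFlow

/-! ### A hyperbolic flow as a hyperbolic cocycle. -/

namespace HyperbolicFlow

variable {E M : Type*} [NormedAddCommGroup E] [NormedSpace ℝ E] [FiniteDimensional ℝ E]
  [TopologicalSpace M] [T2Space M] [ChartedSpace E M] [IsManifold 𝓘(ℝ, E) ∞ M]
  [RiemannianBundle (fun x : M => TangentSpace 𝓘(ℝ, E) x)]
  [IsContMDiffRiemannianBundle 𝓘(ℝ, E) ∞ E (fun x : M => TangentSpace 𝓘(ℝ, E) x)]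
  (H : HyperbolicFlow E M) (b : BumpCover E H.K)

/-- The stable projection read in the trivial bundle. -/
def hatPs (x : H.K) : (Fin b.n → E) →L[ℝ] (Fin b.n → E) := (b.J x).comp ((H.Ps x).comp (b.R x))

/-- The unstable projection read in the trivial bundle. -/
def hatPu (x : H.K) : (Fin b.n → E) →L[ℝ] (Fin b.n → E) := (b.J x).comp ((H.Pu x).comp (b.R x))

/-- The vector field read in the trivial bundle. -/
def hatF (x : M) : Fin b.n → E := b.J x (H.F x)

theorem exists_norm_hatPs_le : ∃ C : ℝ, ∀ x, ‖H.hatPs b x‖ ≤ C :=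
  b.exists_norm_J_comp_R_le H.isCompact_K H.Ps H.continuous_s

theorem exists_norm_hatPu_le : ∃ C : ℝ, ∀ x, ‖H.hatPu b x‖ ≤ C :=
  b.exists_norm_J_comp_R_le H.isCompact_K H.Pu H.continuous_u

theorem contMDiff_hatF : ContMDiff 𝓘(ℝ, E) 𝓘(ℝ, Fin b.n → E) ∞ (H.hatF b) :=
  b.contMDiff_J_section H.smooth_F

theorem hatF_lower : ∃ m : ℝ, 0 < m ∧ ∀ x : H.K, m ≤ ‖H.hatF b x‖ := by
  rcases H.K.eq_empty_or_nonempty with h | h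
  · exact ⟨1, one_pos, fun x => (h.subset x.2).elim⟩
  · obtain ⟨x₀, hx₀, hmin⟩ := H.isCompact_K.exists_isMinOn h
      (H.contMDiff_hatF b).continuous.norm.continuousOn
    refine ⟨‖H.hatF b x₀‖, norm_pos_iff.2 fun h0 => H.F_ne_zero x₀ hx₀ ?_, fun x => hmin x.2⟩
    rw [← b.R_J hx₀ (H.F x₀)]
    exact (congrArg (b.R x₀) h0).trans (map_zero _)

theorem split_hat (x : H.K) : H.hat b 0 x = H.hatPs b x + H.hatPu b x +
    ((H.epsc x).comp (b.R x)).smulRight (H.hatF b x) := by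
  rw [hat_zero]
  ext1 w
  have h := congrArg (b.J (x : M)) (H.decomposition x (b.R x w))
  rw [map_add, map_add, map_smul] at h
  exact h

theorem exists_norm_epsc_le : ∃ C : ℝ, ∀ x : H.K, ‖(H.epsc x).comp (b.R x)‖ ≤ C := by
  obtain ⟨C, hC⟩ := H.exists_norm_hatPs_le b
  obtain ⟨D, hD⟩ := H.exists_norm_hatPu_le b
  obtain ⟨B, r, hB, -, -, hB1, -⟩ := ((H.exp_growth b).2.at_time 0).exists_bound
  obtain ⟨m, hm, hF⟩ := H.hatF_lower b
  refine ⟨(B + C + D) / m, fun x => ?_⟩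
  have hnn : 0 ≤ B + C + D := by
    linarith [(norm_nonneg _).trans (hC x), (norm_nonneg _).trans (hD x)]
  refine ContinuousLinearMap.opNorm_le_bound _ (by positivity) fun w => ?_
  have h : ((H.epsc x).comp (b.R x)) w • H.hatF b x =
      (H.hat b 0 x - H.hatPs b x - H.hatPu b x) w := by
    rw [split_hat]
    simp
    abel
  have h2 : ‖((H.epsc x).comp (b.R x)) w‖ * ‖H.hatF b x‖ ≤ (B + C + D) * ‖w‖ := by
    rw [← norm_smul, h]
    refine (ContinuousLinearMap.le_opNorm _ _).trans
      (mul_le_mul_of_nonneg_right ?_ (norm_nonneg _))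
    exact (norm_sub_le _ _).trans (add_le_add ((norm_sub_le _ _).trans
      (add_le_add (hB1 x) (hC x))) (hD x))
  rw [div_mul_eq_mul_div, le_div_iff₀ hm]
  exact (mul_le_mul_of_nonneg_left (hF x) (norm_nonneg _)).trans h2

/-- The bounds on `J`, `R` and the projection move hyperbolicity from the Riemannian norm to the
fixed norm, with rate `a = -log λ`. The sign function `θ` lets one proof serve both the stable and
the unstable estimate. -/
theorem hyp_estimate (P : (x : H.K) → TangentSpace 𝓘(ℝ, E) (x : M) →L[ℝ]
      TangentSpace 𝓘(ℝ, E) (x : M)) {D : ℝ}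
    (hP : ∀ x : H.K, ‖(b.J x).comp ((P x).comp (b.R x))‖ ≤ D) (θ : ℝ → ℝ)
    (h : ∃ C lam : ℝ, 0 < C ∧ 0 < lam ∧ lam < 1 ∧ ∀ (x : H.K) (t : ℝ), 0 ≤ t → ∀ v,
      ‖H.push (θ t) x (P x v)‖ ≤ C * lam ^ t * ‖P x v‖) :
    ∃ C a : ℝ, 0 < a ∧ ∀ (x : H.K) t, 0 ≤ t →
      ‖(H.hat b (θ t) x).comp ((b.J x).comp ((P x).comp (b.R x)))‖ ≤ C * Real.exp (-a * t) := by
  obtain ⟨C, lam, hC, hl0, hl1, h⟩ := h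
  obtain ⟨CJ, hCJ, hJ⟩ := b.exists_norm_J_le H.isCompact_K
  obtain ⟨CR, hCR, hR⟩ := b.exists_norm_R_le H.isCompact_K
  refine ⟨CJ * (C * (CR * D)), -Real.log lam, by linarith [Real.log_neg hl0 hl1],
    fun x t ht => ?_⟩
  have hD : 0 ≤ D := (norm_nonneg _).trans (hP x)
  have hlt : lam ^ t = Real.exp (- -Real.log lam * t) := by
    rw [neg_neg, Real.rpow_def_of_pos hl0]
  rw [← hlt]
  have hl : 0 ≤ lam ^ t := Real.rpow_nonneg hl0.le _
  refine ContinuousLinearMap.opNorm_le_bound _ (by positivity) fun w => ?_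
  have e : ((H.hat b (θ t) x).comp ((b.J x).comp ((P x).comp (b.R x)))) w =
      b.J (H.orb (θ t) x) (H.push (θ t) x (P x (b.R x w))) := (H.J_push b (θ t) x _).symm
  have n1 : ‖P x (b.R x w)‖ ≤ CR * (D * ‖w‖) := by
    rw [← b.R_J x.2 (P x (b.R x w))]
    refine (hR x x.2 _).trans (mul_le_mul_of_nonneg_left ?_ hCR)
    exact (ContinuousLinearMap.le_opNorm ((b.J x).comp ((P x).comp (b.R x))) w).trans
      (mul_le_mul_of_nonneg_right (hP x) (norm_nonneg _))
  rw [e]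
  calc _ ≤ CJ * ‖H.push (θ t) x (P x (b.R x w))‖ := hJ _ (H.orb (θ t) x).2 _
    _ ≤ CJ * (C * lam ^ t * (CR * (D * ‖w‖))) :=
        mul_le_mul_of_nonneg_left ((h x t ht _).trans
          (mul_le_mul_of_nonneg_left n1 (by positivity))) hCJ
    _ = _ := by ring

/-- The derivative cocycle of a hyperbolic flow, read in the trivial bundle. -/
def cocycle : HypCocycle H.K (Fin b.n → E × ℝ) (Fin b.n → E) where
  ι := b.ι
  φ := H.orb
  A t x := H.hat b t x
  Ps := H.hatPs b
  Pu := H.hatPu b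
  F x := H.hatF b x
  eps x := (H.epsc x).comp (b.R x)
  φ_zero := H.orb_zero
  φ_add := H.orb_add
  A_add := H.hat_add b
  expLipschitz_φ := (H.exp_growth b).1
  expHolder_A := (H.exp_growth b).2
  continuous_φ x := b.continuous_ι.comp (H.continuous_orb.comp (Continuous.prodMk_left x))
  continuous_A := H.continuous_hat b
  split := H.split_hat b
  A_zero_Ps x := by
    rw [hat_zero]
    ext1 w
    exact congrArg (b.J x) (b.R_J x.2 _)
  A_zero_Pu x := by
    rw [hat_zero]
    ext1 w
    exact congrArg (b.J x) (b.R_J x.2 _)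
  Ps_comm t x := by
    ext1 w
    have h1 := congrArg (fun v => b.J (H.orb t x) (H.Ps (H.orb t x) v))
      (b.R_J (H.orb t x).2 (H.push t x (b.R x w)))
    refine h1.trans ?_
    exact (congrArg (b.J (H.orb t x)) (H.Ps_push t x _)).trans (H.J_push b t x _)
  Pu_comm t x := by
    ext1 w
    have h1 := congrArg (fun v => b.J (H.orb t x) (H.Pu (H.orb t x) v))
      (b.R_J (H.orb t x).2 (H.push t x (b.R x w)))
    refine h1.trans ?_
    exact (congrArg (b.J (H.orb t x)) (H.Pu_push t x _)).trans (H.J_push b t x _)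
  Ps_F x := by
    change b.J x (H.Ps x (b.R x (b.J x (H.F x)))) = 0
    rw [b.R_J x.2, Ps_F, map_zero]
  Pu_F x := by
    change b.J x (H.Pu x (b.R x (b.J x (H.F x)))) = 0
    rw [b.R_J x.2, Pu_F, map_zero]
  eps_F x := by
    change H.epsc x (b.R x (b.J x (H.F x))) = 1
    rw [b.R_J x.2, epsc_F]
  eps_A t x := by
    ext1 w
    exact (congrArg (H.epsc (H.orb t x)) (b.R_J (H.orb t x).2 (H.push t x (b.R x w)))).trans
      (H.epsc_push t x _)
  A_F t x := (H.J_push b t x _).symm.trans (congrArg (b.J (H.orb t x)) (H.push_F t x))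
  hyp_s := by
    obtain ⟨D, hD⟩ := H.exists_norm_hatPs_le b
    obtain ⟨C, lam, hC, hl0, hl1, h⟩ := H.hyperbolic
    exact H.hyp_estimate b H.Ps hD id ⟨C, lam, hC, hl0, hl1, fun x t ht v =>
      (h x t ht).1 _ (H.Ps_mem x v)⟩
  hyp_u := by
    obtain ⟨D, hD⟩ := H.exists_norm_hatPu_le b
    obtain ⟨C, lam, hC, hl0, hl1, h⟩ := H.hyperbolic
    exact H.hyp_estimate b H.Pu hD Neg.neg ⟨C, lam, hC, hl0, hl1, fun x t ht v =>
      (h x t ht).2 _ (H.Pu_mem x v)⟩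
  bound_eps := H.exists_norm_epsc_le b
  holder_F := b.bddHolder_of_contMDiffAt H.isCompact_K
    fun x _ => ((H.contMDiff_hatF b) x).of_le (by simp)
  F_lower := H.hatF_lower b

end HyperbolicFlow

/-! ### From the equation at time zero to the equation along orbits. -/

namespace HypCocycle

variable {K V W : Type*} [NormedAddCommGroup V] [NormedAddCommGroup W] [NormedSpace ℝ W]
  (c : HypCocycle K V W)

/-- The hypothesis at the point `φ_t x`, pulled back by the fixed map `A t x`, is the derivative at
time `t`. -/
theorem hasDerivAt_comp_A {m n : K → W →L[ℝ] ℝ}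
    (h : ∀ x, HasDerivAt (fun s => (m (c.φ s x)).comp (c.A s x)) ((n x).comp (c.A 0 x)) 0)
    (x : K) (t : ℝ) :
    HasDerivAt (fun s => (m (c.φ s x)).comp (c.A s x)) ((n (c.φ t x)).comp (c.A t x)) t := by
  have h1 : HasDerivAt (fun s => (m (c.φ (s - t) (c.φ t x))).comp (c.A (s - t) (c.φ t x)))
      ((n (c.φ t x)).comp (c.A 0 (c.φ t x))) t := by
    have := HasDerivAt.scomp t (by simpa using h (c.φ t x)) ((hasDerivAt_id t).sub_const t)
    rw [one_smul] at this
    exact this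
  have h2 := ((ContinuousLinearMap.compL ℝ W W ℝ).flip (c.A t x)).hasFDerivAt.comp_hasDerivAt t h1
  have e1 : ∀ s, ((m (c.φ (s - t) (c.φ t x))).comp (c.A (s - t) (c.φ t x))).comp (c.A t x) =
      (m (c.φ s x)).comp (c.A s x) := fun s => by
    rw [ContinuousLinearMap.comp_assoc, ← c.A_add, ← c.φ_add, sub_add_cancel]
  have e2 : ((n (c.φ t x)).comp (c.A 0 (c.φ t x))).comp (c.A t x) =
      (n (c.φ t x)).comp (c.A t x) := by
    rw [ContinuousLinearMap.comp_assoc, c.A_zero_comp_A]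
  refine (h2.congr_deriv e2).congr_of_eventuallyEq (Eventually.of_forall fun s => ?_)
  exact (e1 s).symm

end HypCocycle

/-! ### Transfer back to the manifold: shadowing pairs and the adjoint operator. -/

namespace HyperbolicFlow

variable {E M : Type*} [NormedAddCommGroup E] [NormedSpace ℝ E] [FiniteDimensional ℝ E]
  [TopologicalSpace M] [T2Space M] [ChartedSpace E M] [IsManifold 𝓘(ℝ, E) ∞ M]
  [RiemannianBundle (fun x : M => TangentSpace 𝓘(ℝ, E) x)]
  [IsContMDiffRiemannianBundle 𝓘(ℝ, E) ∞ E (fun x : M => TangentSpace 𝓘(ℝ, E) x)]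
  (H : HyperbolicFlow E M) (b : BumpCover E H.K)

/-- The inverse of `f_*^t`, read in the trivial bundle. -/
def pushInv (t : ℝ) (x : H.K) :
    TangentSpace 𝓘(ℝ, E) (H.orb t x : M) →L[ℝ] TangentSpace 𝓘(ℝ, E) (x : M) :=
  (b.R x).comp ((H.hat b (-t) (H.orb t x)).comp (b.J (H.orb t x)))

theorem pushInv_push (t : ℝ) (x : H.K) (v : TangentSpace 𝓘(ℝ, E) (x : M)) :
    H.pushInv b t x (H.push t x v) = v := by
  have h1 : H.hat b (-t) (H.orb t x) (H.hat b t x (b.J x v)) = H.hat b 0 x (b.J x v) :=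
    DFunLike.congr_fun ((H.cocycle b).A_neg_comp_A t x) (b.J x v)
  have h2 : H.pushInv b t x (H.push t x v) = b.R x (H.hat b (-t) (H.orb t x)
    (b.J (H.orb t x) (H.push t x v))) := rfl
  rw [h2, J_push, h1, hat_zero, ContinuousLinearMap.comp_apply, b.R_J x.2, b.R_J x.2]

theorem push_pushInv (t : ℝ) (x : H.K) (v : TangentSpace 𝓘(ℝ, E) (H.orb t x : M)) :
    H.push t x (H.pushInv b t x v) = v := by
  have h1 : H.hat b t x (H.hat b (-t) (H.orb t x) (b.J (H.orb t x) v)) =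
      H.hat b 0 (H.orb t x) (b.J (H.orb t x) v) :=
    DFunLike.congr_fun ((H.cocycle b).A_comp_A_neg t x) (b.J (H.orb t x) v)
  have h3 := b.R_J (H.orb t x).2 (H.push t x (H.pushInv b t x v))
  have h4 : b.J (H.orb t x) (H.push t x (H.pushInv b t x v)) =
    H.hat b t x (H.hat b (-t) (H.orb t x) (b.J (H.orb t x) v)) := rfl
  rw [h4, h1, hat_zero, ContinuousLinearMap.comp_apply, b.R_J (H.orb t x).2,
    b.R_J (H.orb t x).2] at h3
  exact h3.symm

/-- Since `f_*^t` is invertible, the `inverse` in `LieVec` is the true inverse and not the default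
value zero. -/
theorem inverse_push (t : ℝ) (x : H.K) : (H.push t x).inverse = H.pushInv b t x := by
  have := ContinuousLinearMap.inverse_equiv (ContinuousLinearEquiv.equivOfInverse (H.push t x)
    (H.pushInv b t x) (H.pushInv_push b t x) (H.push_pushInv b t x))
  exact this

theorem J_pushInv (t : ℝ) (x : H.K) (v : TangentSpace 𝓘(ℝ, E) (H.orb t x : M)) :
    b.J x (H.pushInv b t x v) = H.hat b (-t) (H.orb t x) (b.J (H.orb t x) v) := by
  have h1 : H.hat b 0 (H.orb (-t) (H.orb t x)) (H.hat b (-t) (H.orb t x) (b.J (H.orb t x) v)) =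
      H.hat b (-t) (H.orb t x) (b.J (H.orb t x) v) :=
    DFunLike.congr_fun ((H.cocycle b).A_zero_comp_A (-t) (H.orb t x)) (b.J (H.orb t x) v)
  have h2 : H.orb (-t) (H.orb t x) = x := (H.cocycle b).φ_neg_φ t x
  rw [h2, hat_zero] at h1
  exact h1

theorem lieVec_iff {v w : (x : H.K) → TangentSpace 𝓘(ℝ, E) (x : M)} :
    H.LieVec v w ↔ ∀ x : H.K, HasDerivAt
      (fun t => H.hat b (-t) (H.orb t x) (b.J (H.orb t x) (v (H.orb t x)))) (b.J x (w x)) 0 := by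
  refine forall_congr' fun x => ?_
  simp only [H.inverse_push b]
  constructor <;> intro h
  · have := (b.J (x : M)).hasFDerivAt.comp_hasDerivAt (0 : ℝ) h
    exact this.congr_of_eventuallyEq (Eventually.of_forall fun s => (H.J_pushInv b s x _).symm)
  · have := (b.R (x : M)).hasFDerivAt.comp_hasDerivAt (0 : ℝ) h
    rw [b.R_J x.2] at this
    exact this

theorem pull_comp_R (t : ℝ) (x : H.K) (η : H.Cotan (H.orb t x)) :
    (H.pull t x η).comp (b.R x) = (η.comp (b.R (H.orb t x))).comp (H.hat b t x) := by
  ext1 w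
  exact congrArg η (b.R_J (H.orb t x).2 (H.push t x (b.R x w))).symm

theorem comp_R_comp_J {x : H.K} (η : H.Cotan x) : (η.comp (b.R x)).comp (b.J x) = η := by
  ext1 v
  exact congrArg η (b.R_J x.2 v)

theorem hasDerivAt_pull_iff {x : H.K} {ν : (t : ℝ) → H.Cotan (H.orb t x)} {μ : H.Cotan x} {t : ℝ} :
    HasDerivAt (fun s => H.pull s x (ν s)) μ t ↔
    HasDerivAt (fun s => ((ν s).comp (b.R (H.orb s x))).comp (H.hat b s x)) (μ.comp (b.R x)) t := by
  constructor <;> intro h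
  · have := ((ContinuousLinearMap.compL ℝ (Fin b.n → E) (TangentSpace 𝓘(ℝ, E) (x : M)) ℝ).flip
      (b.R x)).hasFDerivAt.comp_hasDerivAt t h
    refine this.congr_of_eventuallyEq (Eventually.of_forall fun s => ?_)
    exact (H.pull_comp_R b s x (ν s)).symm
  · have := ((ContinuousLinearMap.compL ℝ (TangentSpace 𝓘(ℝ, E) (x : M)) (Fin b.n → E) ℝ).flip
      (b.J x)).hasFDerivAt.comp_hasDerivAt t h
    refine (this.congr_deriv (H.comp_R_comp_J b μ)).congr_of_eventuallyEq
      (Eventually.of_forall fun s => ?_)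
    exact (H.comp_R_comp_J b (H.pull s x (ν s))).symm.trans
      (congrArg (fun m => m.comp (b.J x)) (H.pull_comp_R b s x (ν s)))

/-- The pair is the cocycle's shadowing field brought back by `R`, with `η = ε^c(X)`. -/
theorem exists_isShadowingPair (X : HolderVec E H.K) : ∃ v η, H.IsShadowingPair X v η := by
  obtain ⟨b⟩ := BumpCover.nonempty_of_isCompact (E := E) H.isCompact_K
  have hX : BddHolder b.ι (fun x => b.J x (X.1 x)) := (b.mem_holderVec_iff H.isCompact_K).1 X.2
  have hv := (H.cocycle b).holder_shadow hX
  have hd := (H.cocycle b).hasDerivAt_shadow hX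
  set v := (H.cocycle b).shadow (fun x => b.J x (X.1 x)) with hvdef
  have hη : BddHolder b.ι (fun x => H.epsc x (X.1 x)) := by
    have h := (H.cocycle b).holder_eps.clm_apply hX
    have e : ∀ x : H.K, ((H.epsc x).comp (b.R x)) (b.J x (X.1 x)) = H.epsc x (X.1 x) :=
      fun x => congrArg (H.epsc x) (b.R_J x.2 _)
    exact (funext e : _) ▸ h
  -- Reading the field back in the trivial bundle applies the projection `A 0`; it is Hölder and is
  -- absorbed by `A (-t)`.
  have e0 : ∀ x : H.K, b.J x (b.R x (v x)) = H.hat b 0 x (v x) := fun x => by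
    rw [hat_zero]; rfl
  refine ⟨⟨fun x => b.R x (v x), (b.mem_holderVec_iff H.isCompact_K).2 ?_⟩,
    ⟨fun x => H.epsc x (X.1 x), (b.isHolder_iff H.isCompact_K).2 hη⟩,
    (H.lieVec_iff b).2 fun x => ?_⟩
  · simp only [e0]
    exact ((H.cocycle b).expHolder_A.at_time 0).clm_apply hv
  · refine ((hd x).congr_deriv ?_).congr_of_eventuallyEq (Eventually.of_forall fun t => ?_)
    · have h1 : H.hat b 0 x (b.J x (X.1 x)) = b.J x (X.1 x) := by
        rw [hat_zero, ContinuousLinearMap.comp_apply, b.R_J x.2]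
      have h2 : ((H.epsc x).comp (b.R x)) (b.J x (X.1 x)) = H.epsc x (X.1 x) :=
        congrArg (H.epsc x) (b.R_J x.2 _)
      have h3 : b.J x (X.1 x - H.epsc x (X.1 x) • H.F x) =
          b.J x (X.1 x) - H.epsc x (X.1 x) • b.J x (H.F x) := by rw [map_sub, map_smul]
      refine Eq.trans ?_ h3.symm
      exact congrArg₂ (· - ·) h1 (congrArg (· • b.J x (H.F x)) h2)
    · have h1 := DFunLike.congr_fun ((H.cocycle b).A_comp_A_zero (-t) (H.orb t x)) (v (H.orb t x))
      refine Eq.trans ?_ h1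
      exact congrArg (H.hat b (-t) (H.orb t x)) (e0 (H.orb t x))

theorem lieCovec_epsc : H.LieCovec H.epsc 0 := fun x => by
  have h : ∀ t, H.pull t x (H.epsc (H.orb t x)) = H.epsc x := fun t => by
    ext1 v
    exact H.epsc_push t x v
  simp only [h]
  exact hasDerivAt_const (F := TangentSpace 𝓘(ℝ, E) (x : M) →L[ℝ] ℝ) (0 : ℝ) (H.epsc x)

/-- A covector field read in the trivial bundle. -/
def hatCovec (ξ : (x : H.K) → H.Cotan x) (x : H.K) : (Fin b.n → E) →L[ℝ] ℝ := (ξ x).comp (b.R x)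

theorem holder_hatCovec (ξ : HolderCovec E H.K) : BddHolder b.ι (H.hatCovec b ξ.1) :=
  (b.mem_holderCovec_iff H.isCompact_K).1 ξ.2

theorem hasDerivAt_pull_of_lieCovec {ν μ : (x : H.K) → H.Cotan x} (h : H.LieCovec ν μ) (x : H.K)
    (t : ℝ) : HasDerivAt (fun s => H.pull s x (ν (H.orb s x))) (H.pull t x (μ (H.orb t x))) t := by
  obtain ⟨b⟩ := BumpCover.nonempty_of_isCompact (E := E) H.isCompact_K
  refine (H.hasDerivAt_pull_iff b).2 ?_
  rw [pull_comp_R]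
  refine (H.cocycle b).hasDerivAt_comp_A (m := H.hatCovec b ν) (n := H.hatCovec b μ)
    (fun y => ?_) x t
  refine ((H.hasDerivAt_pull_iff b).1 (h y)).congr_deriv ?_
  have h0 : (b.J y).comp (b.R y) = H.hat b 0 y := (H.hat_zero b y).symm
  have h1 : ((μ y).comp (b.R y)).comp ((b.J y).comp (b.R y)) = (μ y).comp (b.R y) := by
    rw [← ContinuousLinearMap.comp_assoc, comp_R_comp_J]
  rw [h0] at h1
  exact h1.symm

/-- The split-propagate covector field. -/
def adjField (p : H.A) (x : H.K) : H.Cotan x :=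
  ((H.cocycle b).adj (H.hatCovec b (H.om p)) (H.psi p) x).comp (b.J x)

theorem holder_om (p : H.A) : BddHolder b.ι (H.hatCovec b (H.om p)) := H.holder_hatCovec b p.1.1

theorem holder_psi (p : H.A) : BddHolder b.ι (H.psi p) :=
  (b.isHolder_iff H.isCompact_K).1 p.1.2.2

theorem hatCovec_F (ξ : (x : H.K) → H.Cotan x) (x : H.K) :
    H.hatCovec b ξ x (H.hatF b x) = ξ x (H.F x) :=
  congrArg (ξ x) (b.R_J x.2 _)

theorem holder_adj (p : H.A) :
    BddHolder b.ι ((H.cocycle b).adj (H.hatCovec b (H.om p)) (H.psi p)) :=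
  (H.cocycle b).holder_adj (H.holder_om b p) (H.holder_psi b p)

theorem adjField_mem (p : H.A) : H.adjField b p ∈ HolderCovec E H.K := by
  refine (b.mem_holderCovec_iff H.isCompact_K).2 ?_
  have h := (H.holder_adj b p).comp_clm ((H.cocycle b).expHolder_A.at_time 0)
  have e : ∀ x : H.K, (H.adjField b p x).comp (b.R x) =
      ((H.cocycle b).adj (H.hatCovec b (H.om p)) (H.psi p) x).comp (H.hat b 0 x) := fun x => by
    rw [hat_zero]
    rfl
  exact (funext e : _) ▸ h

theorem adjField_F (p : H.A) (x : H.K) : H.adjField b p x (H.F x) = -H.psi p x :=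
  (H.cocycle b).adj_F (H.holder_om b p) (H.psi p) x

theorem lieCovec_adjField (p : H.A) : H.LieCovec (H.adjField b p) (fun x => -H.om p x) :=
  fun x => by
  refine (H.hasDerivAt_pull_iff b).2 ?_
  have hψ : HasDerivAt (fun t => H.psi p ((H.cocycle b).φ t x))
      (H.hatCovec b (H.om p) x ((H.cocycle b).F x)) 0 :=
    HasDerivAt.congr_deriv (p.2 x) (H.hatCovec_F b (H.om p) x).symm
  have h := (H.cocycle b).hasDerivAt_adj (H.holder_om b p) hψ
  have e1 : ∀ s, ((H.adjField b p (H.orb s x)).comp (b.R (H.orb s x))).comp (H.hat b s x) =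
      ((H.cocycle b).adj (H.hatCovec b (H.om p)) (H.psi p) (H.orb s x)).comp (H.hat b s x) :=
    fun s => by
    have := (H.cocycle b).A_zero_comp_A s x
    have h2 : H.hat b 0 (H.orb s x) = (b.J (H.orb s x)).comp (b.R (H.orb s x)) := H.hat_zero b _
    have h3 : ((b.J (H.orb s x)).comp (b.R (H.orb s x))).comp (H.hat b s x) = H.hat b s x := by
      rw [← h2]; exact this
    rw [adjField, ContinuousLinearMap.comp_assoc, ContinuousLinearMap.comp_assoc,
      ← ContinuousLinearMap.comp_assoc (b.J (H.orb s x)), h3]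
  refine (h.congr_deriv ?_).congr_of_eventuallyEq (Eventually.of_forall e1)
  have h0 : (b.J x).comp (b.R x) = H.hat b 0 x := (H.hat_zero b x).symm
  have h1 : ((H.om p x).comp (b.R x)).comp ((b.J x).comp (b.R x)) = (H.om p x).comp (b.R x) := by
    rw [← ContinuousLinearMap.comp_assoc, comp_R_comp_J]
  rw [h0] at h1
  ext1 w
  exact congrArg Neg.neg (DFunLike.congr_fun h1 w)

theorem isBoundedSolution_adjField (p : H.A) :
    H.IsBoundedSolution (H.om p) (H.adjField b p) := by
  refine ⟨?_, H.lieCovec_adjField b p⟩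
  obtain ⟨B, r, hB, -, -, h1, -⟩ := (H.holder_adj b p).exists_bound
  obtain ⟨C, hC, hJ⟩ := b.exists_norm_J_le H.isCompact_K
  refine ⟨B * C, fun x w => ?_⟩
  rw [mul_assoc]
  refine (ContinuousLinearMap.le_opNorm
    ((H.cocycle b).adj (H.hatCovec b (H.om p)) (H.psi p) x) (b.J x w)).trans ?_
  exact mul_le_mul (h1 x) (hJ x x.2 w) (norm_nonneg _) hB

theorem comp_push_eq (P : (x : H.K) → TangentSpace 𝓘(ℝ, E) (x : M) →L[ℝ]
      TangentSpace 𝓘(ℝ, E) (x : M)) (ξ : (x : H.K) → H.Cotan x) (x : H.K) (t : ℝ)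
    (w : TangentSpace 𝓘(ℝ, E) (x : M)) :
    ξ (H.orb t x) (P (H.orb t x) (H.push t x w)) =
      H.hatCovec b ξ (H.orb t x) (b.J (H.orb t x) (P (H.orb t x)
        (b.R (H.orb t x) (H.hat b t x (b.J x w))))) := by
  have h1 : b.R (H.orb t x) (H.hat b t x (b.J x w)) = H.push t x w := by
    rw [← J_push]
    exact b.R_J (H.orb t x).2 _
  rw [h1]
  exact (congrArg (ξ (H.orb t x)) (b.R_J (H.orb t x).2 _)).symm

theorem stablePart_apply (ξ : (x : H.K) → H.Cotan x) (x : H.K) (t : ℝ)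
    (w : TangentSpace 𝓘(ℝ, E) (x : M)) :
    H.stablePart ξ x t w = (H.cocycle b).sPart (H.hatCovec b ξ) x t (b.J x w) :=
  H.comp_push_eq b H.Ps ξ x t w

theorem unstablePart_apply (ξ : (x : H.K) → H.Cotan x) (x : H.K) (t : ℝ)
    (w : TangentSpace 𝓘(ℝ, E) (x : M)) :
    H.unstablePart ξ x (-t) w = (H.cocycle b).reverse.sPart (H.hatCovec b ξ) x t (b.J x w) :=
  H.comp_push_eq b H.Pu ξ x (-t) w

theorem isSplitPropagate_adjField (p : H.A) :
    H.IsSplitPropagate (H.om p) (H.psi p) (H.adjField b p) := by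
  intro x w
  have i1 := (H.cocycle b).integrableOn_sPart (H.holder_om b p) x
  have i2 := (H.cocycle b).reverse.integrableOn_sPart (H.holder_om b p) x
  have j1 : IntegrableOn (fun t => H.stablePart (H.om p) x t w) (Ici 0) := by
    simp only [H.stablePart_apply b]
    exact i1.apply_continuousLinearMap (b.J x w)
  have j2 : IntegrableOn (fun t => H.unstablePart (H.om p) x (-t) w) (Ici 0) := by
    simp only [H.unstablePart_apply b]
    exact i2.apply_continuousLinearMap (b.J x w)
  have j3 : IntegrableOn (fun t => H.unstablePart (H.om p) x t w) (Iic 0) := by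
    have h : IntegrableOn (fun t => H.unstablePart (H.om p) x (-t) w) (Ici (-0)) := by
      rwa [neg_zero]
    simpa using h.comp_neg_Iic
  refine ⟨j1, j3, ?_⟩
  have e1 : ∫ t in Ici (0 : ℝ), H.stablePart (H.om p) x t w =
      (H.cocycle b).sInt (H.hatCovec b (H.om p)) x (b.J x w) := by
    simp only [H.stablePart_apply b]
    exact ((H.cocycle b).sInt_apply (H.holder_om b p) x _).symm
  have e2 : ∫ t in Iic (0 : ℝ), H.unstablePart (H.om p) x t w =
      (H.cocycle b).reverse.sInt (H.hatCovec b (H.om p)) x (b.J x w) := by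
    have h := integral_comp_neg_Ioi (0 : ℝ) (fun t => H.unstablePart (H.om p) x t w)
    rw [neg_zero] at h
    rw [← h, ← integral_Ici_eq_integral_Ioi]
    simp only [H.unstablePart_apply b]
    exact ((H.cocycle b).reverse.sInt_apply (H.holder_om b p) x _).symm
  have e3 : H.epsc x w = ((H.epsc x).comp (b.R x)) (b.J x w) :=
    congrArg (H.epsc x) (b.R_J x.2 w).symm
  rw [e1, e2, e3]
  rfl

theorem isSplitPropagate_iff (p : H.A) (ν : (x : H.K) → H.Cotan x) :
    H.IsSplitPropagate (H.om p) (H.psi p) ν ↔ ν = H.adjField b p := by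
  refine ⟨fun h => ?_, fun h => h ▸ H.isSplitPropagate_adjField b p⟩
  funext x
  ext1 w
  rw [(h x w).2.2, (H.isSplitPropagate_adjField b p x w).2.2]

/-- Linearity is read off the split-propagate formula, whose absolute convergence allows the
integrals to be split. -/
theorem adjField_add (p q : H.A) (x : H.K) :
    H.adjField b (p + q) x = H.adjField b p x + H.adjField b q x := by
  ext1 w
  obtain ⟨i1, j1, e1⟩ := H.isSplitPropagate_adjField b p x w
  obtain ⟨i2, j2, e2⟩ := H.isSplitPropagate_adjField b q x w
  obtain ⟨-, -, e⟩ := H.isSplitPropagate_adjField b (p + q) x w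
  have h1 : ∀ t, H.stablePart (H.om (p + q)) x t w =
    H.stablePart (H.om p) x t w + H.stablePart (H.om q) x t w := fun t => rfl
  have h2 : ∀ t, H.unstablePart (H.om (p + q)) x t w =
    H.unstablePart (H.om p) x t w + H.unstablePart (H.om q) x t w := fun t => rfl
  have h3 : H.psi (p + q) x = H.psi p x + H.psi q x := rfl
  refine e.trans ?_
  simp only [h1, h2, h3]
  rw [integral_add i1 i2, integral_add j1 j2, add_apply, e1, e2]
  ring

theorem adjField_smul (r : ℝ) (p : H.A) (x : H.K) :
    H.adjField b (r • p) x = r • H.adjField b p x := by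
  ext1 w
  obtain ⟨-, -, e1⟩ := H.isSplitPropagate_adjField b p x w
  obtain ⟨-, -, e⟩ := H.isSplitPropagate_adjField b (r • p) x w
  have h1 : ∀ t, H.stablePart (H.om (r • p)) x t w = r * H.stablePart (H.om p) x t w :=
    fun t => rfl
  have h2 : ∀ t, H.unstablePart (H.om (r • p)) x t w = r * H.unstablePart (H.om p) x t w :=
    fun t => rfl
  have h3 : H.psi (r • p) x = r * H.psi p x := rfl
  refine e.trans ?_
  simp only [h1, h2, h3]
  rw [integral_const_mul, integral_const_mul, smul_apply, e1, smul_eq_mul]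
  ring

/-- The adjoint shadowing operator. -/
def adjointShadowing : H.A →ₗ[ℝ] HolderCovec E H.K where
  toFun p := ⟨H.adjField b p, H.adjField_mem b p⟩
  map_add' p q := Subtype.ext (funext fun x => H.adjField_add b p q x)
  map_smul' r p := Subtype.ext (funext fun x => H.adjField_smul b r p x)

theorem isBoundedOrbitSolution_of_isBoundedSolution {ξ ν : (x : H.K) → H.Cotan x}
    (h : H.IsBoundedSolution ξ ν) (x : H.K) :
    H.IsBoundedOrbitSolution ξ x (fun t => ν (H.orb t x)) := by
  obtain ⟨⟨C, hC⟩, hL⟩ := h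
  refine ⟨⟨C, fun t w => hC _ w⟩, fun t => ?_⟩
  have e : H.pull t x (-ξ (H.orb t x)) = -H.pull t x (ξ (H.orb t x)) := by
    ext1 w
    rfl
  rw [← e]
  exact H.hasDerivAt_pull_of_lieCovec hL x t

/-- The pullback of the difference to `x` has zero derivative, hence is constant in time. It
annihilates `F` because `f_*^τ` preserves `F`, and boundedness along the orbit annihilates the
stable and unstable directions. Invertibility of `f_*^t` then gives equality at every time. -/
theorem eq_of_isBoundedOrbitSolution {ξ : (x : H.K) → H.Cotan x} {x : H.K}
    {ν μ : (t : ℝ) → H.Cotan (H.orb t x)} (hν : H.IsBoundedOrbitSolution ξ x ν)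
    (hμ : H.IsBoundedOrbitSolution ξ x μ) {τ : ℝ}
    (hτ : ν τ (H.F (H.orb τ x)) = μ τ (H.F (H.orb τ x))) (t : ℝ) : ν t = μ t := by
  obtain ⟨b⟩ := BumpCover.nonempty_of_isCompact (E := E) H.isCompact_K
  obtain ⟨⟨C, hC⟩, hν⟩ := hν
  obtain ⟨⟨D, hD⟩, hμ⟩ := hμ
  obtain ⟨CR, hCR, hR⟩ := b.exists_norm_R_le H.isCompact_K
  set N : ℝ → (Fin b.n → E) →L[ℝ] ℝ := fun s => (ν s - μ s).comp (b.R (H.orb s x)) with hN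
  have hNe : ∀ s, (N s).comp (H.hat b s x) = ((ν s).comp (b.R (H.orb s x))).comp (H.hat b s x) -
      ((μ s).comp (b.R (H.orb s x))).comp (H.hat b s x) := fun s => rfl
  have hconst : ∀ s, (N s).comp (H.hat b s x) = (N τ).comp (H.hat b τ x) := fun s => by
    refine is_const_of_deriv_eq_zero (f := fun s => (N s).comp (H.hat b s x)) (𝕜 := ℝ) ?_ ?_ s τ
    · intro s
      exact (((H.hasDerivAt_pull_iff b).1 (hν s)).sub
        ((H.hasDerivAt_pull_iff b).1 (hμ s))).differentiableAt
    · intro s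
      have := (((H.hasDerivAt_pull_iff b).1 (hν s)).sub
        ((H.hasDerivAt_pull_iff b).1 (hμ s))).deriv
      rw [sub_self] at this
      exact this
  have hbd : ∀ s, ‖N s‖ ≤ (|C| + |D|) * CR := fun s => by
    refine ContinuousLinearMap.opNorm_le_bound _ (by positivity) fun w => ?_
    set v := b.R (H.orb s x) w with hv
    have h1 : N s w = ν s v - μ s v := rfl
    have h2 : ‖v‖ ≤ CR * ‖w‖ := hR _ (H.orb s x).2 w
    rw [h1, Real.norm_eq_abs]
    calc |ν s v - μ s v| ≤ |ν s v| + |μ s v| := abs_sub _ _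
      _ ≤ |C| * ‖v‖ + |D| * ‖v‖ := add_le_add
          ((hC s v).trans (mul_le_mul_of_nonneg_right (le_abs_self C) (norm_nonneg _)))
          ((hD s v).trans (mul_le_mul_of_nonneg_right (le_abs_self D) (norm_nonneg _)))
      _ = (|C| + |D|) * ‖v‖ := by ring
      _ ≤ (|C| + |D|) * (CR * ‖w‖) := mul_le_mul_of_nonneg_left h2 (by positivity)
      _ = _ := by ring
  have hF : ((N τ).comp (H.hat b τ x)) (H.hatF b x) = 0 := by
    have h1 : H.hat b τ x (H.hatF b x) = H.hatF b (H.orb τ x) := (H.cocycle b).A_F τ x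
    have h2 : b.R (H.orb τ x) (H.hatF b (H.orb τ x)) = H.F (H.orb τ x) :=
      b.R_J (H.orb τ x).2 _
    have h3 : N τ (H.hatF b (H.orb τ x)) = ν τ (H.F (H.orb τ x)) - μ τ (H.F (H.orb τ x)) :=
      congrArg (ν τ - μ τ) h2
    rw [ContinuousLinearMap.comp_apply, h1, h3, hτ, sub_self]
  have h0 := (H.cocycle b).comp_A_zero_eq_zero (x := x) hconst hbd hF
  have h1 : (N t).comp (H.hat b t x) = 0 := by
    rw [hconst t]
    have := (H.cocycle b).A_comp_A_zero τ x
    refine Eq.trans ?_ h0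
    exact congrArg (N τ).comp this.symm
  ext1 v
  have h2 : N t (H.hat b t x (b.J x (H.pushInv b t x v))) = 0 := DFunLike.congr_fun h1 _
  rw [← J_push, push_pushInv] at h2
  have h3 : (ν t - μ t) v = 0 := (congrArg (ν t - μ t) (b.R_J (H.orb t x).2 v)).symm.trans h2
  exact sub_eq_zero.1 h3

theorem isBoundedOrbitSolution_adjField (p : H.A) (x : H.K) :
    H.IsBoundedOrbitSolution (H.om p) x (fun t => H.adjField b p (H.orb t x)) :=
  H.isBoundedOrbitSolution_of_isBoundedSolution (H.isBoundedSolution_adjField b p) x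

theorem isBoundedOrbitSolution_iff (p : H.A) (x : H.K) (ν : (t : ℝ) → H.Cotan (H.orb t x)) :
    ((H.IsBoundedOrbitSolution (H.om p) x ν ∧
        ∃ τ, ν τ (H.F (H.orb τ x)) = -H.psi p (H.orb τ x)) ↔
      ∀ t, ν t = H.adjField b p (H.orb t x)) ∧
    ((H.IsBoundedOrbitSolution (H.om p) x ν ∧
        ∀ τ, ν τ (H.F (H.orb τ x)) = -H.psi p (H.orb τ x)) ↔
      ∀ t, ν t = H.adjField b p (H.orb t x)) := by
  have h1 : ∀ τ, H.IsBoundedOrbitSolution (H.om p) x ν →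
      ν τ (H.F (H.orb τ x)) = -H.psi p (H.orb τ x) → ∀ t, ν t = H.adjField b p (H.orb t x) :=
    fun τ hν hτ => H.eq_of_isBoundedOrbitSolution hν (H.isBoundedOrbitSolution_adjField b p x)
      (hτ.trans (H.adjField_F b p _).symm)
  have h2 : (∀ t, ν t = H.adjField b p (H.orb t x)) → H.IsBoundedOrbitSolution (H.om p) x ν ∧
      ∀ τ, ν τ (H.F (H.orb τ x)) = -H.psi p (H.orb τ x) := fun h => by
    obtain rfl : ν = fun t => H.adjField b p (H.orb t x) := funext h
    exact ⟨H.isBoundedOrbitSolution_adjField b p x, fun τ => H.adjField_F b p _⟩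
  exact ⟨⟨fun ⟨hν, τ, hτ⟩ => h1 τ hν hτ, fun h => ⟨(h2 h).1, 0, (h2 h).2 0⟩⟩,
    ⟨fun ⟨hν, hτ⟩ => h1 0 hν (hτ 0), h2⟩⟩

theorem isBoundedSolution_iff (p : H.A) (ν : (x : H.K) → H.Cotan x) :
    (H.IsBoundedSolution (H.om p) ν ∧ ∀ x, ν x (H.F x) = -H.psi p x) ↔ ν = H.adjField b p := by
  constructor
  · rintro ⟨hν, hF⟩
    funext x
    have h := ((H.isBoundedOrbitSolution_iff b p x fun t => ν (H.orb t x)).2.1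
      ⟨H.isBoundedOrbitSolution_of_isBoundedSolution hν x, fun τ => hF _⟩) 0
    have h2 : ∀ y, y = x → ν y = H.adjField b p y → ν x = H.adjField b p x := by
      rintro y rfl h
      exact h
    exact h2 _ (H.orb_zero x) h
  · rintro rfl
    exact ⟨H.isBoundedSolution_adjField b p, H.adjField_F b p⟩

/-- `M` itself is not assumed second countable; the compact set `K` inherits the property from the
finite-dimensional space that contains its image under `ι`. -/
theorem secondCountableTopology_K : SecondCountableTopology H.K := by
  obtain ⟨b⟩ := BumpCover.nonempty_of_isCompact (E := E) H.isCompact_K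
  have : CompactSpace H.K := isCompact_iff_compactSpace.1 H.isCompact_K
  exact (b.continuous_ι.isClosedEmbedding b.ι_injective).isEmbedding.secondCountableTopology

theorem continuous_apply (ξ : HolderCovec E H.K) (X : HolderVec E H.K) :
    Continuous fun x => ξ.1 x (X.1 x) := by
  obtain ⟨b⟩ := BumpCover.nonempty_of_isCompact (E := E) H.isCompact_K
  have h0 : BddHolder b.ι (fun x => H.hatCovec b ξ.1 x (b.J x (X.1 x))) :=
    (H.holder_hatCovec b ξ).clm_apply ((b.mem_holderVec_iff H.isCompact_K).1 X.2)
  have h := h0.continuous b.continuous_ι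
  have e : ∀ x : H.K, H.hatCovec b ξ.1 x (b.J x (X.1 x)) = ξ.1 x (X.1 x) :=
    fun x => congrArg (ξ.1 x) (b.R_J x.2 _)
  exact (funext e : _) ▸ h

theorem continuous_holderFun (η : HolderFun E H.K) : Continuous η.1 := by
  obtain ⟨b⟩ := BumpCover.nonempty_of_isCompact (E := E) H.isCompact_K
  exact ((b.isHolder_iff H.isCompact_K).1 η.2).continuous b.continuous_ι

/-- The product rule for `ν_t(v_t) = (f^{*t} ν_t)((f_*^t)⁻¹ v_t)`: the covector contributes `-ω(v)`
and the vector `ν(X - η F)`, where `ν(F) = -ψ`. -/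
theorem hasDerivAt_adjField_apply {p : H.A} {X v : HolderVec E H.K} {η : HolderFun E H.K}
    (h : H.IsShadowingPair X v η) (x : H.K) :
    HasDerivAt (fun t => H.adjField b p (H.orb t x) (v.1 (H.orb t x)))
      (-H.om p x (v.1 x) + H.adjField b p x (X.1 x) + η.1 x * H.psi p x) 0 := by
  have h1 := (H.hasDerivAt_pull_iff b).1 (H.lieCovec_adjField b p x)
  have h2 := (H.lieVec_iff b).1 h x
  have e1 : ∀ t, ((H.adjField b p (H.orb t x)).comp (b.R (H.orb t x))).comp (H.hat b t x)
      (H.hat b (-t) (H.orb t x) (b.J (H.orb t x) (v.1 (H.orb t x)))) =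
      H.adjField b p (H.orb t x) (v.1 (H.orb t x)) := fun t => by
    have a1 : H.hat b t x (H.hat b (-t) (H.orb t x) (b.J (H.orb t x) (v.1 (H.orb t x)))) =
        H.hat b 0 (H.orb t x) (b.J (H.orb t x) (v.1 (H.orb t x))) :=
      DFunLike.congr_fun ((H.cocycle b).A_comp_A_neg t x) _
    rw [hat_zero, ContinuousLinearMap.comp_apply, b.R_J (H.orb t x).2] at a1
    rw [ContinuousLinearMap.comp_apply, a1]
    exact congrArg (H.adjField b p (H.orb t x)) (b.R_J (H.orb t x).2 _)
  have h3 := h1.clm_apply h2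
  refine (h3.congr_deriv ?_).congr_of_eventuallyEq (Eventually.of_forall fun t => (e1 t).symm)
  have e0 : H.orb 0 x = x := H.orb_zero x
  have a1 : ((-H.om p x).comp (b.R x)) (H.hat b (-0) (H.orb 0 x) (b.J (H.orb 0 x)
      (v.1 (H.orb 0 x)))) = -H.om p x (v.1 x) := by
    rw [neg_zero, e0, hat_zero, ContinuousLinearMap.comp_apply (b.J x), b.R_J x.2]
    exact congrArg (fun w => -H.om p x w) (b.R_J x.2 _)
  have a2 : ((H.adjField b p (H.orb 0 x)).comp (b.R (H.orb 0 x))).comp (H.hat b 0 x)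
      (b.J x (X.1 x - η.1 x • H.F x)) =
      H.adjField b p x (X.1 x) + η.1 x * H.psi p x := by
    rw [e0, hat_zero, ContinuousLinearMap.comp_apply _ ((b.J x).comp (b.R x)),
      ContinuousLinearMap.comp_apply (b.J x), b.R_J x.2]
    refine (congrArg (H.adjField b p x) (b.R_J x.2 _)).trans ?_
    have := map_sub (H.adjField b p x) (X.1 x) (η.1 x • H.F x)
    rw [map_smul, adjField_F, smul_eq_mul] at this
    rw [this]
    ring
  refine (congrArg₂ (· + ·) a1 a2).trans ?_
  ring

/-! ### The adjoint property and its uniqueness, and time averages. -/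

variable [MeasurableSpace M] [BorelSpace M] {ρ : Measure H.K} [IsProbabilityMeasure ρ]

theorem isAdjointAt_adjointShadowing (hρ : H.IsInvariantMeasure ρ) (p : H.A) :
    H.IsAdjointAt ρ p (H.adjointShadowing b p) := by
  have : CompactSpace H.K := isCompact_iff_compactSpace.1 H.isCompact_K
  have := H.secondCountableTopology_K
  intro X v η h
  have c1 := H.continuous_apply p.1.1 v
  have c2 := H.continuous_apply (H.adjointShadowing b p) X
  have c3 : Continuous fun x => η.1 x * H.psi p x :=
    (H.continuous_holderFun η).mul (H.continuous_holderFun p.1.2)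
  have h0 := integral_deriv_along_flow_eq_zero H.orb_add hρ
    (H.continuous_apply (H.adjointShadowing b p) v) ((c1.neg.add c2).add c3) H.orb_zero
    (fun x => H.hasDerivAt_adjField_apply b h x)
  have i1 : Integrable (fun x => p.1.1.1 x (v.1 x)) ρ := integrable_of_continuous c1
  have i2 : Integrable (fun x => (H.adjointShadowing b p).1 x (X.1 x)) ρ :=
    integrable_of_continuous c2
  have i3 : Integrable (fun x => η.1 x * H.psi p x) ρ := integrable_of_continuous c3
  have h1 := integral_add (i1.neg.add i2) i3
  have h2 := integral_add i1.neg i2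
  have h3 := integral_neg (μ := ρ) (fun x => p.1.1.1 x (v.1 x))
  simp only [Pi.add_apply, Pi.neg_apply] at h0 h1 h2 h3
  rw [h0, h2, h3] at h1
  rw [product]
  linarith

/-- Because every Hölder `X` has a shadowing pair, the difference of two adjoint covector fields
integrates to zero against all such `X`. -/
theorem isAdjointAt_iff (hρ : H.IsInvariantMeasure ρ) (p : H.A) (ν : HolderCovec E H.K) :
    H.IsAdjointAt ρ p ν ↔ ∀ᵐ x ∂ρ, ν.1 x = (H.adjointShadowing b p).1 x := by
  have : CompactSpace H.K := isCompact_iff_compactSpace.1 H.isCompact_K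
  have := H.secondCountableTopology_K
  have hS := H.isAdjointAt_adjointShadowing b hρ p
  constructor
  · intro hν
    set μ : HolderCovec E H.K := ν - H.adjointShadowing b p with hμ
    have h0 : ∀ X : HolderVec E H.K, ∫ x, μ.1 x (X.1 x) ∂ρ = 0 := fun X => by
      obtain ⟨v, η, h⟩ := H.exists_isShadowingPair X
      have i1 : Integrable (fun x => ν.1 x (X.1 x)) ρ :=
        integrable_of_continuous (H.continuous_apply ν X)
      have i2 : Integrable (fun x => (H.adjointShadowing b p).1 x (X.1 x)) ρ :=
        integrable_of_continuous (H.continuous_apply _ X)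
      refine (integral_sub i1 i2).trans ?_
      rw [← hν X v η h, ← hS X v η h, sub_self]
    have hμ' := H.holder_hatCovec b μ
    let B := Module.finBasis ℝ (Fin b.n → E)
    have h1 : ∀ j, ∀ᵐ x ∂ρ, H.hatCovec b μ.1 x (B j) = 0 := fun j => by
      have hc : BddHolder b.ι fun x => H.hatCovec b μ.1 x (B j) :=
        hμ'.clm_apply (ExpHolder.const (B j))
      have e0 : ∀ x : H.K, b.J x (H.hatCovec b μ.1 x (B j) • b.R x (B j)) =
          H.hatCovec b μ.1 x (B j) • H.hat b 0 x (B j) := fun x => by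
        rw [hat_zero, map_smul]
        rfl
      -- For this test field `μ(X)` is the square of the `j`-th component of `μ` in the trivial
      -- bundle, so that component vanishes almost everywhere.
      let X : HolderVec E H.K := ⟨fun x => H.hatCovec b μ.1 x (B j) • b.R x (B j),
        (b.mem_holderVec_iff H.isCompact_K).2 (by
          simp only [e0]
          exact hc.smul (((H.cocycle b).expHolder_A.at_time 0).clm_apply
            (ExpHolder.const (B j))))⟩
      have h2 : ∫ x, H.hatCovec b μ.1 x (B j) ^ 2 ∂ρ = 0 := by
        rw [← h0 X]
        refine integral_congr_ae (ae_of_all _ fun x => ?_)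
        have : μ.1 x (X.1 x) = H.hatCovec b μ.1 x (B j) * μ.1 x (b.R x (B j)) :=
          map_smul (μ.1 x) _ _
        refine Eq.trans ?_ this.symm
        exact sq _
      have hcc : Continuous fun x => H.hatCovec b μ.1 x (B j) := hc.continuous b.continuous_ι
      have h3 := (integral_eq_zero_iff_of_nonneg (fun x => sq_nonneg _)
        (integrable_of_continuous (ρ := ρ) (hcc.pow 2))).1 h2
      filter_upwards [h3] with x hx
      exact pow_eq_zero_iff two_ne_zero |>.1 hx
    filter_upwards [ae_all_iff.2 h1] with x hx
    have h2 : H.hatCovec b μ.1 x = 0 :=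
      ContinuousLinearMap.coe_injective (B.ext hx)
    have h3 : μ.1 x = 0 := by
      rw [← H.comp_R_comp_J b (μ.1 x)]
      exact congrArg (fun m => m.comp (b.J x)) h2
    exact sub_eq_zero.1 h3
  · intro h X v η hX
    rw [hS X v η hX]
    refine integral_congr_ae ?_
    filter_upwards [h] with x hx
    rw [hx]

theorem eq_of_ae_eq [ρ.IsOpenPosMeasure] {ν μ : HolderCovec E H.K}
    (h : ∀ᵐ x ∂ρ, ν.1 x = μ.1 x) : ν = μ := by
  obtain ⟨b⟩ := BumpCover.nonempty_of_isCompact (E := E) H.isCompact_K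
  have h1 : H.hatCovec b ν.1 =ᵐ[ρ] H.hatCovec b μ.1 := by
    filter_upwards [h] with x hx
    exact congrArg (fun m => m.comp (b.R x)) hx
  have h2 := (((H.holder_hatCovec b ν).continuous b.continuous_ι).ae_eq_iff_eq ρ
    ((H.holder_hatCovec b μ).continuous b.continuous_ι)).1 h1
  refine Subtype.ext (funext fun x => ?_)
  rw [← H.comp_R_comp_J b (ν.1 x), ← H.comp_R_comp_J b (μ.1 x)]
  exact congrArg (fun m => m.comp (b.J x)) (congrFun h2 x)

theorem forall_isAdjointAt_iff [ρ.IsOpenPosMeasure] (hρ : H.IsInvariantMeasure ρ)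
    (T : H.A →ₗ[ℝ] HolderCovec E H.K) :
    (∀ p, H.IsAdjointAt ρ p (T p)) ↔ T = H.adjointShadowing b := by
  refine ⟨fun h => LinearMap.ext fun p => H.eq_of_ae_eq ((H.isAdjointAt_iff b hρ p _).1 (h p)), ?_⟩
  rintro rfl
  exact H.isAdjointAt_adjointShadowing b hρ

theorem ae_tendsto_average (hρ : H.IsInvariantMeasure ρ) (herg : H.IsErgodicMeasure ρ)
    (ξ : HolderCovec E H.K) (X : HolderVec E H.K) :
    ∀ᵐ x ∂ρ, Tendsto (fun T : ℝ => T⁻¹ * ∫ t in (0 : ℝ)..T, ξ.1 (H.orb t x) (X.1 (H.orb t x)))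
      atTop (𝓝 (∫ x, ξ.1 x (X.1 x) ∂ρ)) := by
  have : CompactSpace H.K := isCompact_iff_compactSpace.1 H.isCompact_K
  have := H.secondCountableTopology_K
  exact ae_tendsto_flow_average H.continuous_orb H.orb_add H.orb_zero hρ herg
    (H.continuous_apply ξ X)

/-! ### Smooth observables. -/

section Observable

variable {Φ : M → ℝ} (hΦ : ContMDiff 𝓘(ℝ, E) 𝓘(ℝ, ℝ) ∞ Φ)
include hΦ

omit [IsContMDiffRiemannianBundle 𝓘(ℝ, E) ∞ E (fun x : M => TangentSpace 𝓘(ℝ, E) x)]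
  [MeasurableSpace M] [BorelSpace M]

theorem contMDiffAt_mfderiv_comp_R {x₀ : M} (hx₀ : x₀ ∈ H.K) :
    ContMDiffAt 𝓘(ℝ, E) 𝓘(ℝ, (Fin b.n → E) →L[ℝ] ℝ) ∞
      (fun x => (show TangentSpace 𝓘(ℝ, E) x →L[ℝ] ℝ from mfderiv 𝓘(ℝ, E) 𝓘(ℝ, ℝ) Φ x).comp
        (b.R x)) x₀ := by
  have h := (hΦ x₀).mfderiv_const (m := ∞) (by simp)
  refine (h.clm_comp (b.contMDiffAt_R hx₀)).congr_of_eventuallyEq ?_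
  filter_upwards [BumpCover.eventually_mem_baseSet (E := E) x₀] with x hx
  ext1 w
  have a1 := Trivialization.symmL_continuousLinearMapAt
    (trivializationAt E (TangentSpace 𝓘(ℝ, E)) x₀) (R := ℝ) hx (b.R x w)
  refine (congrArg (mfderiv 𝓘(ℝ, E) 𝓘(ℝ, ℝ) Φ x) a1).symm.trans ?_
  have a2 : ∀ r : ℝ, (trivializationAt ℝ (TangentSpace 𝓘(ℝ, ℝ)) (Φ x₀)).continuousLinearMapAt ℝ
      (Φ x) r = r := fun r => by
    rw [TangentBundle.continuousLinearMapAt_model_space]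
    rfl
  exact (a2 _).symm

theorem mfderiv_mem_holderCovec :
    (fun x : H.K => (mfderiv 𝓘(ℝ, E) 𝓘(ℝ, ℝ) Φ x : H.Cotan x)) ∈ HolderCovec E H.K := by
  obtain ⟨b⟩ := BumpCover.nonempty_of_isCompact (E := E) H.isCompact_K
  exact (b.mem_holderCovec_iff H.isCompact_K).2 (b.bddHolder_of_contMDiffAt H.isCompact_K
    fun x hx => (H.contMDiffAt_mfderiv_comp_R b hΦ hx).of_le (by simp))

theorem sub_const_mem_holderFun (r : ℝ) : (fun x : H.K => Φ x - r) ∈ HolderFun E H.K := by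
  obtain ⟨b⟩ := BumpCover.nonempty_of_isCompact (E := E) H.isCompact_K
  exact (b.isHolder_iff H.isCompact_K).2 (b.bddHolder_of_contMDiffAt H.isCompact_K
    fun x _ => ((hΦ.sub contMDiff_const) x).of_le (by simp))

theorem lieFun_sub_const (r : ℝ) : H.LieFun (fun x => Φ x - r)
    (fun x => mfderiv 𝓘(ℝ, E) 𝓘(ℝ, ℝ) Φ x (H.F x)) := by
  intro x
  refine HasDerivAt.sub_const r ?_
  have h1 : HasMFDerivAt 𝓘(ℝ, ℝ) 𝓘(ℝ, E) (fun s => H.f s x) (0 : ℝ)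
      ((1 : ℝ →L[ℝ] ℝ).smulRight (H.F (H.f 0 x))) := H.integralCurve x 0
  have h2 : HasMFDerivAt 𝓘(ℝ, E) 𝓘(ℝ, ℝ) Φ (H.f 0 x) (mfderiv 𝓘(ℝ, E) 𝓘(ℝ, ℝ) Φ (H.f 0 x)) :=
    (hΦ.mdifferentiable (by simp) _).hasMFDerivAt
  have h3 := hasMFDerivAt_iff_hasFDerivAt.1 (h2.comp (0 : ℝ) h1)
  have h4 : ∀ y : M, y = x → ((mfderiv 𝓘(ℝ, E) 𝓘(ℝ, ℝ) Φ y).comp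
      ((1 : ℝ →L[ℝ] ℝ).smulRight (H.F y)) : ℝ →L[ℝ] ℝ) =
      (1 : ℝ →L[ℝ] ℝ).smulRight (mfderiv 𝓘(ℝ, E) 𝓘(ℝ, ℝ) Φ x (H.F x) : ℝ) := by
    rintro y rfl
    ext1
    have h5 : ∀ w : E, ((1 : ℝ →L[ℝ] ℝ).smulRight w) (1 : ℝ) = w := fun w => by simp
    have h6 : ∀ w : ℝ, ((1 : ℝ →L[ℝ] ℝ).smulRight w) (1 : ℝ) = w := fun w => by simp
    exact (congrArg (mfderiv 𝓘(ℝ, E) 𝓘(ℝ, ℝ) Φ x) (h5 (H.F x))).trans (h6 _).symm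
  have h5 : HasFDerivAt (fun s => Φ (H.f s x))
      ((1 : ℝ →L[ℝ] ℝ).smulRight (mfderiv 𝓘(ℝ, E) 𝓘(ℝ, ℝ) Φ x (H.F x) : ℝ)) 0 :=
    (h4 _ (H.f.map_zero_apply x)) ▸ h3
  have h6 : ∀ w : ℝ, ((1 : ℝ →L[ℝ] ℝ).smulRight w) (1 : ℝ) = w := fun w => by simp
  exact h5.hasDerivAt.congr_deriv (h6 _)

end Observable

end HyperbolicFlow

end AdjointShadowing

end

/-! ### The theorem on the adjoint shadowing operator. -/

theorem theorem2 {E M : Type*} [NormedAddCommGroup E] [NormedSpace ℝ E] [FiniteDimensional ℝ E]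
    [TopologicalSpace M] [T2Space M] [ChartedSpace E M] [IsManifold 𝓘(ℝ, E) ∞ M]
    [RiemannianBundle (fun x : M => TangentSpace 𝓘(ℝ, E) x)]
    [IsContMDiffRiemannianBundle 𝓘(ℝ, E) ∞ E (fun x : M => TangentSpace 𝓘(ℝ, E) x)]
    [MeasurableSpace M] [BorelSpace M]
    (H : AdjointShadowing.HyperbolicFlow E M)
    (ρ : Measure H.K) [IsProbabilityMeasure ρ] (hρ : H.IsInvariantMeasure ρ) :
    -- every Hölder vector field has a shadowing pair
    (∀ X, ∃ v η, H.IsShadowingPair X v η) ∧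
    -- `ε^c` is the homogeneous adjoint solution in the center direction with `ε^c(F) = 1`
    (H.LieCovec H.epsc 0 ∧
      ∀ x, (H.epsc x).comp (H.Pc x) = H.epsc x ∧ H.epsc x (H.F x) = 1) ∧
    ∃ S : H.A →ₗ[ℝ] AdjointShadowing.HolderCovec E H.K,
      -- (a) `S` is adjoint to the shadowing operator, and is determined by this `ρ`-a.e.
      ((∀ p, H.IsAdjointAt ρ p (S p)) ∧
        (∀ p ν, H.IsAdjointAt ρ p ν ↔ ∀ᵐ x ∂ρ, ν.1 x = (S p).1 x) ∧
        (ρ.IsOpenPosMeasure → ∀ T : H.A →ₗ[ℝ] AdjointShadowing.HolderCovec E H.K,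
          (∀ p, H.IsAdjointAt ρ p (T p)) ↔ T = S)) ∧
      -- (b) `S` is given by the split-propagate formula
      (∀ p ν, H.IsSplitPropagate (H.om p) (H.psi p) ν ↔ ν = (S p).1) ∧
      -- (c) `S p` is the unique bounded solution of the adjoint equation: as a field on `K` ...
      (∀ p ν, (H.IsBoundedSolution (H.om p) ν ∧ ∀ x, ν x (H.F x) = -H.psi p x) ↔
        ν = (S p).1) ∧
      -- ... and along every orbit, with the constraint at some time or at all times
      (∀ p x ν, ((H.IsBoundedOrbitSolution (H.om p) x ν ∧
          ∃ τ, ν τ (H.F (H.orb τ x)) = -H.psi p (H.orb τ x)) ↔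
            ∀ t, ν t = (S p).1 (H.orb t x)) ∧
        ((H.IsBoundedOrbitSolution (H.om p) x ν ∧
          ∀ τ, ν τ (H.F (H.orb τ x)) = -H.psi p (H.orb τ x)) ↔
            ∀ t, ν t = (S p).1 (H.orb t x))) ∧
      -- the shadowing contribution of an observable `Φ`
      (∀ Φ : M → ℝ, ContMDiff 𝓘(ℝ, E) 𝓘(ℝ, ℝ) ∞ Φ →
        ∃ p : H.A, (∀ x, H.om p x = mfderiv 𝓘(ℝ, E) 𝓘(ℝ, ℝ) Φ x) ∧
          (∀ x, H.psi p x = Φ x - ∫ y, Φ y ∂ρ) ∧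
          ∀ X v η, H.IsShadowingPair X v η →
            H.product ρ v η p = ∫ x, (S p).1 x (X.1 x) ∂ρ ∧
            (H.IsErgodicMeasure ρ → ∀ᵐ x ∂ρ, Tendsto
              (fun T : ℝ => T⁻¹ * ∫ t in (0 : ℝ)..T, (S p).1 (H.orb t x) (X.1 (H.orb t x)))
              atTop (𝓝 (H.product ρ v η p)))) := by
  -- The operator is built from one fixed cover; the split-propagate formula shows that its values
  -- do not depend on that choice.
  obtain ⟨b⟩ := AdjointShadowing.BumpCover.nonempty_of_isCompact (E := E) H.isCompact_K
  refine ⟨H.exists_isShadowingPair,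
    ⟨H.lieCovec_epsc, fun x => ⟨H.epsc_comp_Pc x, H.epsc_F x⟩⟩, H.adjointShadowing b,
    ⟨H.isAdjointAt_adjointShadowing b hρ, H.isAdjointAt_iff b hρ,
      fun _ => H.forall_isAdjointAt_iff b hρ⟩,
    H.isSplitPropagate_iff b, H.isBoundedSolution_iff b, H.isBoundedOrbitSolution_iff b,
    fun Φ hΦ => ?_⟩
  refine ⟨⟨(⟨_, H.mfderiv_mem_holderCovec hΦ⟩, ⟨_, H.sub_const_mem_holderFun hΦ (∫ y, Φ y ∂ρ)⟩),
    H.lieFun_sub_const hΦ _⟩, fun _ => rfl, fun _ => rfl, fun X v η h => ?_⟩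
  have hS := fun p => H.isAdjointAt_adjointShadowing b hρ p X v η h
  refine ⟨hS _, fun herg => ?_⟩
  rw [hS]
  exact H.ae_tendsto_average hρ herg _ X
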